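/- Let $G=SU(2)$ and let $LG$ be the group of smooth loops $S^1\to G$. Let $S^1$ act on $LG$ by $z\gamma z^{-1}$, where $z\in S^1$ is identified with $\mathrm{diag}(1,z)\in U(2)$ and conjugation is pointwise, and let $LG\rtimes S^1$ be the semidirect product, $(\gamma,z)(\gamma',z')=(\gamma\cdot z\gamma'z^{-1},zz')$. All spaces below carry their standard smooth structures (smooth maps from $\mathbb R^n$ to $LG$ being the maps $P$ with $(x,z)\mapsto P(x)(z)$ smooth), and forms are complex valued. **The bisimplicial manifold.** Put $NLG(p)\rtimes NS^1(q)=LG^p\times (S^1)^q$. The horizontal face operators $\varepsilon_i^{LG}$ are those of the nerve of $LG$: $\varepsilon_0$ drops $\gamma_1$, $\varepsilon_p$ drops $\gamma_p$, and $\varepsilon_i$ replaces $\gamma_i,\gamma_{i+1}$ by $\gamma_i\gamma_{i+1}$ for $0<i<p$. The vertical ones are those of the nerve of $S^1$ on $(z_1,\dots,z_q)$, leaving $\vec\gamma$ unchanged, except that $\varepsilon_q^{S^1}(\vec\gamma,z_1,\dots,z_q)=(z_q\vec\gamma z_q^{-1},z_1,\dots,z_{q-1})$. The triple complex is $\Omega^{p,q,r}=\Omega^r(NLG(p)\rtimes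 NS^1(q))$ with the differentials $$d'=\sum_i(-1)^i(\varepsilon_i^{LG})^*,\qquad d''=(-1)^p\sum_i(-1)^i(\varepsilon_i^{S^1})^*,\qquad d'''=(-1)^{p+q}d .$$ **The bundle.** Let $\nu=\left(\frac1{2\pi i}\right)^2\frac{-1}{6}\mathrm{tr}(h^{-1}dh)^3\in\Omega^3(G)$ and $C_{2,2}=\left(\frac1{2\pi i}\right)^2\frac12\mathrm{tr}(h_2^{-1}h_1^{-1}dh_1dh_2)\in\Omega^2(G\times G)$. Let $Q\to LG$ be the $U(1)$-bundle whose fibre over $\gamma$ consists of the classes $[\sigma,w]$ of pairs of a smooth path $\sigma:[0,1]\to LG$ from the constant loop $1$ to $\gamma$ and $w\in U(1)$, where $(\sigma,w)\sim(\sigma',w')$ iff $w=w'\exp\left(\int_{I^2\times S^1}2\pi i\,F^*\nu\right)$ for a smooth homotopy $F$ from $\sigma$ to $\sigma'$ with fixed ends. The circle acts on $Q$ over its action on $LG$ by $z[\sigma,w]z^{-1}=[z\sigma z^{-1},w]$. Let $\theta$ be any connection form on $Q$, and let $c_1(\theta)\in\Omega^2(LG)$ be the form whose pullback to $Q$ is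 $\frac{-1}{2\pi i}d\theta$. Let $\delta\theta$ be the connection induced by $\theta$ on $\delta Q=\varepsilon_0^*Q\otimes(\varepsilon_1^*Q)^{\otimes-1}\otimes\varepsilon_2^*Q$ over $LG\times LG$, let $s_L$ be the section of $\delta Q$ given by $$s_L(\gamma_1,\gamma_2)=\left([\sigma_2,1]\otimes[\sigma_1\sigma_2,1]^{\otimes-1}\otimes[\sigma_1,1]\right)\cdot\exp\left(\int_{I\times S^1}2\pi i\,(\sigma_1,\sigma_2)^*C_{2,2}\right)$$ for any paths $\sigma_j$ from $1$ to $\gamma_j$, and put $\beta=\frac{-1}{2\pi i}s_L^*(\delta\theta)\in\Omega^1(LG\times LG)$. Let $\delta_\rtimes\theta$ be the connection induced by $\theta$ on $((\varepsilon_0^{S^1})^*Q)^{\otimes-1}\otimes(\varepsilon_1^{S^1})^*Q$ over $LG\rtimes S^1$, and let $s_\rtimes$ be the section $$s_\rtimes(\gamma,z)=(\hat\gamma,z)^{\otimes-1}\otimes(z\hat\gamma z^{-1},z),\qquad \hat\gamma\in Q\text{ any point over }\gamma .$$ **Claim.** The forms $c_1(\theta)$, $\delta\theta$, $\delta_\rtimes\theta$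 and the smooth sections $s_L$, $s_\rtimes$ exist and are uniquely determined by these descriptions, and the 1-form $\tau=\frac{-1}{2\pi i}s_\rtimes^*(\delta_\rtimes\theta)$ on $LG\rtimes S^1$ satisfies 1. $d\tau=(-\varepsilon_0^{S^1*}+\varepsilon_1^{S^1*})\,c_1(\theta)$ on $LG\rtimes S^1$; 2. $(\varepsilon_0^{LG*}-\varepsilon_1^{LG*}+\varepsilon_2^{LG*})\,\tau=(-\varepsilon_0^{S^1*}+\varepsilon_1^{S^1*})\,\beta$ on $NLG(2)\rtimes NS^1(1)$; 3. $(-\varepsilon_0^{S^1*}+\varepsilon_1^{S^1*}-\varepsilon_2^{S^1*})\,\tau=0$ on $NLG(1)\rtimes NS^1(2)$. Consequently $c_1(\theta)-\beta-\tau$, with components in $\Omega^{1,0,2}$, $\Omega^{2,0,1}$ and $\Omega^{1,1,1}$, is a 3-cocycle of the total complex of $\Omega^{*,*,*}$ with differential $d'+d''+d'''$, and its restriction to $\Omega^3(NLG)$ (the part with $q=0$) is the Dixmier–Douady cocycle $c_1(\theta)-\beta$ of the loop group. -/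

import Mathlib

open scoped ContDiff Topology
open Diffeology

noncomputable section

namespace LoopTriple

/-! ## Diffeological constructions

Infinite-dimensional manifolds (loop spaces, bundles over them) are treated as diffeological
spaces; a plot is a smooth map from some `ℝⁿ`. -/

abbrev Eu (n : ℕ) : Type := EuclideanSpace ℝ (Fin n)

theorem exists_local_id {n : ℕ} {x : Eu n} {u : Set (Eu n)} (hu : IsOpen u) (hx : x ∈ u) :
    ∃ f : Eu n → Eu n, ContDiff ℝ ∞ f ∧ (∀ y, f y ∈ u) ∧ ∀ᶠ y in 𝓝 x, f y = y := by
  obtain ⟨ε, hε, hb⟩ := Metric.isOpen_iff.mp hu x hx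
  let b : ContDiffBump x := ⟨ε / 2, ε, by positivity, by linarith⟩
  refine ⟨fun y => x + b y • (y - x), ?_, ?_, ?_⟩
  · exact contDiff_const.add (b.contDiff.smul (contDiff_id.sub contDiff_const))
  · intro y
    apply hb
    rw [Metric.mem_ball, dist_eq_norm, add_sub_cancel_left, norm_smul, Real.norm_eq_abs,
      abs_of_nonneg b.nonneg]
    by_cases hy : dist y x < ε
    · rw [dist_eq_norm] at hy
      exact lt_of_le_of_lt (mul_le_of_le_one_left (norm_nonneg _) b.le_one) hy
    · rw [b.zero_of_le_dist (not_lt.mp hy), zero_mul]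
      exact hε
  · filter_upwards [b.eventuallyEq_one] with y hy
    simp [hy]

instance prodDiffeology {X Y : Type} [DiffeologicalSpace X] [DiffeologicalSpace Y] :
    DiffeologicalSpace (X × Y) where
  plots n := {p | IsPlot (fun x => (p x).1) ∧ IsPlot (fun x => (p x).2)}
  constant_plots _ := ⟨isPlot_const, isPlot_const⟩
  plot_reparam hp hf := ⟨isPlot_reparam hp.1 hf, isPlot_reparam hp.2 hf⟩
  locality h := by
    constructor
    · refine DiffeologicalSpace.locality fun x => ?_
      obtain ⟨u, hu, hx, H⟩ := h x
      exact ⟨u, hu, hx, fun hf hc => (H hf hc).1⟩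
    · refine DiffeologicalSpace.locality fun x => ?_
      obtain ⟨u, hu, hx, H⟩ := h x
      exact ⟨u, hu, hx, fun hf hc => (H hf hc).2⟩

instance piDiffeology {ι : Type} {X : ι → Type} [∀ i, DiffeologicalSpace (X i)] :
    DiffeologicalSpace (∀ i, X i) where
  plots n := {p | ∀ i, IsPlot (fun x => p x i)}
  constant_plots _ _ := isPlot_const
  plot_reparam hp hf i := isPlot_reparam (hp i) hf
  locality h i := by
    refine DiffeologicalSpace.locality fun x => ?_
    obtain ⟨u, hu, hx, H⟩ := h x
    exact ⟨u, hu, hx, fun hf hc => H hf hc i⟩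

instance subtypeDiffeology {X : Type} [DiffeologicalSpace X] {P : X → Prop} :
    DiffeologicalSpace {x : X // P x} where
  plots n := {p | IsPlot (fun x => (p x).1)}
  constant_plots _ := isPlot_const
  plot_reparam hp hf := isPlot_reparam hp hf
  locality h := by
    refine DiffeologicalSpace.locality (p := fun x => (_ : {x : X // P x}).1) fun x => ?_
    obtain ⟨u, hu, hx, H⟩ := h x
    exact ⟨u, hu, hx, fun hf hc => H hf hc⟩

/-- Quotient diffeology: the plots are the maps that locally lift to plots. -/
instance quotDiffeology {X : Type} [DiffeologicalSpace X] {r : X → X → Prop} :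
    DiffeologicalSpace (Quot r) where
  plots n := {p | ∀ x, ∃ q : Eu n → X, IsPlot q ∧ ∀ᶠ y in 𝓝 x, Quot.mk r (q y) = p y}
  constant_plots a x := by
    obtain ⟨a, rfl⟩ := Quot.exists_rep a
    exact ⟨fun _ => a, isPlot_const, Filter.Eventually.of_forall fun _ => rfl⟩
  plot_reparam {n m p f} hp hf x := by
    obtain ⟨q, hq, he⟩ := hp (f x)
    exact ⟨q ∘ f, isPlot_reparam hq hf, hf.continuous.continuousAt.eventually he⟩
  locality {n p} h x := by
    obtain ⟨u, hu, hx, H⟩ := h x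
    obtain ⟨f, hf, hfu, hfx⟩ := exists_local_id hu hx
    obtain ⟨q, hq, he⟩ := H hfu hf x
    refine ⟨q, hq, ?_⟩
    filter_upwards [he, hfx] with y h1 h2
    rw [h1, Function.comp_apply, h2]

/-- Smooth maps of diffeological spaces. -/
structure SmoothMap (X Y : Type) [DiffeologicalSpace X] [DiffeologicalSpace Y] where
  toFun : X → Y
  smooth : DSmooth toFun

instance {X Y : Type} [DiffeologicalSpace X] [DiffeologicalSpace Y] :
    CoeFun (SmoothMap X Y) (fun _ => X → Y) := ⟨SmoothMap.toFun⟩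

def SmoothMap.comp {X Y Z : Type} [DiffeologicalSpace X] [DiffeologicalSpace Y]
    [DiffeologicalSpace Z] (g : SmoothMap Y Z) (f : SmoothMap X Y) : SmoothMap X Z :=
  ⟨fun x => g (f x), g.smooth.comp f.smooth⟩

section
variable {X Y : Type} [DiffeologicalSpace X] [DiffeologicalSpace Y]

def fstMap : SmoothMap (X × Y) X := ⟨Prod.fst, fun _ _ hp => hp.1⟩

def sndMap : SmoothMap (X × Y) Y := ⟨Prod.snd, fun _ _ hp => hp.2⟩

def valMap {P : X → Prop} : SmoothMap {x : X // P x} X := ⟨Subtype.val, fun _ _ hp => hp⟩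

def quotMap (r : X → X → Prop) : SmoothMap X (Quot r) :=
  ⟨Quot.mk r, fun _ p hp _ => ⟨p, hp, Filter.Eventually.of_forall fun _ => rfl⟩⟩

theorem isPlot_of_eventuallyEq {n : ℕ} {p : Eu n → X}
    (h : ∀ x, ∃ q : Eu n → X, IsPlot q ∧ ∀ᶠ y in 𝓝 x, q y = p y) : IsPlot p := by
  refine DiffeologicalSpace.locality fun x => ?_
  obtain ⟨q, hq, he⟩ := h x
  obtain ⟨u, hu, ho, hx⟩ := eventually_nhds_iff.mp he
  refine ⟨u, ho, hx, fun {m f} hf hc => ?_⟩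
  have : p ∘ f = q ∘ f := by
    funext y
    exact (hu _ (hf y)).symm
  rw [this]
  exact isPlot_reparam hq hc

/-- A map out of a quotient is smooth as soon as its composite with the projection is. -/
theorem dSmooth_of_quot {r : X → X → Prop} {f : Quot r → Y}
    (hf : DSmooth (fun x => f (Quot.mk r x))) : DSmooth f := by
  intro n p hp
  refine isPlot_of_eventuallyEq fun x => ?_
  obtain ⟨q, hq, he⟩ := hp x
  refine ⟨_, hf n q hq, ?_⟩
  filter_upwards [he] with y hy
  simp [Function.comp_apply, hy]

end

/-! ## Differential forms on diffeological spaces -/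

/-- Complex-valued differential `k`-forms on a diffeological space: a smooth `k`-form on `ℝⁿ` for
every plot `ℝⁿ → X`, compatible with smooth reparametrisations. -/
def Form (X : Type) [DiffeologicalSpace X] (k : ℕ) :
    Submodule ℂ (∀ n : ℕ, {p : Eu n → X // IsPlot p} → Eu n → Eu n [⋀^Fin k]→L[ℝ] ℂ) where
  carrier := {α | (∀ n p, ContDiff ℝ ∞ (α n p)) ∧
    ∀ (m n : ℕ) (p : {p : Eu n → X // IsPlot p}) (f : Eu m → Eu n) (hf : ContDiff ℝ ∞ f),
      α m ⟨p.1 ∘ f, isPlot_reparam p.2 hf⟩ =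
        fun x => (α n p (f x)).compContinuousLinearMap (fderiv ℝ f x)}
  add_mem' {a b} ha hb := by
    refine ⟨fun n p => (ha.1 n p).add (hb.1 n p), fun m n p f hf => ?_⟩
    funext x
    simp only [Pi.add_apply, ha.2 m n p f hf, hb.2 m n p f hf]
    rfl
  zero_mem' := by
    refine ⟨fun n p => contDiff_const, fun m n p f hf => ?_⟩
    funext x
    rfl
  smul_mem' c a ha := by
    refine ⟨fun n p => (ha.1 n p).const_smul c, fun m n p f hf => ?_⟩
    funext x
    simp only [Pi.smul_apply, ha.2 m n p f hf]
    rfl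

section
variable {X Y : Type} [DiffeologicalSpace X] [DiffeologicalSpace Y] {k : ℕ}

/-- Pullback of forms along a smooth map. -/
def pullback (f : SmoothMap X Y) (α : Form Y k) : Form X k :=
  ⟨fun n p => α.1 n ⟨f.toFun ∘ p.1, f.smooth n p.1 p.2⟩,
    fun n _ => α.2.1 n _, fun m n p g hg =>
      α.2.2 m n ⟨f.toFun ∘ p.1, f.smooth n p.1 p.2⟩ g hg⟩

/-- The exterior derivative. -/
def extD (α : Form X k) : Form X (k + 1) :=
  ⟨fun n p => extDeriv (α.1 n p), by
    constructor
    · intro n p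
      exact (ContinuousAlternatingMap.alternatizeUncurryFinCLM ℝ (Eu n) ℂ).contDiff.comp
        ((α.2.1 n p).fderiv_right (m := ∞) (by simp))
    · intro m n p f hf
      funext x
      change extDeriv (α.1 m ⟨p.1 ∘ f, isPlot_reparam p.2 hf⟩) x = _
      rw [α.2.2 m n p f hf]
      exact extDeriv_pullback ((α.2.1 n p).differentiable (by simp) _) hf.contDiffAt
        (r := ∞) (by
          rw [minSmoothness_of_isRCLikeNormedField]
          exact WithTop.coe_le_coe.2 (le_top : (2 : ℕ∞) ≤ ⊤))⟩

open Classical in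
/-- Descent of a form along a map `q : X → Y`: the form `η` on `Y` with `q^* η = α`
(`0` if there is none). -/
def descend (q : SmoothMap X Y) (α : Form X k) : Form Y k :=
  if h : ∃ η : Form Y k, pullback q η = α then h.choose else 0

end

/-! ## The circle -/

/-- `p : ℝⁿ → Circle` is smooth as a map to `ℂ`. -/
def IsSmoothCircle {n : ℕ} (p : Eu n → Circle) : Prop := ContDiff ℝ ∞ (fun x => (p x : ℂ))

instance circleDiffeology : DiffeologicalSpace Circle where
  plots n := {p | IsSmoothCircle p}
  constant_plots _ := by
    change ContDiff ℝ ∞ _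
    exact contDiff_const
  plot_reparam {n m p f} hp hf := by
    change ContDiff ℝ ∞ (fun x => (p x : ℂ)) at hp
    exact hp.comp hf
  locality {n p} h := by
    change ContDiff ℝ ∞ (fun x => (p x : ℂ))
    rw [contDiff_iff_contDiffAt]
    intro x
    obtain ⟨u, hu, hx, H⟩ := h x
    obtain ⟨f, hf, hfu, hfx⟩ := exists_local_id hu hx
    have h1 : ContDiff ℝ ∞ (fun x => ((p ∘ f) x : ℂ)) := H hfu hf
    refine h1.contDiffAt.congr_of_eventuallyEq ?_
    filter_upwards [hfx] with y hy
    simp [hy]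

/-- The form `z⁻¹ dz` on the circle. -/
def dlog : Form Circle 1 :=
  ⟨fun n p x => ContinuousAlternatingMap.ofSubsingleton ℝ (Eu n) ℂ (0 : Fin 1)
      (((p.1 x)⁻¹ : Circle).1 • fderiv ℝ (fun y => (p.1 y : ℂ)) x), by
    constructor
    · intro n p
      have hp : ContDiff ℝ ∞ (fun x => (p.1 x : ℂ)) := p.2
      have h1 : ContDiff ℝ ∞ (fun x => (((p.1 x)⁻¹ : Circle) : ℂ)) := by
        simp only [Circle.coe_inv_eq_conj]
        exact Complex.conjCLE.contDiff.comp hp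
      exact (ContinuousAlternatingMap.ofSubsingletonLIE (𝕜 := ℝ) (E := Eu n) (F := ℂ) (0 : Fin 1)).toContinuousLinearEquiv.contDiff.comp
        (h1.smul (hp.fderiv_right (m := ∞) (by simp)))
    · intro m n p f hf
      have hp : ContDiff ℝ ∞ (fun x => (p.1 x : ℂ)) := p.2
      funext x
      have : fderiv ℝ (fun y => ((p.1 ∘ f) y : ℂ)) x
          = (fderiv ℝ (fun y => (p.1 y : ℂ)) (f x)).comp (fderiv ℝ f x) :=
        fderiv_comp x (hp.differentiable (by simp) _) (hf.differentiable (by simp) _)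
      ext v
      simp only [Function.comp_apply] at this
      simp [this]⟩

/-! ## Circle bundles -/

/-- The data of a `U(1)`-bundle over `M`: a total space with a smooth fibrewise action of the
circle. -/
structure CircleBundle (M : Type) [DiffeologicalSpace M] where
  Total : Type
  [diffeology : DiffeologicalSpace Total]
  [action : MulAction Circle Total]
  proj : SmoothMap Total M
  act_smooth : DSmooth (fun x : Circle × Total => x.1 • x.2)
  proj_smul : ∀ (z : Circle) (q : Total), proj (z • q) = proj q

attribute [instance] CircleBundle.diffeology CircleBundle.action

theorem dSmooth_inv_circle : DSmooth (fun z : Circle => z⁻¹) := by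
  intro n p hp
  have hp' : ContDiff ℝ ∞ (fun x => (p x : ℂ)) := hp
  change ContDiff ℝ ∞ (fun x => (((p x)⁻¹ : Circle) : ℂ))
  simp only [Circle.coe_inv_eq_conj]
  exact Complex.conjCLE.contDiff.comp hp'

theorem dSmooth_mul_circle : DSmooth (fun z : Circle × Circle => z.1 * z.2) := by
  intro n p hp
  have h1 : ContDiff ℝ ∞ (fun x => ((p x).1 : ℂ)) := hp.1
  have h2 : ContDiff ℝ ∞ (fun x => ((p x).2 : ℂ)) := hp.2
  change ContDiff ℝ ∞ (fun x => (((p x).1 * (p x).2 : Circle) : ℂ))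
  simp only [Circle.coe_mul]
  exact h1.mul h2

namespace CircleBundle
variable {M N : Type} [DiffeologicalSpace M] [DiffeologicalSpace N]

def actMap (B : CircleBundle M) : SmoothMap (Circle × B.Total) B.Total :=
  ⟨fun x => x.1 • x.2, B.act_smooth⟩

/-- A connection form: an `iℝ`-valued 1-form `θ` on the total space with
`a^* θ = pr₁^*(z⁻¹ dz) + pr₂^* θ` for the action map `a`, i.e. `θ` is invariant and restricts to
`z⁻¹ dz` along the orbits. -/
def IsConnection (B : CircleBundle M) (θ : Form B.Total 1) : Prop :=
  (∀ n p x v, (θ.1 n p x v).re = 0) ∧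
    LoopTriple.pullback B.actMap θ = LoopTriple.pullback fstMap dlog + LoopTriple.pullback sndMap θ

/-- The pullback bundle `f^* B`. -/
def pullback (B : CircleBundle M) (f : SmoothMap N M) : CircleBundle N where
  Total := {x : N × B.Total // f x.1 = B.proj x.2}
  action :=
    { smul := fun z x => ⟨(x.1.1, z • x.1.2), by rw [B.proj_smul]; exact x.2⟩
      one_smul := fun x => Subtype.ext (Prod.ext rfl (one_smul _ _))
      mul_smul := fun z w x => Subtype.ext (Prod.ext rfl (mul_smul z w _)) }
  proj := fstMap.comp valMap
  act_smooth := fun n p hp =>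
    ⟨hp.2.1, B.act_smooth n (fun x => ((p x).1, (p x).2.1.2)) ⟨hp.1, hp.2.2⟩⟩
  proj_smul _ _ := rfl

/-- The point `(x, q)` of `f^* B`. -/
def pullbackPt (B : CircleBundle M) (f : SmoothMap N M) (x : N) (q : B.Total)
    (h : f x = B.proj q) : (B.pullback f).Total := ⟨(x, q), h⟩

/-- The bundle map `f^* B → B`. -/
def pullbackMap (B : CircleBundle M) (f : SmoothMap N M) :
    SmoothMap (B.pullback f).Total B.Total := sndMap.comp valMap

/-- The dual bundle `B^{⊗-1}`: the same space with the inverse action. -/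
def dual (B : CircleBundle M) : CircleBundle M where
  Total := B.Total
  diffeology := B.diffeology
  action := MulAction.compHom B.Total (invMonoidHom : Circle →* Circle)
  proj := B.proj
  act_smooth := fun n p hp =>
    B.act_smooth n (fun x => ((p x).1⁻¹, (p x).2)) ⟨dSmooth_inv_circle n _ hp.1, hp.2⟩
  proj_smul z q := B.proj_smul z⁻¹ q

/-- The fibre product `S ×_M T`. -/
abbrev FibreProd (S T : CircleBundle M) : Type :=
  {x : S.Total × T.Total // S.proj x.1 = T.proj x.2}

/-- `(s, t) ∼ (s u, t u⁻¹)` for `u ∈ U(1)`. -/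
def tensorRel (S T : CircleBundle M) (x y : FibreProd S T) : Prop :=
  ∃ u : Circle, y.1.1 = u • x.1.1 ∧ y.1.2 = u⁻¹ • x.1.2

/-- The action `(s ⊗ t) u = (s u) ⊗ t`. -/
instance tensorAction (S T : CircleBundle M) : MulAction Circle (Quot (tensorRel S T)) where
  smul := fun z => Quot.map
    (fun x => ⟨(z • x.1.1, x.1.2), by rw [S.proj_smul]; exact x.2⟩)
    (by
      rintro x y ⟨u, h1, h2⟩
      exact ⟨u, (congrArg (z • ·) h1).trans (smul_comm z u _), h2⟩)
  one_smul := by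
    rintro ⟨x⟩
    exact congrArg (Quot.mk _) (Subtype.ext (Prod.ext (one_smul _ _) rfl))
  mul_smul := by
    rintro z w ⟨x⟩
    exact congrArg (Quot.mk _) (Subtype.ext (Prod.ext (mul_smul z w _) rfl))

/-- The tensor product `S ⊗ T`. -/
def tensor (S T : CircleBundle M) : CircleBundle M where
  Total := Quot (tensorRel S T)
  proj := ⟨Quot.lift (fun x => S.proj x.1.1)
      (by
        rintro x y ⟨u, h1, -⟩
        rw [h1, S.proj_smul]),
    dSmooth_of_quot ((S.proj.comp (fstMap.comp valMap)).smooth)⟩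
  act_smooth := by
    intro n p hp
    refine isPlot_of_eventuallyEq fun x => ?_
    obtain ⟨q, hq, he⟩ := hp.2 x
    refine ⟨fun y => Quot.mk _ ⟨((p y).1 • (q y).1.1, (q y).1.2), by
      rw [S.proj_smul]; exact (q y).2⟩, ?_, ?_⟩
    · refine (quotMap (tensorRel S T)).smooth n (fun y => ⟨((p y).1 • (q y).1.1, (q y).1.2), by
        rw [S.proj_smul]; exact (q y).2⟩) ⟨?_, hq.2⟩
      exact S.act_smooth n (fun y => ((p y).1, (q y).1.1)) ⟨hp.1, hq.1⟩
    · filter_upwards [he] with y hy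
      change _ = (p y).1 • (p y).2
      rw [← hy]
      rfl
  proj_smul := by
    rintro z ⟨x⟩
    exact S.proj_smul z _

/-- The quotient map `S ×_M T → S ⊗ T`. -/
def tensorMap (S T : CircleBundle M) : SmoothMap (FibreProd S T) (S.tensor T).Total :=
  quotMap (tensorRel S T)

/-- The element `s ⊗ t`. -/
def tensorPt (S T : CircleBundle M) (s : S.Total) (t : T.Total) (h : S.proj s = T.proj t) :
    (S.tensor T).Total := S.tensorMap T ⟨(s, t), h⟩

/-- `pr₁^* α + pr₂^* β` on `S ×_M T`. -/
def sumForm (S T : CircleBundle M) (α : Form S.Total 1) (β : Form T.Total 1) :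
    Form (FibreProd S T) 1 :=
  LoopTriple.pullback (fstMap.comp valMap) α + LoopTriple.pullback (sndMap.comp valMap) β

/-- `Θ` is the connection on `S ⊗ T` induced by `α` and `β`: it pulls back to
`pr₁^* α + pr₂^* β` on `S ×_M T`. -/
def IsTensorConn (S T : CircleBundle M) (α : Form S.Total 1) (β : Form T.Total 1)
    (Θ : Form (S.tensor T).Total 1) : Prop :=
  LoopTriple.pullback (S.tensorMap T) Θ = S.sumForm T α β

/-- The connection on `S ⊗ T` induced by `α` and `β`. -/
def tensorConn (S T : CircleBundle M) (α : Form S.Total 1) (β : Form T.Total 1) :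
    Form (S.tensor T).Total 1 := descend (S.tensorMap T) (S.sumForm T α β)

/-- The connection induced on `f^* B`. -/
def pullbackConn (B : CircleBundle M) (f : SmoothMap N M) (θ : Form B.Total 1) :
    Form (B.pullback f).Total 1 := LoopTriple.pullback (B.pullbackMap f) θ

/-- The connection induced on `B^{⊗-1}`. -/
def dualConn (B : CircleBundle M) (θ : Form B.Total 1) : Form B.dual.Total 1 :=
  (-θ : Form B.Total 1)

end CircleBundle

/-! ## The loop group of `SU(2)` -/

abbrev SU2 : Type := Matrix.specialUnitaryGroup (Fin 2) ℂ

/-- Smoothness of a map into `SU(2)`, a submanifold of the space of matrices. -/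
def SmoothSU2 {E : Type} [NormedAddCommGroup E] [NormedSpace ℝ E] (F : E → SU2) : Prop :=
  ∀ i j, ContDiff ℝ ∞ (fun x => (F x).1 i j)

section
variable {E E' : Type} [NormedAddCommGroup E] [NormedSpace ℝ E]
  [NormedAddCommGroup E'] [NormedSpace ℝ E']

theorem SmoothSU2.const (g : SU2) : SmoothSU2 (fun _ : E => g) := fun _ _ => contDiff_const

theorem SmoothSU2.comp {F : E → SU2} (hF : SmoothSU2 F) {f : E' → E} (hf : ContDiff ℝ ∞ f) :
    SmoothSU2 (fun x => F (f x)) := fun i j => (hF i j).comp hf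

theorem SmoothSU2.mul {F G : E → SU2} (hF : SmoothSU2 F) (hG : SmoothSU2 G) :
    SmoothSU2 (fun x => F x * G x) := by
  intro i j
  simp only [Submonoid.coe_mul, Matrix.mul_apply]
  exact ContDiff.sum fun k _ => (hF i k).mul (hG k j)

theorem SmoothSU2.inv {F : E → SU2} (hF : SmoothSU2 F) : SmoothSU2 (fun x => (F x)⁻¹) :=
  fun i j => Complex.conjCLE.contDiff.comp (hF j i)

theorem SmoothSU2.of_local {n : ℕ} {G : Eu n → E → SU2}
    (h : ∀ x : Eu n, ∃ u : Set (Eu n), IsOpen u ∧ x ∈ u ∧ ∀ {m : ℕ} {f : Eu m → Eu n},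
      (∀ x, f x ∈ u) → ContDiff ℝ ∞ f → SmoothSU2 (fun y : Eu m × E => G (f y.1) y.2)) :
    SmoothSU2 (fun y : Eu n × E => G y.1 y.2) := by
  intro i j
  rw [contDiff_iff_contDiffAt]
  rintro ⟨x, t⟩
  obtain ⟨u, hu, hx, H⟩ := h x
  obtain ⟨f, hf, hfu, hfx⟩ := exists_local_id hu hx
  refine (H hfu hf i j).contDiffAt.congr_of_eventuallyEq ?_
  filter_upwards [(continuous_fst.tendsto (x, t)).eventually hfx] with y hy
  simp only [hy]

end

/-- `diag(1, z)`. -/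
def diagU (z : Circle) : Matrix (Fin 2) (Fin 2) ℂ := Matrix.diagonal ![1, (z : ℂ)]

theorem diagU_mul (z w : Circle) : diagU (z * w) = diagU z * diagU w := by
  ext i j
  fin_cases i <;> fin_cases j <;> simp [diagU]

theorem diagU_one : diagU 1 = 1 := by
  ext i j
  fin_cases i <;> fin_cases j <;> simp [diagU]

theorem diagU_inv_mul (z : Circle) : diagU z⁻¹ * diagU z = 1 := by
  rw [← diagU_mul, inv_mul_cancel, diagU_one]

theorem diagU_mul_inv (z : Circle) : diagU z * diagU z⁻¹ = 1 := by
  rw [← diagU_mul, mul_inv_cancel, diagU_one]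

theorem star_diagU (z : Circle) : star (diagU z) = diagU z⁻¹ := by
  ext i j
  rw [diagU, diagU, Matrix.star_eq_conjTranspose, Matrix.diagonal_conjTranspose]
  fin_cases i <;> fin_cases j <;>
    simp [Circle.coe_inv_eq_conj, -Circle.coe_inv]

/-- `z X z⁻¹`, where `z ∈ S¹` is identified with `diag(1, z) ∈ U(2)`. -/
def conjMat (z : Circle) (X : Matrix (Fin 2) (Fin 2) ℂ) : Matrix (Fin 2) (Fin 2) ℂ :=
  diagU z * X * diagU z⁻¹

theorem conjMat_mul (z : Circle) (X Y : Matrix (Fin 2) (Fin 2) ℂ) :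
    conjMat z X * conjMat z Y = conjMat z (X * Y) := by
  have : diagU z * X * diagU z⁻¹ * (diagU z * Y * diagU z⁻¹)
      = diagU z * X * (diagU z⁻¹ * diagU z) * Y * diagU z⁻¹ := by
    simp only [Matrix.mul_assoc]
  rw [conjMat, conjMat, this, diagU_inv_mul, conjMat, Matrix.mul_one, Matrix.mul_assoc (diagU z)]

theorem trace_conjMat (z : Circle) (X : Matrix (Fin 2) (Fin 2) ℂ) :
    (conjMat z X).trace = X.trace := by
  rw [conjMat, Matrix.trace_mul_comm, ← Matrix.mul_assoc, diagU_inv_mul, Matrix.one_mul]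

theorem star_conjMat (z : Circle) (X : Matrix (Fin 2) (Fin 2) ℂ) :
    star (conjMat z X) = conjMat z (star X) := by
  rw [conjMat, star_mul, star_mul, star_diagU, star_diagU, inv_inv, conjMat, Matrix.mul_assoc]

theorem conjMat_one (z : Circle) : conjMat z 1 = 1 := by
  rw [conjMat, Matrix.mul_one, diagU_mul_inv]

theorem conjMat_mem (z : Circle) (h : SU2) :
    conjMat z h.1 ∈ Matrix.specialUnitaryGroup (Fin 2) ℂ := by
  obtain ⟨h, hh⟩ := h
  rw [Matrix.mem_specialUnitaryGroup_iff, Matrix.mem_unitaryGroup_iff] at hh ⊢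
  refine ⟨?_, ?_⟩
  · rw [star_conjMat, conjMat_mul, hh.1, conjMat_one]
  · change (conjMat z h).det = 1
    rw [conjMat, Matrix.det_mul_comm, ← Matrix.mul_assoc, diagU_inv_mul, Matrix.one_mul, hh.2]

/-- The action of `S¹` on `SU(2)` by conjugation in `U(2)`. -/
def conjSU2 : Circle →* MulAut SU2 where
  toFun z :=
    { toFun := fun h => ⟨conjMat z h.1, conjMat_mem z h⟩
      invFun := fun h => ⟨conjMat z⁻¹ h.1, conjMat_mem z⁻¹ h⟩
      left_inv := fun h => Subtype.ext (by
        change diagU z⁻¹ * (diagU z * h.1 * diagU z⁻¹) * diagU z⁻¹⁻¹ = h.1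
        rw [inv_inv, Matrix.mul_assoc, Matrix.mul_assoc _ _ (diagU z), diagU_inv_mul,
          Matrix.mul_one, ← Matrix.mul_assoc, diagU_inv_mul, Matrix.one_mul])
      right_inv := fun h => Subtype.ext (by
        change diagU z * (diagU z⁻¹ * h.1 * diagU z⁻¹⁻¹) * diagU z⁻¹ = h.1
        rw [inv_inv, Matrix.mul_assoc, Matrix.mul_assoc _ _ (diagU z⁻¹), diagU_mul_inv,
          Matrix.mul_one, ← Matrix.mul_assoc, diagU_mul_inv, Matrix.one_mul])
      map_mul' := fun g h => Subtype.ext (conjMat_mul z g.1 h.1).symm }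
  map_one' := by
    ext1 h
    refine Subtype.ext ?_
    change diagU 1 * h.1 * diagU 1⁻¹ = h.1
    rw [inv_one, diagU_one, Matrix.one_mul, Matrix.mul_one]
  map_mul' z w := by
    ext1 h
    refine Subtype.ext ?_
    change diagU (z * w) * h.1 * diagU (z * w)⁻¹ =
      diagU z * (diagU w * h.1 * diagU w⁻¹) * diagU z⁻¹
    rw [mul_inv_rev, diagU_mul, diagU_mul]
    simp only [Matrix.mul_assoc]

theorem conjSU2_entry (z : Circle) (h : SU2) (i j : Fin 2) :
    (conjSU2 z h).1 i j =
      (![1, (z : ℂ)] : Fin 2 → ℂ) i * h.1 i j * (![1, ((z⁻¹ : Circle) : ℂ)] : Fin 2 → ℂ) j := by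
  change (diagU z * h.1 * diagU z⁻¹) i j = _
  rw [diagU, diagU, Matrix.mul_diagonal, Matrix.diagonal_mul]

theorem SmoothSU2.conj {E : Type} [NormedAddCommGroup E] [NormedSpace ℝ E] {F : E → SU2}
    (hF : SmoothSU2 F) {z : E → Circle} (hz : ContDiff ℝ ∞ (fun x => (z x : ℂ))) :
    SmoothSU2 (fun x => conjSU2 (z x) (F x)) := by
  have hz' : ContDiff ℝ ∞ (fun x => (((z x)⁻¹ : Circle) : ℂ)) := by
    simp only [Circle.coe_inv_eq_conj]
    exact Complex.conjCLE.contDiff.comp hz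
  intro i j
  simp only [conjSU2_entry]
  refine (ContDiff.mul ?_ (hF i j)).mul ?_
  · fin_cases i
    · exact contDiff_const
    · exact hz
  · fin_cases j
    · exact contDiff_const
    · exact hz'

/-- The free loop group `LSU(2)` of smooth loops `S¹ → SU(2)`. -/
def LSU2 : Subgroup (Circle → SU2) where
  carrier := {γ | SmoothSU2 (fun t : ℝ => γ (Circle.exp t))}
  mul_mem' ha hb := SmoothSU2.mul ha hb
  one_mem' := SmoothSU2.const 1
  inv_mem' ha := SmoothSU2.inv ha

abbrev LG : Type := LSU2

/-- A map `P : ℝⁿ → LSU(2)` is smooth iff `(x, z) ↦ P(x)(z)` is smooth on `ℝⁿ × S¹`. -/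
instance loopDiffeology : DiffeologicalSpace LG where
  plots n := {P | SmoothSU2 (fun y : Eu n × ℝ => (P y.1).1 (Circle.exp y.2))}
  constant_plots γ := SmoothSU2.comp (F := fun t : ℝ => γ.1 (Circle.exp t)) γ.2 contDiff_snd
  plot_reparam {n m P f} hP hf :=
    SmoothSU2.comp (F := fun y : Eu m × ℝ => (P y.1).1 (Circle.exp y.2)) hP
      ((hf.comp contDiff_fst).prodMk contDiff_snd)
  locality {n P} h := SmoothSU2.of_local (G := fun x t => (P x).1 (Circle.exp t)) h

/-- The action of `S¹` on `LSU(2)` by pointwise conjugation. It defines the semidirect product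
`LSU(2) ⋊ S¹`, with product `(γ, z)(γ', z') = (γ · zγ'z⁻¹, zz')`. -/
def conjLG : Circle →* MulAut LG where
  toFun z :=
    { toFun := fun γ => ⟨fun w => conjSU2 z (γ.1 w), SmoothSU2.conj γ.2 contDiff_const⟩
      invFun := fun γ => ⟨fun w => conjSU2 z⁻¹ (γ.1 w), SmoothSU2.conj γ.2 contDiff_const⟩
      left_inv := fun γ => Subtype.ext (funext fun w => by simp [map_inv])
      right_inv := fun γ => Subtype.ext (funext fun w => by simp [map_inv])
      map_mul' := fun γ γ' => Subtype.ext (funext fun w => map_mul (conjSU2 z) _ _) }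
  map_one' := by
    ext1 γ
    exact Subtype.ext (funext fun w => by simp)
  map_mul' z w := by
    ext1 γ
    exact Subtype.ext (funext fun v => by simp)

theorem dSmooth_mul_LG : DSmooth (fun x : LG × LG => x.1 * x.2) :=
  fun _ _ hp => SmoothSU2.mul hp.1 hp.2

theorem dSmooth_conj_LG : DSmooth (fun x : Circle × LG => conjLG x.1 x.2) := by
  intro n p hp
  have h1 : ContDiff ℝ ∞ (fun x => ((p x).1 : ℂ)) := hp.1
  exact SmoothSU2.conj (F := fun y : Eu n × ℝ => (p y.1).2.1 (Circle.exp y.2)) hp.2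
    (z := fun y => (p y.1).1) (h1.comp contDiff_fst)

/-! ## The forms `C_{1,3}`, `C_{2,2}` and their integrals -/

/-- The derivative of a curve in `SU(2)`. -/
def curveDeriv (h : ℝ → SU2) (t : ℝ) : Matrix (Fin 2) (Fin 2) ℂ :=
  Matrix.of fun i j => deriv (fun r => (h r).1 i j) t

/-- The (real) value of `ν = C_{1,3} = (1/2πi)² (-1/6) tr((h⁻¹dh)³)` at `h` on the tangent vectors
`X 0, X 1, X 2`. -/
def nuForm (h : SU2) (X : Fin 3 → Matrix (Fin 2) (Fin 2) ℂ) : ℝ :=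
  ((1 / (2 * Real.pi * Complex.I)) ^ 2 * (-1 / 6) *
    ∑ σ : Equiv.Perm (Fin 3), ((Equiv.Perm.sign σ : ℤ) : ℂ) *
      (((h⁻¹).1 * X (σ 0)) * ((h⁻¹).1 * X (σ 1)) * ((h⁻¹).1 * X (σ 2))).trace).re

/-- The (real) value of `C_{2,2} = (1/2πi)² (1/2) tr(h₂⁻¹ h₁⁻¹ dh₁ dh₂)` at `(h₁, h₂)` on the
tangent vectors `(X₁, X₂)`, `(Y₁, Y₂)`. -/
def c22Form (h₁ h₂ : SU2) (X₁ X₂ Y₁ Y₂ : Matrix (Fin 2) (Fin 2) ℂ) : ℝ :=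
  ((1 / (2 * Real.pi * Complex.I)) ^ 2 * (1 / 2) *
    ((h₂⁻¹).1 * (h₁⁻¹).1 * (X₁ * Y₂ - Y₁ * X₂)).trace).re

/-- `∫_{I² × S¹} F^* ν` for `F(s, t, z) = F s t z`. -/
def nuIntegral (F : ℝ → ℝ → LG) : ℝ :=
  ∫ s in (0 : ℝ)..1, ∫ t in (0 : ℝ)..1, ∫ φ in (0 : ℝ)..(2 * Real.pi),
    nuForm ((F s t).1 (Circle.exp φ))
      ![curveDeriv (fun r => (F r t).1 (Circle.exp φ)) s,
        curveDeriv (fun r => (F s r).1 (Circle.exp φ)) t,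
        curveDeriv (fun r => (F s t).1 (Circle.exp r)) φ]

/-- `∫_{I × S¹} (σ₁, σ₂)^* C_{2,2}`. -/
def c22Integral (σ₁ σ₂ : ℝ → LG) : ℝ :=
  ∫ t in (0 : ℝ)..1, ∫ φ in (0 : ℝ)..(2 * Real.pi),
    c22Form ((σ₁ t).1 (Circle.exp φ)) ((σ₂ t).1 (Circle.exp φ))
      (curveDeriv (fun r => (σ₁ r).1 (Circle.exp φ)) t)
      (curveDeriv (fun r => (σ₂ r).1 (Circle.exp φ)) t)
      (curveDeriv (fun r => (σ₁ t).1 (Circle.exp r)) φ)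
      (curveDeriv (fun r => (σ₂ t).1 (Circle.exp r)) φ)

theorem curveDeriv_conj (z : Circle) (h : ℝ → SU2) (t : ℝ) :
    curveDeriv (fun r => conjSU2 z (h r)) t = conjMat z (curveDeriv h t) := by
  ext i j
  change deriv (fun r => (conjSU2 z (h r)).1 i j) t = (diagU z * curveDeriv h t * diagU z⁻¹) i j
  rw [diagU, diagU, Matrix.mul_diagonal, Matrix.diagonal_mul]
  simp only [conjSU2_entry]
  rw [deriv_mul_const_field, deriv_const_mul_field]
  rfl

theorem nuForm_conj (z : Circle) (h : SU2) (X : Fin 3 → Matrix (Fin 2) (Fin 2) ℂ) :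
    nuForm (conjSU2 z h) (fun i => conjMat z (X i)) = nuForm h X := by
  have hi : ((conjSU2 z h)⁻¹).1 = conjMat z (h⁻¹).1 := by
    rw [← map_inv]
    rfl
  simp only [nuForm, hi, conjMat_mul, trace_conjMat]

theorem nuIntegral_conj (z : Circle) (F : ℝ → ℝ → LG) :
    nuIntegral (fun s t => conjLG z (F s t)) = nuIntegral F := by
  have key : ∀ s t φ : ℝ, nuForm ((conjLG z (F s t)).1 (Circle.exp φ))
      ![curveDeriv (fun r => (conjLG z (F r t)).1 (Circle.exp φ)) s,
        curveDeriv (fun r => (conjLG z (F s r)).1 (Circle.exp φ)) t,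
        curveDeriv (fun r => (conjLG z (F s t)).1 (Circle.exp r)) φ] =
      nuForm ((F s t).1 (Circle.exp φ))
      ![curveDeriv (fun r => (F r t).1 (Circle.exp φ)) s,
        curveDeriv (fun r => (F s r).1 (Circle.exp φ)) t,
        curveDeriv (fun r => (F s t).1 (Circle.exp r)) φ] := by
    intro s t φ
    have e : ∀ (γ : LG) (w : Circle), (conjLG z γ).1 w = conjSU2 z (γ.1 w) := fun _ _ => rfl
    simp only [e, curveDeriv_conj]
    refine Eq.trans (congrArg (nuForm _) ?_) (nuForm_conj z _ _)
    funext i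
    fin_cases i <;> rfl
  simp only [nuIntegral, key]

/-! ## The bundle `Q(ν)` over `LSU(2)` -/

/-- Smooth paths in `LSU(2)` that start at the constant loop `1`. Only the restriction to `[0, 1]`
matters below; smooth paths on `[0, 1]` extend to `ℝ`. -/
structure BasedPath where
  toFun : ℝ → LG
  smooth : SmoothSU2 (fun y : ℝ × ℝ => (toFun y.1).1 (Circle.exp y.2))
  start : toFun 0 = 1

instance : CoeFun BasedPath (fun _ => ℝ → LG) := ⟨BasedPath.toFun⟩

instance pathDiffeology : DiffeologicalSpace BasedPath where
  plots n := {P | SmoothSU2 (fun y : Eu n × ℝ × ℝ => (P y.1 y.2.1).1 (Circle.exp y.2.2))}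
  constant_plots σ := SmoothSU2.comp (F := fun y : ℝ × ℝ => (σ y.1).1 (Circle.exp y.2)) σ.smooth
    contDiff_snd
  plot_reparam {n m P f} hP hf :=
    SmoothSU2.comp (F := fun y : Eu m × ℝ × ℝ => (P y.1 y.2.1).1 (Circle.exp y.2.2)) hP
      ((hf.comp contDiff_fst).prodMk contDiff_snd)
  locality {n P} h :=
    SmoothSU2.of_local (G := fun x (y : ℝ × ℝ) => (P x y.1).1 (Circle.exp y.2)) h

/-- Pointwise product of paths. -/
instance : Mul BasedPath where
  mul σ τ := ⟨fun t => σ t * τ t, σ.smooth.mul τ.smooth, by rw [σ.start, τ.start, mul_one]⟩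

/-- The path `zσz⁻¹`. -/
def BasedPath.conj (z : Circle) (σ : BasedPath) : BasedPath :=
  ⟨fun t => conjLG z (σ t), σ.smooth.conj contDiff_const, by rw [σ.start, map_one]⟩

/-- Smooth homotopies of paths with fixed ends `1` and `σ(1)`, from `F(0, ·) = σ` to
`F(1, ·) = τ`. -/
structure IsHomotopy (F : ℝ → ℝ → LG) (σ τ : BasedPath) : Prop where
  smooth : SmoothSU2 (fun y : ℝ × ℝ × ℝ => (F y.1 y.2.1).1 (Circle.exp y.2.2))
  left : ∀ t ∈ Set.Icc (0 : ℝ) 1, F 0 t = σ t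
  right : ∀ t ∈ Set.Icc (0 : ℝ) 1, F 1 t = τ t
  bot : ∀ s ∈ Set.Icc (0 : ℝ) 1, F s 0 = 1
  top : ∀ s ∈ Set.Icc (0 : ℝ) 1, F s 1 = σ 1

/-- `(σ, z) ∼ (τ, w)` iff `z = w exp(∫_{I² × S¹} 2πi F^* ν)` for a homotopy `F` from `σ` to `τ`
with fixed ends. -/
def qRel (x y : BasedPath × Circle) : Prop :=
  ∃ F : ℝ → ℝ → LG, IsHomotopy F x.1 y.1 ∧ x.2 = y.2 * Circle.exp (2 * Real.pi * nuIntegral F)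

theorem qRel.end_eq {x y : BasedPath × Circle} (h : qRel x y) : x.1 1 = y.1 1 := by
  obtain ⟨F, hF, -⟩ := h
  rw [← hF.right 1 (by simp), hF.top 1 (by simp)]

/-- The action `[σ, w] z = [σ, wz]`. -/
instance qAction : MulAction Circle (Quot qRel) where
  smul := fun z => Quot.map (fun x => (x.1, z * x.2)) (by
    rintro x y ⟨F, hF, h⟩
    exact ⟨F, hF, by simp only [h, mul_assoc]⟩)
  one_smul := by
    rintro ⟨x⟩
    exact congrArg (Quot.mk _) (Prod.ext rfl (one_mul _))
  mul_smul := by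
    rintro z w ⟨x⟩
    exact congrArg (Quot.mk _) (Prod.ext rfl (mul_assoc z w _))

/-- The `U(1)`-bundle `Q = Q(ν)` over `LSU(2)`. -/
def Q : CircleBundle LG where
  Total := Quot qRel
  proj := ⟨Quot.lift (fun x => x.1 1) (fun _ _ h => h.end_eq), dSmooth_of_quot (by
    intro n p hp
    exact SmoothSU2.comp (F := fun y : Eu n × ℝ × ℝ => ((p y.1).1 y.2.1).1 (Circle.exp y.2.2))
      hp.1 (f := fun y : Eu n × ℝ => (y.1, (1 : ℝ), y.2))
      (contDiff_fst.prodMk (contDiff_const.prodMk contDiff_snd)))⟩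
  act_smooth := by
    intro n p hp
    refine isPlot_of_eventuallyEq fun x => ?_
    obtain ⟨q, hq, he⟩ := hp.2 x
    refine ⟨fun y => Quot.mk _ ((q y).1, (p y).1 * (q y).2), ?_, ?_⟩
    · exact (quotMap qRel).smooth n (fun y => ((q y).1, (p y).1 * (q y).2))
        ⟨hq.1, dSmooth_mul_circle n (fun y => ((p y).1, (q y).2)) ⟨hp.1, hq.2⟩⟩
    · filter_upwards [he] with y hy
      change _ = (p y).1 • (p y).2
      rw [← hy]
      rfl
  proj_smul := by
    rintro z ⟨x⟩
    rfl

/-- The class `[σ, w]`, a point of `Q` over `σ(1)`. -/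
def qPt (σ : BasedPath) (w : Circle) : Q.Total := Quot.mk qRel (σ, w)

/-- The action of `S¹` on `Q` over the conjugation action on `LSU(2)`:
`z [σ, w] z⁻¹ = [zσz⁻¹, w]`. -/
def conjQ (z : Circle) : Q.Total → Q.Total :=
  Quot.map (fun x => (x.1.conj z, x.2)) (by
    rintro x y ⟨F, hF, h⟩
    refine ⟨fun s t => conjLG z (F s t), ⟨hF.smooth.conj contDiff_const, ?_, ?_, ?_, ?_⟩, ?_⟩
    · exact fun t ht => congrArg (conjLG z) (hF.left t ht)
    · exact fun t ht => congrArg (conjLG z) (hF.right t ht)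
    · intro s hs
      rw [hF.bot s hs, map_one]
    · exact fun s hs => congrArg (conjLG z) (hF.top s hs)
    · rw [nuIntegral_conj]
      exact h)

/-! ## The bisimplicial manifold `NLSU(2) ⋊ NS¹` and its triple complex -/

/-- `NLG(p) ⋊ NS¹(q)`. -/
abbrev N (p q : ℕ) : Type := (Fin p → LG) × (Fin q → Circle)

/-- The face operators of the nerve of a group: the first one drops the first entry, the last one
drops the last entry, and the others multiply neighbours. -/
def face {G : Type} [Mul G] {p : ℕ} (i : Fin (p + 2)) (g : Fin (p + 1) → G) : Fin p → G :=
  fun j =>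
    if j.val + 1 < i.val then g j.castSucc
    else if j.val + 1 = i.val then g j.castSucc * g j.succ
    else g j.succ

theorem dSmooth_face {G : Type} [Mul G] [DiffeologicalSpace G]
    (hG : DSmooth (fun x : G × G => x.1 * x.2)) {p : ℕ} (i : Fin (p + 2)) :
    DSmooth (face i : (Fin (p + 1) → G) → Fin p → G) := by
  intro n P hP j
  change IsPlot (fun x => face i (P x) j)
  unfold face
  split_ifs
  · exact hP _
  · exact hG n (fun x => (P x j.castSucc, P x j.succ)) ⟨hP _, hP _⟩
  · exact hP _

/-- The horizontal face operators `ε_i^{LG}`. -/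
def faceLG {p : ℕ} (q : ℕ) (i : Fin (p + 2)) : SmoothMap (N (p + 1) q) (N p q) :=
  ⟨fun x => (face i x.1, x.2), fun n _ hP => ⟨dSmooth_face dSmooth_mul_LG i n _ hP.1, hP.2⟩⟩

/-- The vertical face operators `ε_i^{S¹}`; the last one is
`(γ, z₁, …, z_q) ↦ (z_q γ z_q⁻¹, z₁, …, z_{q-1})`. -/
def faceS (p : ℕ) {q : ℕ} (i : Fin (q + 2)) : SmoothMap (N p (q + 1)) (N p q) :=
  ⟨fun x => (fun k => if i = Fin.last (q + 1) then conjLG (x.2 (Fin.last q)) (x.1 k) else x.1 k,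
      face i x.2), by
    intro n P hP
    refine ⟨fun k => ?_, dSmooth_face dSmooth_mul_circle i n _ hP.2⟩
    by_cases hi : i = Fin.last (q + 1)
    · simp only [Function.comp_apply, hi, if_true]
      exact dSmooth_conj_LG n (fun x => ((P x).2 (Fin.last q), (P x).1 k)) ⟨hP.2 _, hP.1 _⟩
    · simp only [Function.comp_apply, hi, if_false]
      exact hP.1 k⟩

/-- `Ω^{p,q,r} = Ω^r(NLG(p) ⋊ NS¹(q))`. -/
abbrev Om (p q r : ℕ) : Type := Form (N p q) r

/-- The horizontal differential `Σ (-1)^i (ε_i^{LG})^*`. -/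
def dH {p q r : ℕ} (α : Om p q r) : Om (p + 1) q r :=
  ∑ i : Fin (p + 2), (-1 : ℂ) ^ i.val • pullback (faceLG q i) α

/-- The vertical differential `(-1)^p Σ (-1)^i (ε_i^{S¹})^*`. -/
def dV {p q r : ℕ} (α : Om p q r) : Om p (q + 1) r :=
  (-1 : ℂ) ^ p • ∑ i : Fin (q + 2), (-1 : ℂ) ^ i.val • pullback (faceS p i) α

/-- The de Rham differential `(-1)^{p+q} d`. -/
def dF {p q r : ℕ} (α : Om p q r) : Om p q (r + 1) := (-1 : ℂ) ^ (p + q) • extD α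

/-- Families of forms in all tri-degrees. -/
abbrev Tot : Type := ∀ p q r : ℕ, Om p q r

/-- Elements of total degree `n`: those supported in tri-degrees with `p + q + r = n`. -/
def IsDegree (n : ℕ) (K : Tot) : Prop := ∀ p q r, p + q + r ≠ n → K p q r = 0

/-- The component in `Ω^{p,q,r}` of the horizontal differential of `K`. -/
def totH (K : Tot) : Tot
  | 0, _, _ => 0
  | p + 1, q, r => dH (K p q r)

/-- The component in `Ω^{p,q,r}` of the vertical differential of `K`. -/
def totV (K : Tot) : Tot
  | _, 0, _ => 0
  | p, q + 1, r => dV (K p q r)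

/-- The component in `Ω^{p,q,r}` of the de Rham differential of `K`. -/
def totF (K : Tot) : Tot
  | _, _, 0 => 0
  | p, q, r + 1 => dF (K p q r)

/-- The total differential. -/
def totD (K : Tot) : Tot := fun p q r => totH K p q r + totV K p q r + totF K p q r

/-! ## The forms `c₁(θ)`, `s_L^*(δθ)` and `τ` -/

/-- `-1 / 2πi`. -/
def kappa : ℂ := -1 / (2 * Real.pi * Complex.I)

/-- `c₁(θ)`: the 2-form on `LSU(2)` whose pullback to `Q` is `(-1/2πi) dθ`. -/
def c1 (θ : Form Q.Total 1) : Form LG 2 := descend Q.proj (kappa • extD θ)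

/-- The identification `NLG(1) ⋊ NS¹(0) = LG`. -/
def toLG : SmoothMap (N 1 0) LG := ⟨fun x => x.1 0, fun _ _ hp => hp.1 0⟩

/-- `ε_i^* Q` over `LG × LG`. -/
def QH (i : Fin 3) : CircleBundle (N 2 0) := Q.pullback (toLG.comp (faceLG 0 i))

/-- `(ε_i^{S¹})^* Q` over `LG ⋊ S¹`. -/
def QV (i : Fin 2) : CircleBundle (N 1 1) := Q.pullback (toLG.comp (faceS 1 i))

/-- `δQ = ε₀^* Q ⊗ (ε₁^* Q)^{⊗-1} ⊗ ε₂^* Q`. -/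
def deltaQ : CircleBundle (N 2 0) := ((QH 0).tensor (QH 1).dual).tensor (QH 2)

/-- The connection induced on `ε_i^* Q`. -/
def thetaH (θ : Form Q.Total 1) (i : Fin 3) : Form (QH i).Total 1 :=
  Q.pullbackConn (toLG.comp (faceLG 0 i)) θ

/-- The connection induced on `(ε_i^{S¹})^* Q`. -/
def thetaV (θ : Form Q.Total 1) (i : Fin 2) : Form (QV i).Total 1 :=
  Q.pullbackConn (toLG.comp (faceS 1 i)) θ

/-- The connection induced on `ε₀^* Q ⊗ (ε₁^* Q)^{⊗-1}`. -/
def deltaTheta01 (θ : Form Q.Total 1) : Form ((QH 0).tensor (QH 1).dual).Total 1 :=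
  (QH 0).tensorConn (QH 1).dual (thetaH θ 0) ((QH 1).dualConn (thetaH θ 1))

/-- The connection `δθ` induced on `δQ`. -/
def deltaTheta (θ : Form Q.Total 1) : Form deltaQ.Total 1 :=
  ((QH 0).tensor (QH 1).dual).tensorConn (QH 2) (deltaTheta01 θ) (thetaH θ 2)

/-- The bundle `((ε₀^{S¹})^* Q)^{⊗-1} ⊗ (ε₁^{S¹})^* Q` over `LG ⋊ S¹`. -/
def semiQ : CircleBundle (N 1 1) := (QV 0).dual.tensor (QV 1)

/-- The connection `δ_⋊ θ` induced on it. -/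
def semiTheta (θ : Form Q.Total 1) : Form semiQ.Total 1 :=
  (QV 0).dual.tensorConn (QV 1) ((QV 0).dualConn (thetaV θ 0)) (thetaV θ 1)

/-- `s` is the section `s_L` of `δQ`:
`s_L(γ₁, γ₂) = ([σ₂, 1] ⊗ [σ₁σ₂, 1]^{⊗-1} ⊗ [σ₁, 1]) · exp(∫_{I × S¹} 2πi (σ₁, σ₂)^* C_{2,2})`
for all paths `σ₁`, `σ₂` from `1` to `γ₁`, `γ₂`. -/
def IsSL (s : SmoothMap (N 2 0) deltaQ.Total) : Prop :=
  (∀ x, deltaQ.proj (s x) = x) ∧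
  ∀ (x : N 2 0) (σ₁ σ₂ : BasedPath)
    (h₀ : toLG (faceLG 0 0 x) = Q.proj (qPt σ₂ 1))
    (h₁ : toLG (faceLG 0 1 x) = Q.proj (qPt (σ₁ * σ₂) 1))
    (h₂ : toLG (faceLG 0 2 x) = Q.proj (qPt σ₁ 1)),
    s x = Circle.exp (2 * Real.pi * c22Integral σ₁ σ₂) •
      (((QH 0).tensor (QH 1).dual).tensorPt (QH 2)
        ((QH 0).tensorPt (QH 1).dual
          (Q.pullbackPt (toLG.comp (faceLG 0 0)) x (qPt σ₂ 1) h₀)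
          (Q.pullbackPt (toLG.comp (faceLG 0 1)) x (qPt (σ₁ * σ₂) 1) h₁) rfl)
        (Q.pullbackPt (toLG.comp (faceLG 0 2)) x (qPt σ₁ 1) h₂) rfl : deltaQ.Total)

/-- `s` is the section `s_⋊(γ, z) = (g, z)^{⊗-1} ⊗ (z g z⁻¹, z)`, for all `g ∈ Q` over `γ`. -/
def IsSemi (s : SmoothMap (N 1 1) semiQ.Total) : Prop :=
  (∀ x, semiQ.proj (s x) = x) ∧
  ∀ (x : N 1 1) (g : Q.Total) (h₀ : toLG (faceS 1 0 x) = Q.proj g)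
    (h₁ : toLG (faceS 1 1 x) = Q.proj (conjQ (x.2 0) g)),
    s x = (QV 0).dual.tensorPt (QV 1)
      (Q.pullbackPt (toLG.comp (faceS 1 0)) x g h₀)
      (Q.pullbackPt (toLG.comp (faceS 1 1)) x (conjQ (x.2 0) g) h₁) rfl

/-- `c₁(θ)` in `Ω^{1,0,2}`. -/
def c1N (θ : Form Q.Total 1) : Om 1 0 2 := pullback toLG (c1 θ)

/-- `(-1/2πi) s_L^*(δθ)`, in `Ω^{2,0,1}`. -/
def betaForm (θ : Form Q.Total 1) (sL : SmoothMap (N 2 0) deltaQ.Total) : Om 2 0 1 :=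
  kappa • pullback sL (deltaTheta θ)

/-- `τ = (-1/2πi) s_⋊^*(δ_⋊ θ)`, in `Ω^{1,1,1} = Ω¹(LG ⋊ S¹)`. -/
def tau (θ : Form Q.Total 1) (s : SmoothMap (N 1 1) semiQ.Total) : Om 1 1 1 :=
  kappa • pullback s (semiTheta θ)

/-- The cocycle `c₁(θ) - (-1/2πi) s_L^*(δθ)` of the double complex of
`NLG(*) = NLG(*) ⋊ NS¹(0)`. -/
def ddCocycle (θ : Form Q.Total 1) (sL : SmoothMap (N 2 0) deltaQ.Total) : ∀ p r : ℕ, Om p 0 r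
  | 1, 2 => c1N θ
  | 2, 1 => -betaForm θ sL
  | _, _ => 0

/-- The element `c₁(θ) - (-1/2πi) s_L^*(δθ) - τ` of the triple complex. -/
def tripleCocycle (θ : Form Q.Total 1) (sL : SmoothMap (N 2 0) deltaQ.Total)
    (s : SmoothMap (N 1 1) semiQ.Total) : Tot
  | p, 0, r => ddCocycle θ sL p r
  | 1, 1, 1 => -tau θ s
  | _, _, _ => 0

end LoopTriple
end

open LoopTriple

open scoped ContDiff Topology
open Diffeology

noncomputable section

namespace LoopTriple

/-! ## Subductions and descent -/

section
variable {X Y Z : Type} [DiffeologicalSpace X] [DiffeologicalSpace Y] [DiffeologicalSpace Z] {k : ℕ}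

/-! Everything is verified upstairs, on the spaces `NQ p q` = `Q^p × (S¹)^q`. The bundle `Q` carries
an associative product `mulQ` covering the product of loops, and the circle acts on it by
automorphisms `conjQ`. Hence the `NQ p q` have face maps covering those of `N p q`, horizontal and
vertical faces commute, and the simplicial identities needed in low degrees hold.

Pulled back to these spaces, `s_L` becomes `(q₁, q₂) ↦ q₂ ⊗ (q₁q₂)^{⊗-1} ⊗ q₁` and `s_⋊` becomes
`(q, z) ↦ q^{⊗-1} ⊗ zqz⁻¹`. So `c₁(θ)`, `β` and `τ` become `κ dθ`, `κ(ε₀^* - ε₁^* + ε₂^*)θ` and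
`κ(-ε₀^* + ε₁^*)θ` with `κ = -1/2πi`: upstairs, `c₁(θ) - β - τ` is minus the total differential of
`κθ`. Its components therefore satisfy the cocycle identities because `d² = 0`, pullback commutes
with `d`, and the faces satisfy the simplicial identities. The identities descend because `projN` is
a subduction, along which pullback of forms is injective (`IsSubduction.pullback_injective`).

The product on `Q` rests on `ν(gh) = ν(g) + ν(h) + dC_{2,2}` (`nuPull_mul`), integrated by Stokes to
the Polyakov–Wiegmann formula `nuIntegral_mul`. This makes `(σ, w)(τ, v) = (στ, wv
exp(-2πi∫C_{2,2}))` respect the relation defining `Q`. Associativity is the cocycle property of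
`C_{2,2}` (`c22Integral_cocycle`), and equivariance is its invariance under conjugation
(`c22Integral_conj`).

The sections, `c₁(θ)` and the induced connections exist because `Q` has local lifts of plots, and
two lifts of a plot differ locally by a smooth circle-valued function. Both facts come from
topology: a smooth surface in `SU(2)` misses a point (`exists_missed_point`), and the complement of
a point contracts, so loops contract to `1` and paths with common ends are homotopic, smoothly in
parameters. Freeness of the circle action, which would need integrality of `ν`, is replaced by the
weaker fact that all points of `Q` have the same stabiliser; this is the group `Γ` in `IsPrincipal`.
-/

theorem SmoothMap.ext {f g : SmoothMap X Y} (h : ∀ x, f x = g x) : f = g := by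
  obtain ⟨f, hf⟩ := f
  obtain ⟨g, hg⟩ := g
  have : f = g := funext h
  subst this
  rfl

/-- Plots are defined on all of `ℝⁿ`, so restriction to a neighbourhood is replaced by
reparametrisation with a map that is the identity near `x`. Its derivative at `x` is the identity,
hence the value at `x` is unchanged. -/
theorem form_comp_local_id (α : Form X k) {n : ℕ} (p : {p : Eu n → X // IsPlot p}) {x : Eu n}
    {f : Eu n → Eu n} (hf : ContDiff ℝ ∞ f) (hfx : ∀ᶠ y in 𝓝 x, f y = y) :
    α.1 n ⟨p.1 ∘ f, isPlot_reparam p.2 hf⟩ x = α.1 n p x := by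
  have h := congrFun (α.2.2 n n p f hf) x
  have hd : fderiv ℝ f x = ContinuousLinearMap.id ℝ (Eu n) := by
    rw [Filter.EventuallyEq.fderiv_eq (f := id) hfx, fderiv_id]
  rw [h, hd, hfx.self_of_nhds]
  ext v
  simp

/-- The value of a form at a point depends only on the germ of the plot. -/
theorem form_congr_plot (α : Form X k) {n : ℕ} (p q : {p : Eu n → X // IsPlot p}) {x : Eu n}
    (h : ∀ᶠ y in 𝓝 x, p.1 y = q.1 y) : α.1 n p x = α.1 n q x := by
  obtain ⟨u, hu, ho, hx⟩ := eventually_nhds_iff.mp h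
  obtain ⟨f, hf, hfu, hfx⟩ := exists_local_id ho hx
  rw [← form_comp_local_id α p hf hfx, ← form_comp_local_id α q hf hfx]
  have : (⟨p.1 ∘ f, isPlot_reparam p.2 hf⟩ : {p : Eu n → X // IsPlot p}) =
      ⟨q.1 ∘ f, isPlot_reparam q.2 hf⟩ := Subtype.ext (funext fun y => hu _ (hfu y))
  rw [this]

/-- Subductions: smooth maps along which plots lift locally. -/
def IsSubduction (f : SmoothMap X Y) : Prop :=
  ∀ (n : ℕ) (p : Eu n → Y), IsPlot p → ∀ x, ∃ q : Eu n → X, IsPlot q ∧ ∀ᶠ y in 𝓝 x, f (q y) = p y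

theorem isSubduction_quotMap (r : X → X → Prop) : IsSubduction (quotMap r) := fun _ _ hp x => hp x

theorem IsSubduction.surjective {f : SmoothMap X Y} (hf : IsSubduction f) (y : Y) :
    ∃ x, f x = y := by
  obtain ⟨q, -, h⟩ := hf 0 (fun _ => y) isPlot_const 0
  exact ⟨q 0, h.self_of_nhds⟩

/-- A plot of `Y` agrees near each point with the image of a plot of `X`, and the value of a form
depends only on the germ of the plot. -/
theorem IsSubduction.pullback_injective {f : SmoothMap X Y} (hf : IsSubduction f) {α β : Form Y k}
    (h : pullback f α = pullback f β) : α = β := by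
  refine Subtype.ext (funext fun n => funext fun p => funext fun x => ?_)
  obtain ⟨q, hq, he⟩ := hf n p.1 p.2 x
  have h1 := congrFun (congrFun (congrFun (congrArg Subtype.val h) n) ⟨q, hq⟩) x
  have h2 := form_congr_plot α ⟨f.toFun ∘ q, f.smooth n q hq⟩ p he
  have h3 := form_congr_plot β ⟨f.toFun ∘ q, f.smooth n q hq⟩ p he
  exact h2.symm.trans (h1.trans h3)

theorem form_eq_of_local {W : Type} {f : X → W} {α : Form X k}
    (h : ∀ (n : ℕ) (p q : {p : Eu n → X // IsPlot p}), (∀ y, f (p.1 y) = f (q.1 y)) →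
      ∀ x, α.1 n p x = α.1 n q x)
    {n : ℕ} (p q : {p : Eu n → X // IsPlot p}) {x : Eu n}
    (hx : ∀ᶠ y in 𝓝 x, f (p.1 y) = f (q.1 y)) : α.1 n p x = α.1 n q x := by
  obtain ⟨u, hu, ho, hxu⟩ := eventually_nhds_iff.mp hx
  obtain ⟨g, hg, hgu, hgx⟩ := exists_local_id ho hxu
  rw [← form_comp_local_id α p hg hgx, ← form_comp_local_id α q hg hgx]
  exact h n _ _ (fun y => hu (g y) (hgu y)) x

/-- A form that only depends on the composites of plots with a subduction descends. -/
theorem IsSubduction.pullback_descend {f : SmoothMap X Y} (hf : IsSubduction f) {α : Form X k}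
    (h : ∀ (n : ℕ) (p q : {p : Eu n → X // IsPlot p}), (∀ y, f (p.1 y) = f (q.1 y)) →
      ∀ x, α.1 n p x = α.1 n q x) : pullback f (descend f α) = α := by
  have key : ∃ η : Form Y k, pullback f η = α := by
    choose L hL hLe using hf
    have hloc : ∀ (n : ℕ) (p : {p : Eu n → Y // IsPlot p}) (x : Eu n) (q : Eu n → X)
        (hq : IsPlot q), (∀ᶠ y in 𝓝 x, f (q y) = p.1 y) →
        α.1 n ⟨L n p.1 p.2 x, hL n p.1 p.2 x⟩ x = α.1 n ⟨q, hq⟩ x := by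
      intro n p x q hq hqe
      refine form_eq_of_local h _ _ ?_
      filter_upwards [hqe, hLe n p.1 p.2 x] with y h1 h2
      exact h2.trans h1.symm
    -- The value of the descended form at `x` is read off from the lift chosen for the point `x`; by
    -- `hloc` any other local lift gives the same value.
    refine ⟨⟨fun n p x => α.1 n ⟨L n p.1 p.2 x, hL n p.1 p.2 x⟩ x, ?_, ?_⟩, ?_⟩
    · intro n p
      rw [contDiff_iff_contDiffAt]
      intro x
      refine ((α.2.1 n ⟨L n p.1 p.2 x, hL n p.1 p.2 x⟩).contDiffAt (x := x)).congr_of_eventuallyEq ?_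
      -- The lift chosen at `x` is also a lift near every `y` close to `x`, so near `x` the
      -- descended form is the value on a single plot and hence smooth.
      filter_upwards [(hLe n p.1 p.2 x).eventually_nhds] with y hy
      exact hloc n p y _ (hL n p.1 p.2 x) hy
    · intro m n p g hg
      funext x
      exact (hloc m ⟨p.1 ∘ g, isPlot_reparam p.2 hg⟩ x (L n p.1 p.2 (g x) ∘ g)
        (isPlot_reparam (hL n p.1 p.2 (g x)) hg)
        (hg.continuous.continuousAt.eventually (hLe n p.1 p.2 (g x)))).trans
        (congrFun (α.2.2 m n ⟨_, hL n p.1 p.2 (g x)⟩ g hg) x)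
    · refine Subtype.ext (funext fun n => funext fun p => funext fun x => ?_)
      exact hloc n ⟨f.toFun ∘ p.1, f.smooth n p.1 p.2⟩ x p.1 p.2 (Filter.Eventually.of_forall fun _ => rfl)
  rw [descend, dif_pos key]
  exact key.choose_spec

/-- A smooth map that is constant on the fibres of a subduction descends. -/
theorem IsSubduction.exists_factor {f : SmoothMap X Y} (hf : IsSubduction f) (g : SmoothMap X Z)
    (h : ∀ a b, f a = f b → g a = g b) : ∃ s : SmoothMap Y Z, ∀ a, s (f a) = g a := by
  choose c hc using hf.surjective
  have e : ∀ a, g (c (f a)) = g a := fun a => h _ _ (hc _)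
  refine ⟨⟨fun y => g (c y), ?_⟩, e⟩
  intro n p hp
  refine isPlot_of_eventuallyEq fun x => ?_
  obtain ⟨q, hq, he⟩ := hf n p hp x
  refine ⟨_, g.smooth n q hq, ?_⟩
  filter_upwards [he] with y hy
  change g (q y) = g (c (p y))
  rw [← hy, e]

/-! ### Naturality and linearity of pullback and of the exterior derivative. -/

theorem pullback_comp (g : SmoothMap Y Z) (f : SmoothMap X Y) (α : Form Z k) :
    pullback f (pullback g α) = pullback (g.comp f) α := rfl

theorem pullback_add (f : SmoothMap X Y) (α β : Form Y k) :
    pullback f (α + β) = pullback f α + pullback f β := rfl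

theorem pullback_sub (f : SmoothMap X Y) (α β : Form Y k) :
    pullback f (α - β) = pullback f α - pullback f β := rfl

theorem pullback_neg (f : SmoothMap X Y) (α : Form Y k) : pullback f (-α) = -pullback f α := rfl

theorem pullback_smul (f : SmoothMap X Y) (c : ℂ) (α : Form Y k) :
    pullback f (c • α) = c • pullback f α := rfl

theorem pullback_zero (f : SmoothMap X Y) : pullback f (0 : Form Y k) = 0 := rfl

theorem pullback_extD (f : SmoothMap X Y) (α : Form Y k) :
    pullback f (extD α) = extD (pullback f α) := rfl

theorem form_differentiable (α : Form X k) {n : ℕ} (p : {p : Eu n → X // IsPlot p}) (x : Eu n) :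
    DifferentiableAt ℝ (α.1 n p) x := (α.2.1 n p).differentiable (by simp) _

theorem extD_add (α β : Form X k) : extD (α + β) = extD α + extD β := by
  refine Subtype.ext (funext fun n => funext fun p => funext fun x => ?_)
  exact extDeriv_add (form_differentiable α p x) (form_differentiable β p x)

theorem extD_smul (c : ℂ) (α : Form X k) : extD (c • α) = c • extD α := by
  refine Subtype.ext (funext fun n => funext fun p => funext fun x => ?_)
  let L : (Eu n [⋀^Fin k]→L[ℝ] ℂ) →L[ℝ] (Eu n [⋀^Fin k]→L[ℝ] ℂ) :=
    c • ContinuousLinearMap.id ℝ (Eu n [⋀^Fin k]→L[ℝ] ℂ)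
  have h : HasFDerivAt (c • α.1 n p) (L.comp (fderiv ℝ (α.1 n p) x)) x :=
    L.hasFDerivAt.comp x (form_differentiable α p x).hasFDerivAt
  change extDeriv (c • α.1 n p) x = c • extDeriv (α.1 n p) x
  ext v
  simp only [extDeriv, h.fderiv, ContinuousAlternatingMap.alternatizeUncurryFin_apply,
    ContinuousAlternatingMap.smul_apply, Finset.smul_sum]
  refine Finset.sum_congr rfl fun i _ => ?_
  simp [L, mul_left_comm]

theorem extD_neg (α : Form X k) : extD (-α) = -extD α := by
  have e : ∀ {k : ℕ} (β : Form X k), -β = (-1 : ℂ) • β := fun β => by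
    refine Subtype.ext (funext fun n => funext fun p => funext fun x => ?_)
    exact (neg_one_smul ℂ (β.1 n p x)).symm
  rw [e, extD_smul, e]

theorem extD_sub (α β : Form X k) : extD (α - β) = extD α - extD β := by
  have e : ∀ {k : ℕ} (α β : Form X k), α - β = α + -β := fun α β => sub_eq_add_neg α β
  rw [e, extD_add, extD_neg, e]

theorem extD_zero : extD (0 : Form X k) = 0 := by
  have e : ∀ {k : ℕ}, (0 : Form X k) = (0 : ℂ) • (0 : Form X k) := fun {k} =>
    (zero_smul ℂ (0 : Form X k)).symm
  rw [e, extD_smul]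
  exact zero_smul ℂ _

theorem extD_extD (α : Form X k) : extD (extD α) = 0 := by
  refine Subtype.ext (funext fun n => funext fun p => ?_)
  exact extDeriv_extDeriv (α.2.1 n p) (by
    rw [minSmoothness_of_isRCLikeNormedField]
    exact WithTop.coe_le_coe.2 (le_top : (2 : ℕ∞) ≤ ⊤))

/-- In `d(z⁻¹ dz) = -z⁻² dz ∧ dz + z⁻¹ d(dz)` the first term is symmetric in its two arguments
before alternation, and the second vanishes by symmetry of the second derivative. -/
theorem extD_dlog : extD dlog = 0 := by
  refine Subtype.ext (funext fun n => funext fun p => funext fun x => ?_)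
  change extDeriv (dlog.1 n p) x = 0
  have hp : ContDiff ℝ ∞ (fun x => (p.1 x : ℂ)) := p.2
  ext v
  rw [extDeriv_apply (form_differentiable dlog p x), Fin.sum_univ_two]
  have hz : ∀ y, (p.1 y : ℂ) ≠ 0 := fun y => Circle.coe_ne_zero _
  have hd := hp.differentiable (by simp)
  have hd2 : Differentiable ℝ (fderiv ℝ (fun y => (p.1 y : ℂ))) :=
    (hp.fderiv_right (m := ∞) (by simp)).differentiable (by simp)
  have e : ∀ (w : Fin 1 → Eu n) (u : Eu n), fderiv ℝ (fun y => (dlog.1 n p y) w) x u =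
      -((p.1 x : ℂ) ^ 2)⁻¹ * fderiv ℝ (fun y => (p.1 y : ℂ)) x u
        * fderiv ℝ (fun y => (p.1 y : ℂ)) x (w 0) +
      (p.1 x : ℂ)⁻¹ * fderiv ℝ (fderiv ℝ (fun y => (p.1 y : ℂ))) x u (w 0) := by
    intro w u
    have h2 : (fun y => (dlog.1 n p y) w) =
        fun y => (p.1 y : ℂ)⁻¹ * fderiv ℝ (fun y => (p.1 y : ℂ)) y (w 0) := by
      funext y
      simp [dlog]
    have h3 := ((hasFDerivAt_inv' (𝕜 := ℝ) (hz x)).comp x (hd x).hasFDerivAt).mul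
      ((hd2 x).hasFDerivAt.clm_apply (hasFDerivAt_const (w 0) x))
    rw [h2]
    refine (congrArg (fun L => L u) h3.fderiv).trans ?_
    simp
    ring
  rw [e, e]
  have hs := (hp.contDiffAt (x := x)).isSymmSndFDerivAt (by
    rw [minSmoothness_of_isRCLikeNormedField]
    exact WithTop.coe_le_coe.2 (le_top : (2 : ℕ∞) ≤ ⊤))
  have := hs (v 0) (v 1)
  simp [Fin.removeNth, Fin.succAbove] 
  rw [this]
  ring

end

/-! ## Principal circle bundles and their connections -/

/-- Supplies the sign that makes the connection on the dual bundle equal to `-θ` and lets the phases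
`z`, `z⁻¹` cancel in a tensor product. -/
theorem dlog_inv {n : ℕ} (z w : {p : Eu n → Circle // IsPlot p}) (x : Eu n)
    (h : ∀ y, w.1 y = (z.1 y)⁻¹) : dlog.1 n w x = -dlog.1 n z x := by
  have hz : ContDiff ℝ ∞ (fun x => (z.1 x : ℂ)) := z.2
  have hd := hz.differentiable (by simp) x
  have e : (fun y => (w.1 y : ℂ)) = fun y => (z.1 y : ℂ)⁻¹ := by
    funext y
    rw [h, Circle.coe_inv]
  have h0 : (z.1 x : ℂ) ≠ 0 := Circle.coe_ne_zero _
  have h3 := (hasFDerivAt_inv' (𝕜 := ℝ) h0).comp x hd.hasFDerivAt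
  ext v
  change (((w.1 x)⁻¹ : Circle) : ℂ) * fderiv ℝ (fun y => (w.1 y : ℂ)) x (v 0) =
    -((((z.1 x)⁻¹ : Circle) : ℂ) * fderiv ℝ (fun y => (z.1 y : ℂ)) x (v 0))
  rw [e, h, inv_inv, Circle.coe_inv]
  have h4 := congrArg (fun L => L (v 0)) h3.fderiv
  simp only [Function.comp_def] at h4
  rw [h4]
  simp
  field_simp

namespace CircleBundle
variable {M N : Type} [DiffeologicalSpace M] [DiffeologicalSpace N]

/-- Circle bundles with local sections whose fibres are smoothly homogeneous under the circle, with
stabiliser `Γ` at every point. -/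
structure IsPrincipal (B : CircleBundle M) (Γ : Subgroup Circle) : Prop where
  lift : IsSubduction B.proj
  trans : ∀ {n : ℕ} {p q : Eu n → B.Total}, IsPlot p → IsPlot q →
    (∀ y, B.proj (p y) = B.proj (q y)) → ∀ x, ∃ z : Eu n → Circle, IsPlot z ∧
      ∀ᶠ y in 𝓝 x, q y = z y • p y
  stab : ∀ (z : Circle) (b : B.Total), z • b = b ↔ z ∈ Γ

variable {B : CircleBundle M} {S T : CircleBundle M} {Γ : Subgroup Circle}

theorem IsPrincipal.trans_of_eventually (h : B.IsPrincipal Γ) {n : ℕ} {p q : Eu n → B.Total}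
    (hp : IsPlot p) (hq : IsPlot q) {x : Eu n}
    (he : ∀ᶠ y in 𝓝 x, B.proj (p y) = B.proj (q y)) :
    ∃ z : Eu n → Circle, IsPlot z ∧ ∀ᶠ y in 𝓝 x, q y = z y • p y := by
  obtain ⟨u, hu, ho, hx⟩ := eventually_nhds_iff.mp he
  obtain ⟨f, hf, hfu, hfx⟩ := exists_local_id ho hx
  obtain ⟨z, hz, hzx⟩ := h.trans (isPlot_reparam hp hf) (isPlot_reparam hq hf)
    (fun y => hu (f y) (hfu y)) x
  refine ⟨z, hz, ?_⟩
  filter_upwards [hzx, hfx] with y h1 h2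
  rwa [Function.comp_apply, Function.comp_apply, h2] at h1

theorem IsPrincipal.pullback (h : B.IsPrincipal Γ) (f : SmoothMap N M) :
    (B.pullback f).IsPrincipal Γ where
  lift := by
    intro n p hp x
    obtain ⟨q, hq, he⟩ := h.lift n (fun y => f (p y)) (f.smooth n p hp) x
    obtain ⟨u, hu, ho, hx⟩ := eventually_nhds_iff.mp he
    obtain ⟨g, hg, hgu, hgx⟩ := exists_local_id ho hx
    -- The compatibility condition of the pullback must hold at every `y`, not only near `x`;
    -- composing with `g`, whose image lies in the good neighbourhood, ensures this.
    refine ⟨fun y => ⟨(p (g y), q (g y)), (hu _ (hgu y)).symm⟩,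
      ⟨isPlot_reparam hp hg, isPlot_reparam hq hg⟩, ?_⟩
    filter_upwards [hgx] with y hy
    exact congrArg p hy
  trans := by
    intro n p q hp hq he x
    obtain ⟨z, hz, hzx⟩ := h.trans (p := fun y => (p y).1.2) (q := fun y => (q y).1.2) hp.2 hq.2
      (fun y => by
        rw [← (p y).2, ← (q y).2]
        exact congrArg f (he y)) x
    refine ⟨z, hz, ?_⟩
    filter_upwards [hzx] with y hy
    exact Subtype.ext (Prod.ext (he y).symm hy)
  stab := by
    intro z b
    rw [← h.stab z b.1.2]
    exact ⟨fun e => congrArg (fun c : (B.pullback f).Total => c.1.2) e,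
      fun e => Subtype.ext (Prod.ext rfl e)⟩

/-- `B.dual.Total` is definitionally `B.Total`, so the type ascription is what selects the inverse
action. -/
theorem inv_smul_dual (B : CircleBundle M) (z : Circle) (b : B.Total) :
    @HSMul.hSMul Circle B.dual.Total B.dual.Total _ z⁻¹ b = z • b := by
  change z⁻¹⁻¹ • b = z • b
  rw [inv_inv]

theorem IsPrincipal.dual (h : B.IsPrincipal Γ) : B.dual.IsPrincipal Γ where
  lift := h.lift
  trans := by
    intro n p q hp hq he x
    obtain ⟨z, hz, hzx⟩ := h.trans hp hq he x
    refine ⟨fun y => (z y)⁻¹, dSmooth_inv_circle n z hz, ?_⟩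
    filter_upwards [hzx] with y hy
    exact hy.trans (B.inv_smul_dual (z y) (p y)).symm
  stab := by
    intro z b
    rw [← Γ.inv_mem_iff]
    exact h.stab z⁻¹ b

theorem tensorRel_equivalence (S T : CircleBundle M) : Equivalence (tensorRel S T) where
  refl x := ⟨1, by simp, by simp⟩
  symm := by
    rintro x y ⟨u, h1, h2⟩
    exact ⟨u⁻¹, by rw [h1, inv_smul_smul], by rw [h2, inv_inv, smul_inv_smul]⟩
  trans := by
    rintro x y z ⟨u, h1, h2⟩ ⟨v, h3, h4⟩
    exact ⟨v * u, by rw [h3, h1, mul_smul], by rw [h4, h2, mul_inv, mul_smul]⟩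

theorem tensorMap_eq_iff (x y : FibreProd S T) :
    S.tensorMap T x = S.tensorMap T y ↔ tensorRel S T x y :=
  (tensorRel_equivalence S T).quot_mk_eq_iff x y

theorem smul_tensorMap (z : Circle) (x : FibreProd S T) :
    (z • S.tensorMap T x : (S.tensor T).Total) =
      S.tensorMap T ⟨(z • x.1.1, x.1.2), by rw [S.proj_smul]; exact x.2⟩ := rfl

theorem tensorPt_smul_left (z : Circle) (s : S.Total) (t : T.Total) (h : S.proj s = T.proj t)
    (h' : S.proj (z • s) = T.proj t) :
    S.tensorPt T (z • s) t h' = z • S.tensorPt T s t h := rfl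

theorem tensorPt_smul_right (z : Circle) (s : S.Total) (t : T.Total) (h : S.proj s = T.proj t)
    (h' : S.proj s = T.proj (z • t)) :
    S.tensorPt T s (z • t) h' = z • S.tensorPt T s t h :=
  (tensorMap_eq_iff _ _).2 ⟨z, rfl, (inv_smul_smul z t).symm⟩

theorem isSubduction_tensorMap (S T : CircleBundle M) : IsSubduction (S.tensorMap T) :=
  isSubduction_quotMap _

/-- Translating the factors by `z` and `w` translates `s ⊗ t` by `zw`. The stabiliser of `s ⊗ t` is
generated by those of `s` and `t`; both being `Γ`, it is again `Γ`. -/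
theorem IsPrincipal.tensor (hS : S.IsPrincipal Γ) (hT : T.IsPrincipal Γ) :
    (S.tensor T).IsPrincipal Γ where
  lift := by
    intro n p hp x
    obtain ⟨s, hs, hse⟩ := hS.lift n p hp x
    obtain ⟨t, ht, hte⟩ := hT.lift n p hp x
    obtain ⟨u, hu, ho, hx⟩ := eventually_nhds_iff.mp (hse.and hte)
    obtain ⟨f, hf, hfu, hfx⟩ := exists_local_id ho hx
    have hst : ∀ y, S.proj (s (f y)) = T.proj (t (f y)) := fun y =>
      (hu _ (hfu y)).1.trans (hu _ (hfu y)).2.symm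
    refine ⟨fun y => S.tensorMap T ⟨(s (f y), t (f y)), hst y⟩,
      (S.tensorMap T).smooth n (fun y => ⟨(s (f y), t (f y)), hst y⟩)
        ⟨isPlot_reparam hs hf, isPlot_reparam ht hf⟩, ?_⟩
    filter_upwards [hfx, hse] with y h1 h2
    change S.proj (s (f y)) = p y
    rw [h1, h2]
  trans := by
    intro n p q hp hq he x
    obtain ⟨a, ha, hap⟩ := isSubduction_tensorMap S T n p hp x
    obtain ⟨b, hb, hbq⟩ := isSubduction_tensorMap S T n q hq x
    have hs : ∀ᶠ y in 𝓝 x, S.proj (a y).1.1 = S.proj (b y).1.1 := by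
      filter_upwards [hap, hbq] with y h1 h2
      have := he y
      rw [← h1, ← h2] at this
      exact this
    obtain ⟨z, hz, hzx⟩ := hS.trans_of_eventually ha.1 hb.1 hs
    obtain ⟨w, hw, hwx⟩ := hT.trans_of_eventually ha.2 hb.2 (by
      filter_upwards [hs] with y hy
      rw [← (a y).2, ← (b y).2]
      exact hy)
    refine ⟨fun y => z y * w y, dSmooth_mul_circle n (fun y => (z y, w y)) ⟨hz, hw⟩, ?_⟩
    filter_upwards [hap, hbq, hzx, hwx] with y h1 h2 h3 h4
    rw [← h1, ← h2, smul_tensorMap, tensorMap_eq_iff]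
    -- The phase `w` is moved from the second tensor factor to the first, where the circle acts.
    refine ⟨w y, ?_, ?_⟩
    · change (z y * w y) • (a y).1.1 = w y • (b y).1.1
      rw [h3, smul_smul, mul_comm]
    · change (a y).1.2 = (w y)⁻¹ • (b y).1.2
      rw [h4, inv_smul_smul]
  stab := by
    rintro z ⟨⟨⟨s, t⟩, hst⟩⟩
    change z • S.tensorMap T ⟨(s, t), hst⟩ = S.tensorMap T ⟨(s, t), hst⟩ ↔ _
    rw [smul_tensorMap, tensorMap_eq_iff]
    constructor
    · rintro ⟨u, h1, h2⟩
      change s = u • z • s at h1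
      change t = u⁻¹ • t at h2
      have h3 := (hS.stab (u * z) s).1 (by rw [mul_smul]; exact h1.symm)
      have h4 := (hT.stab u⁻¹ t).1 h2.symm
      simpa using Γ.mul_mem h4 h3
    · intro hz
      refine ⟨1, ?_, by simp⟩
      change s = (1 : Circle) • z • s
      rw [one_smul, (hS.stab z s).2 hz]

/-- 1-forms on the total space with `a^* θ = pr₁^*(z⁻¹ dz) + pr₂^* θ` for the action map `a`. -/
def IsEquivariant (B : CircleBundle M) (θ : Form B.Total 1) : Prop :=
  ∀ (n : ℕ) (z : {p : Eu n → Circle // IsPlot p}) (p q : {p : Eu n → B.Total // IsPlot p}),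
    (∀ y, q.1 y = z.1 y • p.1 y) → ∀ x, θ.1 n q x = dlog.1 n z x + θ.1 n p x

theorem IsConnection.isEquivariant {θ : Form B.Total 1} (h : B.IsConnection θ) :
    B.IsEquivariant θ := by
  intro n z p q hq x
  have h1 := congrFun (congrFun (congrFun (congrArg Subtype.val h.2) n)
    ⟨fun y => (z.1 y, p.1 y), z.2, p.2⟩) x
  exact (form_congr_plot θ q ⟨_, B.act_smooth n (fun y => (z.1 y, p.1 y)) ⟨z.2, p.2⟩⟩
    (Filter.Eventually.of_forall hq)).trans h1

theorem IsEquivariant.of_eventually {θ : Form B.Total 1} (h : B.IsEquivariant θ) {n : ℕ}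
    (z : {p : Eu n → Circle // IsPlot p}) (p q : {p : Eu n → B.Total // IsPlot p}) {x : Eu n}
    (hq : ∀ᶠ y in 𝓝 x, q.1 y = z.1 y • p.1 y) : θ.1 n q x = dlog.1 n z x + θ.1 n p x := by
  rw [form_congr_plot θ q ⟨_, B.act_smooth n (fun y => (z.1 y, p.1 y)) ⟨z.2, p.2⟩⟩ hq]
  exact h n z p _ (fun _ => rfl) x

theorem IsEquivariant.pullbackConn {θ : Form B.Total 1} (h : B.IsEquivariant θ)
    (f : SmoothMap N M) : (B.pullback f).IsEquivariant (B.pullbackConn f θ) := by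
  intro n z p q hq x
  exact h n z ⟨_, (B.pullbackMap f).smooth n p.1 p.2⟩ ⟨_, (B.pullbackMap f).smooth n q.1 q.2⟩
    (fun y => congrArg (B.pullbackMap f) (hq y)) x

theorem IsEquivariant.dualConn {θ : Form B.Total 1} (h : B.IsEquivariant θ) :
    B.dual.IsEquivariant (B.dualConn θ) := by
  intro n z p q hq x
  have h1 := h n ⟨fun y => (z.1 y)⁻¹, dSmooth_inv_circle n z.1 z.2⟩ p q hq x
  change -θ.1 n q x = dlog.1 n z x + -θ.1 n p x
  rw [h1, dlog_inv z _ x (fun _ => rfl)]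
  abel

/-- Two lifts to `S ×_M T` of one plot of `S ⊗ T` differ locally by `(z, z⁻¹)`, and the
contributions `dlog z` and `dlog z⁻¹` to the sum of the connections cancel. -/
theorem isTensorConn_tensorConn {α : Form S.Total 1} {β : Form T.Total 1}
    (hS : S.IsPrincipal Γ) (hT : T.IsPrincipal Γ) (hα : S.IsEquivariant α)
    (hβ : T.IsEquivariant β) : S.IsTensorConn T α β (S.tensorConn T α β) := by
  refine (isSubduction_tensorMap S T).pullback_descend ?_
  intro n p q hpq x
  have hrel : ∀ y, tensorRel S T (p.1 y) (q.1 y) := fun y => (tensorMap_eq_iff _ _).1 (hpq y)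
  obtain ⟨z, hz, hzx⟩ := hS.trans (p := fun y => (p.1 y).1.1) (q := fun y => (q.1 y).1.1)
    p.2.1 q.2.1 (fun y => by
      obtain ⟨u, h1, -⟩ := hrel y
      rw [h1, S.proj_smul]) x
  have htx : ∀ᶠ y in 𝓝 x, (q.1 y).1.2 = (z y)⁻¹ • (p.1 y).1.2 := by
    filter_upwards [hzx] with y hy
    obtain ⟨u, h1, h2⟩ := hrel y
    -- The phase `u` from the relation is only pointwise, while `z` is smooth but chosen for `S`
    -- alone. Their ratio fixes a point of `S`, so it lies in the common stabiliser and also fixes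
    -- the point of `T`; thus `z` serves both factors.
    have h3 : ((z y)⁻¹ * u) • (p.1 y).1.1 = (p.1 y).1.1 := by
      rw [mul_smul, ← h1, hy, inv_smul_smul]
    have h4 := (hT.stab _ ((p.1 y).1.2)).2 ((hS.stab _ _).1 h3)
    rw [h2]
    conv_lhs => rw [← h4]
    rw [smul_smul, mul_left_comm, inv_mul_cancel, mul_one]
  have e1 := hα.of_eventually ⟨z, hz⟩ ⟨_, p.2.1⟩ ⟨_, q.2.1⟩ hzx
  have e2 := hβ.of_eventually ⟨fun y => (z y)⁻¹, dSmooth_inv_circle n z hz⟩ ⟨_, p.2.2⟩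
    ⟨_, q.2.2⟩ htx
  rw [dlog_inv ⟨z, hz⟩ _ x (fun _ => rfl)] at e2
  change α.1 n ⟨_, p.2.1⟩ x + β.1 n ⟨_, p.2.2⟩ x = α.1 n ⟨_, q.2.1⟩ x + β.1 n ⟨_, q.2.2⟩ x
  rw [e1, e2]
  abel

/-- The circle acts on `S ⊗ T` through the first factor, so only `α` contributes `dlog z`. -/
theorem IsTensorConn.isEquivariant {α : Form S.Total 1} {β : Form T.Total 1}
    {Θ : Form (S.tensor T).Total 1} (h : S.IsTensorConn T α β Θ) (hα : S.IsEquivariant α) :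
    (S.tensor T).IsEquivariant Θ := by
  intro n z p q hq x
  obtain ⟨a, ha, hap⟩ := isSubduction_tensorMap S T n p.1 p.2 x
  have hb : IsPlot (fun y => (⟨(z.1 y • (a y).1.1, (a y).1.2), by
      rw [S.proj_smul]; exact (a y).2⟩ : FibreProd S T)) :=
    ⟨S.act_smooth n (fun y => (z.1 y, (a y).1.1)) ⟨z.2, ha.1⟩, ha.2⟩
  have ev := fun c : {p : Eu n → FibreProd S T // IsPlot p} =>
    congrFun (congrFun (congrFun (congrArg Subtype.val h) n) c) x
  have e1 := form_congr_plot Θ ⟨_, (S.tensorMap T).smooth n a ha⟩ p hap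
  have e2 := form_congr_plot Θ ⟨_, (S.tensorMap T).smooth n _ hb⟩ q (by
    filter_upwards [hap] with y hy
    rw [hq, ← hy]
    rfl)
  have e3 := hα n z ⟨fun y => (a y).1.1, ha.1⟩ ⟨fun y => z.1 y • (a y).1.1, hb.1⟩ (fun _ => rfl) x
  refine e2.symm.trans ((ev ⟨_, hb⟩).trans ?_)
  refine Eq.trans ?_ (congrArg (dlog.1 n z x + ·) ((ev ⟨a, ha⟩).symm.trans e1))
  change α.1 n ⟨fun y => z.1 y • (a y).1.1, hb.1⟩ x + β.1 n ⟨_, ha.2⟩ x =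
    dlog.1 n z x + (α.1 n ⟨fun y => (a y).1.1, ha.1⟩ x + β.1 n ⟨_, ha.2⟩ x)
  rw [e3, add_assoc]

/-- The curvature of an equivariant form is basic. -/
theorem IsEquivariant.pullback_descend_extD {θ : Form B.Total 1} (h : B.IsEquivariant θ)
    (hB : B.IsPrincipal Γ) (c : ℂ) :
    LoopTriple.pullback B.proj (descend B.proj (c • extD θ)) = c • extD θ := by
  refine hB.lift.pullback_descend ?_
  intro n p q hpq x
  obtain ⟨z, hz, hzx⟩ := hB.trans p.2 q.2 hpq x
  -- On two lifts of a plot of the base `θ` differs by the closed form `dlog z`, so `dθ` does not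
  -- depend on the lift.
  have e : θ.1 n q =ᶠ[𝓝 x] dlog.1 n ⟨z, hz⟩ + θ.1 n p := by
    filter_upwards [hzx.eventually_nhds] with y hy
    exact h.of_eventually ⟨z, hz⟩ p q hy
  change c • extDeriv (θ.1 n p) x = c • extDeriv (θ.1 n q) x
  rw [e.extDeriv_eq, extDeriv_add (form_differentiable dlog _ x) (form_differentiable θ p x)]
  have e0 : extDeriv (dlog.1 n ⟨z, hz⟩) x = 0 :=
    congrFun (congrFun (congrFun (congrArg Subtype.val extD_dlog) n) ⟨z, hz⟩) x
  rw [e0, zero_add]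

end CircleBundle

/-! ## Integrals with parameters -/

section

/-- Dominated differentiation under the integral; the dominating constant is a bound for the partial
derivative on the compact set (closed unit ball around `x`) × (interval). -/
theorem hasFDerivAt_intervalIntegral {E F : Type} [NormedAddCommGroup E] [NormedSpace ℝ E]
    [FiniteDimensional ℝ E] [NormedAddCommGroup F] [NormedSpace ℝ F]
    {g : E × ℝ → F} (hg : ContDiff ℝ ∞ g) (a b : ℝ) (x : E) :
    HasFDerivAt (fun x => ∫ t in a..b, g (x, t))
      (∫ t in a..b, (fderiv ℝ g (x, t)).comp (ContinuousLinearMap.inl ℝ E ℝ)) x := by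
  have hc : Continuous fun y : E × ℝ => (fderiv ℝ g y).comp (ContinuousLinearMap.inl ℝ E ℝ) :=
    (hg.continuous_fderiv (by simp)).clm_comp continuous_const
  have hK : IsCompact (Metric.closedBall x 1 ×ˢ Set.uIcc a b) :=
    (isCompact_closedBall x 1).prod isCompact_uIcc
  obtain ⟨C, hC⟩ := hK.exists_bound_of_continuousOn hc.continuousOn
  refine intervalIntegral.hasFDerivAt_integral_of_dominated_of_fderiv_le
    (s := Metric.ball x 1) (bound := fun _ => C)
    (F' := fun x t => (fderiv ℝ g (x, t)).comp (ContinuousLinearMap.inl ℝ E ℝ))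
    (Metric.ball_mem_nhds x one_pos) ?_ ?_ ?_ ?_ ?_ ?_
  · exact Filter.Eventually.of_forall fun y =>
      (hg.continuous.comp (by fun_prop)).aestronglyMeasurable
  · exact (hg.continuous.comp (by fun_prop)).intervalIntegrable _ _
  · exact (hc.comp (by fun_prop : Continuous fun t : ℝ => (x, t))).aestronglyMeasurable
  · exact Filter.Eventually.of_forall fun t ht y hy =>
      hC (y, t) ⟨Metric.ball_subset_closedBall hy, Set.uIoc_subset_uIcc ht⟩
  · exact intervalIntegrable_const
  · refine Filter.Eventually.of_forall fun t ht y hy => ?_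
    exact ((hg.differentiable (by simp) (y, t)).hasFDerivAt).comp y
      (hasFDerivAt_prodMk_left y t)

theorem contDiff_intervalIntegral {E F : Type} [NormedAddCommGroup E] [NormedSpace ℝ E]
    [FiniteDimensional ℝ E] [NormedAddCommGroup F] [NormedSpace ℝ F]
    {g : E × ℝ → F} (hg : ContDiff ℝ ∞ g) (a b : ℝ) :
    ContDiff ℝ ∞ (fun x => ∫ t in a..b, g (x, t)) := by
  rw [contDiff_infty]
  intro n
  -- The target space varies in the induction: the derivative is an integral of the same kind with
  -- values in `E →L[ℝ] F`.
  induction n generalizing F with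
  | zero =>
    rw [Nat.cast_zero, contDiff_zero]
    exact continuous_iff_continuousAt.2 fun x =>
      (hasFDerivAt_intervalIntegral hg a b x).continuousAt
  | succ n ih =>
    rw [Nat.cast_succ, contDiff_succ_iff_hasFDerivAt]
    exact ⟨_, ih (g := fun y => (fderiv ℝ g y).comp (ContinuousLinearMap.inl ℝ E ℝ))
      ((hg.fderiv_right (m := ∞) (by simp)).clm_comp contDiff_const),
      hasFDerivAt_intervalIntegral hg a b⟩

theorem intervalIntegral_swap_of_continuous {f : ℝ → ℝ → ℝ} (hf : Continuous f.uncurry)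
    (a b c d : ℝ) : ∫ x in a..b, ∫ y in c..d, f x y = ∫ y in c..d, ∫ x in a..b, f x y :=
  MeasureTheory.intervalIntegral_intervalIntegral_swap
    ((hf.continuousOn.integrableOn_compact (isCompact_uIcc.prod isCompact_uIcc)).mono_set
      (Set.prod_mono Set.uIoc_subset_uIcc Set.uIoc_subset_uIcc))

/-- The integral over `[0, 1]² × [0, 2π]`. -/
def boxIntegral (f : ℝ × ℝ × ℝ → ℝ) : ℝ :=
  ∫ s in (0 : ℝ)..1, ∫ t in (0 : ℝ)..1, ∫ φ in (0 : ℝ)..(2 * Real.pi), f (s, t, φ)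

theorem continuous_integral_inner {X : Type} [TopologicalSpace X] {f : X × ℝ → ℝ}
    (hf : Continuous f) (a b : ℝ) : Continuous fun x => ∫ t in a..b, f (x, t) :=
  intervalIntegral.continuous_parametric_intervalIntegral_of_continuous'
    (f := fun x t => f (x, t)) hf a b

theorem continuous_integral_box {f : ℝ × ℝ × ℝ → ℝ} (hf : Continuous f) :
    Continuous fun y : ℝ × ℝ => ∫ φ in (0 : ℝ)..(2 * Real.pi), f (y.1, y.2, φ) :=
  continuous_integral_inner (f := fun y : (ℝ × ℝ) × ℝ => f (y.1.1, y.1.2, y.2))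
    (hf.comp (by fun_prop)) _ _

theorem boxIntegral_add {f g : ℝ × ℝ × ℝ → ℝ} (hf : Continuous f) (hg : Continuous g) :
    boxIntegral (fun y => f y + g y) = boxIntegral f + boxIntegral g := by
  have h1 : ∀ (f : ℝ × ℝ × ℝ → ℝ), Continuous f → ∀ s t,
      IntervalIntegrable (fun φ => f (s, t, φ)) MeasureTheory.volume 0 (2 * Real.pi) :=
    fun f hf s t => (hf.comp (by fun_prop)).intervalIntegrable _ _
  have h2 : ∀ (f : ℝ × ℝ × ℝ → ℝ), Continuous f → ∀ s, IntervalIntegrable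
      (fun t => ∫ φ in (0 : ℝ)..(2 * Real.pi), f (s, t, φ)) MeasureTheory.volume 0 1 :=
    fun f hf s => ((continuous_integral_box hf).comp
      (by fun_prop : Continuous fun t : ℝ => (s, t))).intervalIntegrable _ _
  have h3 : ∀ (f : ℝ × ℝ × ℝ → ℝ), Continuous f → IntervalIntegrable
      (fun s => ∫ t in (0 : ℝ)..1, ∫ φ in (0 : ℝ)..(2 * Real.pi), f (s, t, φ))
      MeasureTheory.volume 0 1 :=
    fun f hf => (continuous_integral_inner (continuous_integral_box hf) 0 1).intervalIntegrable _ _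
  rw [boxIntegral, boxIntegral, boxIntegral, ← intervalIntegral.integral_add (h3 f hf) (h3 g hg)]
  congr 1
  funext s
  rw [← intervalIntegral.integral_add (h2 f hf s) (h2 g hg s)]
  congr 1
  funext t
  rw [← intervalIntegral.integral_add (h1 f hf s t) (h1 g hg s t)]

theorem boxIntegral_neg (f : ℝ × ℝ × ℝ → ℝ) : boxIntegral (fun y => -f y) = -boxIntegral f := by
  simp only [boxIntegral, intervalIntegral.integral_neg]

variable {η : ℝ × ℝ × ℝ → ℝ}

theorem continuous_fderiv_apply (hη : ContDiff ℝ ∞ η) (v : ℝ × ℝ × ℝ) :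
    Continuous fun y => fderiv ℝ η y v :=
  (hη.continuous_fderiv (by simp)).clm_apply continuous_const

/-- Fubini moves the `s`-integral innermost, where the fundamental theorem of calculus applies. -/
theorem boxIntegral_fderiv_fst (hη : ContDiff ℝ ∞ η) :
    boxIntegral (fun y => fderiv ℝ η y (1, 0, 0)) =
      (∫ t in (0 : ℝ)..1, ∫ φ in (0 : ℝ)..(2 * Real.pi), η (1, t, φ)) -
        ∫ t in (0 : ℝ)..1, ∫ φ in (0 : ℝ)..(2 * Real.pi), η (0, t, φ) := by
  have hc := continuous_fderiv_apply hη (1, 0, 0)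
  rw [boxIntegral, intervalIntegral_swap_of_continuous
    (f := fun s t => ∫ φ in (0 : ℝ)..(2 * Real.pi), fderiv ℝ η (s, t, φ) (1, 0, 0))
    (continuous_integral_box hc), ← intervalIntegral.integral_sub]
  · congr 1
    funext t
    rw [intervalIntegral_swap_of_continuous (f := fun s φ => fderiv ℝ η (s, t, φ) (1, 0, 0))
      (hc.comp (by fun_prop : Continuous fun y : ℝ × ℝ => (y.1, t, y.2))),
      ← intervalIntegral.integral_sub]
    · congr 1
      funext φ
      refine intervalIntegral.integral_eq_sub_of_hasDerivAt (f := fun s => η (s, t, φ))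
        (fun s _ => ?_) ((hc.comp (by fun_prop : Continuous fun s : ℝ =>
          (s, t, φ))).intervalIntegrable _ _)
      exact (hη.differentiable (by simp) (s, t, φ)).hasFDerivAt.comp_hasDerivAt s
        ((hasDerivAt_id s).prodMk (hasDerivAt_const s (t, φ)))
    · exact (hη.continuous.comp (by fun_prop)).intervalIntegrable _ _
    · exact (hη.continuous.comp (by fun_prop)).intervalIntegrable _ _
  · exact ((continuous_integral_box hη.continuous).comp
      (by fun_prop : Continuous fun t : ℝ => ((1 : ℝ), t))).intervalIntegrable _ _
  · exact ((continuous_integral_box hη.continuous).comp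
      (by fun_prop : Continuous fun t : ℝ => ((0 : ℝ), t))).intervalIntegrable _ _

theorem boxIntegral_fderiv_snd (hη : ContDiff ℝ ∞ η)
    (h0 : ∀ s ∈ Set.Icc (0 : ℝ) 1, ∀ φ, η (s, 0, φ) = 0)
    (h1 : ∀ s ∈ Set.Icc (0 : ℝ) 1, ∀ φ, η (s, 1, φ) = 0) :
    boxIntegral (fun y => fderiv ℝ η y (0, 1, 0)) = 0 := by
  have hc := continuous_fderiv_apply hη (0, 1, 0)
  refine (intervalIntegral.integral_congr (g := fun _ => 0) fun s hs => ?_).trans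
    intervalIntegral.integral_zero
  rw [Set.uIcc_of_le zero_le_one] at hs
  change (∫ t in (0 : ℝ)..1, ∫ φ in (0 : ℝ)..(2 * Real.pi), fderiv ℝ η (s, t, φ) (0, 1, 0)) = 0
  rw [intervalIntegral_swap_of_continuous (f := fun t φ => fderiv ℝ η (s, t, φ) (0, 1, 0))
    (hc.comp (by fun_prop : Continuous fun y : ℝ × ℝ => (s, y.1, y.2)))]
  refine (intervalIntegral.integral_congr (g := fun _ => 0) fun φ _ => ?_).trans
    intervalIntegral.integral_zero
  have := intervalIntegral.integral_eq_sub_of_hasDerivAt (f := fun t => η (s, t, φ))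
    (f' := fun t => fderiv ℝ η (s, t, φ) (0, 1, 0)) (a := 0) (b := 1) (fun t _ => ?_)
    ((hc.comp (by fun_prop : Continuous fun t : ℝ => (s, t, φ))).intervalIntegrable _ _)
  · exact this.trans (by rw [h0 s hs, h1 s hs, sub_zero])
  · exact (hη.differentiable (by simp) (s, t, φ)).hasFDerivAt.comp_hasDerivAt t
      ((hasDerivAt_const t s).prodMk ((hasDerivAt_id t).prodMk (hasDerivAt_const t φ)))

theorem boxIntegral_fderiv_trd (hη : ContDiff ℝ ∞ η)
    (h : ∀ s t, η (s, t, 2 * Real.pi) = η (s, t, 0)) :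
    boxIntegral (fun y => fderiv ℝ η y (0, 0, 1)) = 0 := by
  have hc := continuous_fderiv_apply hη (0, 0, 1)
  have key : ∀ s t, ∫ φ in (0 : ℝ)..(2 * Real.pi), fderiv ℝ η (s, t, φ) (0, 0, 1) = 0 := by
    intro s t
    have := intervalIntegral.integral_eq_sub_of_hasDerivAt (f := fun φ => η (s, t, φ))
      (f' := fun φ => fderiv ℝ η (s, t, φ) (0, 0, 1)) (a := 0) (b := 2 * Real.pi) (fun φ _ => ?_)
      ((hc.comp (by fun_prop : Continuous fun φ : ℝ => (s, t, φ))).intervalIntegrable _ _)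
    · rw [this, h, sub_self]
    · exact (hη.differentiable (by simp) (s, t, φ)).hasFDerivAt.comp_hasDerivAt φ
        ((hasDerivAt_const φ s).prodMk ((hasDerivAt_const φ t).prodMk (hasDerivAt_id φ)))
  simp only [boxIntegral, key, intervalIntegral.integral_zero]

/-- Stokes' theorem on `[0, 1]² × S¹` for a 2-form whose restriction to `[0, 1] × {0, 1} × S¹`
vanishes. -/
theorem boxIntegral_extDeriv {η₁ η₂ η₃ : ℝ × ℝ × ℝ → ℝ} (h₁ : ContDiff ℝ ∞ η₁)
    (h₂ : ContDiff ℝ ∞ η₂) (h₃ : ContDiff ℝ ∞ η₃)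
    (h20 : ∀ s ∈ Set.Icc (0 : ℝ) 1, ∀ φ, η₂ (s, 0, φ) = 0)
    (h21 : ∀ s ∈ Set.Icc (0 : ℝ) 1, ∀ φ, η₂ (s, 1, φ) = 0)
    (h3 : ∀ s t, η₃ (s, t, 2 * Real.pi) = η₃ (s, t, 0)) :
    boxIntegral (fun y => fderiv ℝ η₁ y (1, 0, 0) + -fderiv ℝ η₂ y (0, 1, 0)
        + fderiv ℝ η₃ y (0, 0, 1)) =
      (∫ t in (0 : ℝ)..1, ∫ φ in (0 : ℝ)..(2 * Real.pi), η₁ (1, t, φ)) -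
        ∫ t in (0 : ℝ)..1, ∫ φ in (0 : ℝ)..(2 * Real.pi), η₁ (0, t, φ) := by
  -- The 2-form is `η₁ dt∧dφ + η₂ ds∧dφ + η₃ ds∧dt`, whence the signs. The `t`-boundary vanishes by
  -- hypothesis and the `φ`-boundary cancels by periodicity; only the faces `s = 0, 1` remain.
  have c1 := continuous_fderiv_apply h₁ (1, 0, 0)
  have c2 := continuous_fderiv_apply h₂ (0, 1, 0)
  have c3 := continuous_fderiv_apply h₃ (0, 0, 1)
  rw [boxIntegral_add (f := fun y => fderiv ℝ η₁ y (1, 0, 0) + -fderiv ℝ η₂ y (0, 1, 0))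
    (c1.add c2.neg) c3,
    boxIntegral_add (g := fun y => -fderiv ℝ η₂ y (0, 1, 0)) c1 c2.neg, boxIntegral_neg,
    boxIntegral_fderiv_fst h₁, boxIntegral_fderiv_snd h₂ h20 h21, boxIntegral_fderiv_trd h₃ h3]
  ring

end

/-! ## The form `ν` on products -/

section
variable {V : Type} [NormedAddCommGroup V] [NormedSpace ℝ V]

/-- Smooth matrix-valued functions. -/
def SmoothMat (M : V → Matrix (Fin 2) (Fin 2) ℂ) : Prop := ∀ i j, ContDiff ℝ ∞ fun y => M y i j

/-- The derivative of a matrix-valued function in the direction `v`. -/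
def dirD (v : V) (M : V → Matrix (Fin 2) (Fin 2) ℂ) (y : V) : Matrix (Fin 2) (Fin 2) ℂ :=
  Matrix.of fun i j => fderiv ℝ (fun y => M y i j) y v

variable {M M' : V → Matrix (Fin 2) (Fin 2) ℂ}

theorem SmoothMat.mul (h : SmoothMat M) (h' : SmoothMat M') : SmoothMat fun y => M y * M' y := by
  intro i j
  simp only [Matrix.mul_apply]
  exact ContDiff.sum fun k _ => (h i k).mul (h' k j)

theorem SmoothMat.sub (h : SmoothMat M) (h' : SmoothMat M') : SmoothMat fun y => M y - M' y :=
  fun i j => (h i j).sub (h' i j)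

theorem SmoothMat.dirD (h : SmoothMat M) (v : V) : SmoothMat (dirD v M) := fun i j =>
  ((h i j).fderiv_right (m := ∞) (by simp)).clm_apply contDiff_const

theorem SmoothMat.trace (h : SmoothMat M) : ContDiff ℝ ∞ fun y => (M y).trace := by
  simp only [Matrix.trace_fin_two]
  exact (h 0 0).add (h 1 1)

theorem SmoothMat.differentiableAt (h : SmoothMat M) (i j : Fin 2) (y : V) :
    DifferentiableAt ℝ (fun y => M y i j) y := (h i j).differentiable (by simp) y

theorem dirD_mul (h : SmoothMat M) (h' : SmoothMat M') (v y : V) :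
    dirD v (fun y => M y * M' y) y = dirD v M y * M' y + M y * dirD v M' y := by
  ext i j
  simp only [dirD, Matrix.of_apply, Matrix.add_apply, Matrix.mul_apply, Fin.sum_univ_two]
  have d := fun i j => h.differentiableAt i j y
  have d' := fun i j => h'.differentiableAt i j y
  have e := (((d i 0).hasFDerivAt.mul (d' 0 j).hasFDerivAt).add
    ((d i 1).hasFDerivAt.mul (d' 1 j).hasFDerivAt)).fderiv
  refine (congrArg (fun L => L v) e).trans ?_
  simp
  ring

theorem dirD_sub (h : SmoothMat M) (h' : SmoothMat M') (v y : V) :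
    dirD v (fun y => M y - M' y) y = dirD v M y - dirD v M' y := by
  ext i j
  simp only [dirD, Matrix.of_apply, Matrix.sub_apply]
  rw [fderiv_fun_sub (h.differentiableAt i j y) (h'.differentiableAt i j y)]
  rfl

theorem fderiv_trace (h : SmoothMat M) (v y : V) :
    fderiv ℝ (fun y => (M y).trace) y v = (dirD v M y).trace := by
  simp only [Matrix.trace_fin_two]
  rw [fderiv_fun_add (h.differentiableAt 0 0 y) (h.differentiableAt 1 1 y)]
  rfl

theorem dirD_const (C : Matrix (Fin 2) (Fin 2) ℂ) (v y : V) : dirD v (fun _ => C) y = 0 := by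
  ext i j
  simp [dirD]

theorem dirD_comm (h : SmoothMat M) (u v y : V) : dirD u (dirD v M) y = dirD v (dirD u M) y := by
  ext i j
  have hs := ((h i j).contDiffAt (x := y)).isSymmSndFDerivAt (by
    rw [minSmoothness_of_isRCLikeNormedField]
    exact WithTop.coe_le_coe.2 (le_top : (2 : ℕ∞) ≤ ⊤))
  have hd : DifferentiableAt ℝ (fderiv ℝ fun y => M y i j) y :=
    ((h i j).fderiv_right (m := ∞) (by simp)).differentiable (by simp) y
  have key : ∀ u v : V, fderiv ℝ (fun y => fderiv ℝ (fun y => M y i j) y v) y u =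
      fderiv ℝ (fderiv ℝ fun y => M y i j) y u v := by
    intro u v
    have h3 := hd.hasFDerivAt.clm_apply (hasFDerivAt_const v y)
    rw [h3.fderiv]
    simp
  change fderiv ℝ (fun y => fderiv ℝ (fun y => M y i j) y v) y u =
    fderiv ℝ (fun y => fderiv ℝ (fun y => M y i j) y u) y v
  rw [key, key]
  exact hs u v

end

/-! ### Trace identities for `ν` and `C_{2,2}`. -/

section
variable {V : Type} [NormedAddCommGroup V] [NormedSpace ℝ V] {A B : V → SU2}

theorem SmoothSU2.smoothMat (h : SmoothSU2 A) : SmoothMat fun y => (A y).1 := h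

theorem SU2_inv_mul (h : SU2) : (h⁻¹).1 * h.1 = 1 := congrArg Subtype.val (inv_mul_cancel h)

theorem SU2_mul_inv (h : SU2) : h.1 * (h⁻¹).1 = 1 := congrArg Subtype.val (mul_inv_cancel h)

/-- Differentiate `A⁻¹A = 1`. -/
theorem dirD_inv (h : SmoothSU2 A) (v y : V) :
    dirD v (fun y => ((A y)⁻¹).1) y =
      -(((A y)⁻¹).1 * dirD v (fun y => (A y).1) y * ((A y)⁻¹).1) := by
  have h1 := dirD_mul h.inv.smoothMat h.smoothMat v y
  simp only [SU2_inv_mul, dirD_const] at h1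
  have h2 := congrArg (· * ((A y)⁻¹).1) h1
  simp only [Matrix.zero_mul, Matrix.add_mul, Matrix.mul_assoc, SU2_mul_inv, Matrix.mul_one] at h2
  rw [Matrix.mul_assoc]
  exact eq_neg_of_add_eq_zero_left h2.symm

/-- The sum of `sgn(σ) tr(h⁻¹X_{σ0} h⁻¹X_{σ1} h⁻¹X_{σ2})`. -/
def traceCube (h : SU2) (X : Fin 3 → Matrix (Fin 2) (Fin 2) ℂ) : ℂ :=
  ∑ σ : Equiv.Perm (Fin 3), ((Equiv.Perm.sign σ : ℤ) : ℂ) *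
      (((h⁻¹).1 * X (σ 0)) * ((h⁻¹).1 * X (σ 1)) * ((h⁻¹).1 * X (σ 2))).trace

/-- `tr(h₂⁻¹ h₁⁻¹ dh₁ dh₂)`. -/
def traceMixed (h₁ h₂ : SU2) (X₁ X₂ Y₁ Y₂ : Matrix (Fin 2) (Fin 2) ℂ) : ℂ :=
  ((h₂⁻¹).1 * (h₁⁻¹).1 * (X₁ * Y₂ - Y₁ * X₂)).trace

/-- The alternating sum of `tr(X_{σ0} X_{σ1} X_{σ2})`. -/
def altTrace (x y z : Matrix (Fin 2) (Fin 2) ℂ) : ℂ :=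
  3 * ((x * y * z).trace - (x * z * y).trace)

/-- The six permutations fall into two classes under cyclic rotation, with opposite signs; by
cyclicity of the trace each class contributes three equal terms. -/
theorem traceCube_eq (h : SU2) (X Y Z : Matrix (Fin 2) (Fin 2) ℂ) :
    traceCube h ![X, Y, Z] = altTrace ((h⁻¹).1 * X) ((h⁻¹).1 * Y) ((h⁻¹).1 * Z) := by
  have cyc : ∀ a b c : Matrix (Fin 2) (Fin 2) ℂ, (a * b * c).trace = (b * c * a).trace :=
    fun a b c => by rw [Matrix.mul_assoc, Matrix.trace_mul_comm]
  generalize e1 : (h⁻¹).1 * X = x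
  generalize e2 : (h⁻¹).1 * Y = y
  generalize e3 : (h⁻¹).1 * Z = z
  have hX : ∀ i, (h⁻¹).1 * (![X, Y, Z] : Fin 3 → _) i = (![x, y, z] : Fin 3 → _) i := by
    intro i
    fin_cases i <;> simp [e1, e2, e3]
  have hp : (Finset.univ : Finset (Equiv.Perm (Fin 3))) = {1, Equiv.swap 0 1, Equiv.swap 0 2,
      Equiv.swap 1 2, Equiv.swap 0 1 * Equiv.swap 1 2, Equiv.swap 1 2 * Equiv.swap 0 1} := by
    decide
  simp only [traceCube, hX, hp]
  rw [Finset.sum_insert (by decide), Finset.sum_insert (by decide), Finset.sum_insert (by decide),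
    Finset.sum_insert (by decide), Finset.sum_insert (by decide), Finset.sum_singleton]
  have s01 : (Equiv.swap (0 : Fin 3) 1) 2 = 2 := by decide
  have s02 : (Equiv.swap (0 : Fin 3) 2) 1 = 1 := by decide
  have s12 : (Equiv.swap (1 : Fin 3) 2) 0 = 0 := by decide
  have g1 : ∀ i j : Fin 3, i ≠ j → Equiv.Perm.sign (Equiv.swap i j) = -1 := fun i j h =>
    Equiv.Perm.sign_swap h
  simp [s01, s02, s12, altTrace, g1]
  rw [cyc z x y, cyc z y x, cyc y x z, ← cyc x y z]
  ring

theorem altTrace_conj (h : SU2) (x y z : Matrix (Fin 2) (Fin 2) ℂ) :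
    altTrace ((h⁻¹).1 * x * h.1) ((h⁻¹).1 * y * h.1) ((h⁻¹).1 * z * h.1) = altTrace x y z := by
  have key : ∀ x y z : Matrix (Fin 2) (Fin 2) ℂ,
      (((h⁻¹).1 * x * h.1) * ((h⁻¹).1 * y * h.1) * ((h⁻¹).1 * z * h.1)).trace =
        (x * y * z).trace := by
    intro x y z
    have e : ((h⁻¹).1 * x * h.1) * ((h⁻¹).1 * y * h.1) * ((h⁻¹).1 * z * h.1) =
        (h⁻¹).1 * (x * (h.1 * (h⁻¹).1) * y * (h.1 * (h⁻¹).1) * z * h.1) := by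
      simp only [Matrix.mul_assoc]
    rw [e, SU2_mul_inv, Matrix.trace_mul_comm]
    simp only [Matrix.mul_one, Matrix.mul_assoc, SU2_mul_inv]
  rw [altTrace, key, key, altTrace]

/-- The mixed terms are grouped in the shape produced by differentiating the inverses in
`traceMixed`, so that they can be matched in `traceCube_mul`. -/
theorem altTrace_add (a₁ a₂ a₃ b₁ b₂ b₃ : Matrix (Fin 2) (Fin 2) ℂ) :
    altTrace (a₁ + b₁) (a₂ + b₂) (a₃ + b₃) = altTrace a₁ a₂ a₃ + altTrace b₁ b₂ b₃ +
      3 * ((b₁ * (a₂ * b₃ - a₃ * b₂)).trace + (a₁ * (a₂ * b₃ - a₃ * b₂)).trace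
        - (b₂ * (a₁ * b₃ - a₃ * b₁)).trace - (a₂ * (a₁ * b₃ - a₃ * b₁)).trace
        + (b₃ * (a₁ * b₂ - a₂ * b₁)).trace + (a₃ * (a₁ * b₂ - a₂ * b₁)).trace) := by
  simp only [altTrace, Matrix.trace_fin_two, Matrix.mul_apply, Fin.sum_univ_two,
    Matrix.add_apply, Matrix.sub_apply]
  ring

/-- `d tr(h₂⁻¹ h₁⁻¹ dh₁ dh₂)` measures the failure of `tr (h⁻¹dh)³` to be additive. -/
theorem traceCube_mul (hA : SmoothSU2 A) (hB : SmoothSU2 B) (u v w y : V) :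
    let D := fun (x : V) (C : V → SU2) (y : V) => dirD x (fun y => (C y).1) y
    let T := fun (x x' : V) (y : V) =>
      traceMixed (A y) (B y) (D x A y) (D x B y) (D x' A y) (D x' B y)
    traceCube (A y * B y) ![D u (fun y => A y * B y) y, D v (fun y => A y * B y) y,
        D w (fun y => A y * B y) y] =
      traceCube (A y) ![D u A y, D v A y, D w A y] + traceCube (B y) ![D u B y, D v B y, D w B y]
        - 3 * (fderiv ℝ (T v w) y u - fderiv ℝ (T u w) y v + fderiv ℝ (T u v) y w) := by
  intro D T
  have sA := hA.smoothMat
  have sB := hB.smoothMat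
  have sA' := hA.inv.smoothMat
  have sB' := hB.inv.smoothMat
  -- The first two traces come from differentiating `B⁻¹` and `A⁻¹`; the third contains the second
  -- derivatives, which cancel in the alternating sum.
  have hT : ∀ x x' x'' : V, fderiv ℝ (T x x') y x'' =
      -((D x'' B y * ((B y)⁻¹).1) * ((((A y)⁻¹).1 * D x A y) * (D x' B y * ((B y)⁻¹).1)
          - (((A y)⁻¹).1 * D x' A y) * (D x B y * ((B y)⁻¹).1))).trace
      - ((((A y)⁻¹).1 * D x'' A y) * ((((A y)⁻¹).1 * D x A y) * (D x' B y * ((B y)⁻¹).1)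
          - (((A y)⁻¹).1 * D x' A y) * (D x B y * ((B y)⁻¹).1))).trace
      + (((B y)⁻¹).1 * ((A y)⁻¹).1 * (dirD x'' (D x A) y * D x' B y + D x A y * dirD x'' (D x' B) y
          - (dirD x'' (D x' A) y * D x B y + D x' A y * dirD x'' (D x B) y))).trace := by
    intro x x' x''
    have s1 := (sA.dirD x).mul (sB.dirD x')
    have s2 := (sA.dirD x').mul (sB.dirD x)
    refine (fderiv_trace ((sB'.mul sA').mul (s1.sub s2)) x'' y).trans ?_
    rw [dirD_mul (sB'.mul sA') (s1.sub s2), dirD_mul sB' sA', dirD_sub s1 s2,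
      dirD_mul (sA.dirD x) (sB.dirD x'), dirD_mul (sA.dirD x') (sB.dirD x), dirD_inv hA,
      dirD_inv hB, Matrix.trace_add]
    congr 1
    change ((-(((B y)⁻¹).1 * D x'' B y * ((B y)⁻¹).1) * ((A y)⁻¹).1 +
      ((B y)⁻¹).1 * -(((A y)⁻¹).1 * D x'' A y * ((A y)⁻¹).1)) *
        (D x A y * D x' B y - D x' A y * D x B y)).trace = _
    generalize ((B y)⁻¹).1 = R
    generalize ((A y)⁻¹).1 = P
    generalize D x'' B y = b''
    generalize D x' B y = b'
    generalize D x B y = b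
    generalize D x'' A y = a''
    generalize D x' A y = a'
    generalize D x A y = a
    have c1 : ∀ p q : Matrix (Fin 2) (Fin 2) ℂ,
        (R * (b'' * (R * (P * (p * q))))).trace = (b'' * (R * (P * (p * (q * R))))).trace :=
      fun p q => by rw [Matrix.trace_mul_comm]; simp only [Matrix.mul_assoc]
    have c2 : ∀ p q : Matrix (Fin 2) (Fin 2) ℂ,
        (R * (P * (a'' * (P * (p * q))))).trace = (P * (a'' * (P * (p * (q * R))))).trace :=
      fun p q => by rw [Matrix.trace_mul_comm]; simp only [Matrix.mul_assoc]
    simp only [Matrix.add_mul, Matrix.mul_sub, Matrix.neg_mul, Matrix.mul_neg, Matrix.trace_add,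
      Matrix.trace_sub, Matrix.trace_neg, Matrix.mul_assoc, c1, c2]
    ring
  -- `(AB)⁻¹d(AB) = B⁻¹(A⁻¹dA + dB B⁻¹)B`; the outer conjugation by `B` is invisible to the trace.
  have hD : ∀ x, ((A y * B y)⁻¹).1 * D x (fun y => A y * B y) y = ((B y)⁻¹).1 *
      (((A y)⁻¹).1 * D x A y + D x B y * ((B y)⁻¹).1) * (B y).1 := by
    intro x
    have e : ((A y * B y)⁻¹).1 = ((B y)⁻¹).1 * ((A y)⁻¹).1 :=
      congrArg Subtype.val (mul_inv_rev (A y) (B y))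
    have e2 : D x (fun y => A y * B y) y = D x A y * (B y).1 + (A y).1 * D x B y :=
      dirD_mul sA sB x y
    have e3 : ∀ X : Matrix (Fin 2) (Fin 2) ℂ, ((A y)⁻¹).1 * ((A y).1 * X) = X := fun X => by
      rw [← Matrix.mul_assoc, SU2_inv_mul, Matrix.one_mul]
    rw [e, e2]
    simp only [Matrix.mul_add, Matrix.add_mul, Matrix.mul_assoc, e3, SU2_inv_mul, Matrix.mul_one]
  -- The cube of `B⁻¹dB` is rewritten through `dB B⁻¹`, the form in which `B` enters the product.
  have hB3 : traceCube (B y) ![D u B y, D v B y, D w B y] =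
      altTrace (D u B y * ((B y)⁻¹).1) (D v B y * ((B y)⁻¹).1) (D w B y * ((B y)⁻¹).1) := by
    rw [traceCube_eq, ← altTrace_conj (B y) (D u B y * ((B y)⁻¹).1)]
    have e : ∀ X : Matrix (Fin 2) (Fin 2) ℂ,
        ((B y)⁻¹).1 * (X * ((B y)⁻¹).1) * (B y).1 = ((B y)⁻¹).1 * X := fun X => by
      simp only [Matrix.mul_assoc, SU2_inv_mul, Matrix.mul_one]
    rw [e, e, e]
  have hAc : ∀ x x', dirD x (D x' A) y = dirD x' (D x A) y := fun x x' => dirD_comm sA x x' y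
  have hBc : ∀ x x', dirD x (D x' B) y = dirD x' (D x B) y := fun x x' => dirD_comm sB x x' y
  rw [traceCube_eq, hD, hD, hD, altTrace_conj, altTrace_add, traceCube_eq, hB3, hT, hT, hT,
    hAc v u, hAc w u, hAc w v, hBc v u, hBc w u, hBc w v]
  simp only [Matrix.mul_add, Matrix.mul_sub, Matrix.trace_add, Matrix.trace_sub]
  ring

end

/-! ## The integrals of `ν` and `C_{2,2}` -/

section
variable {V : Type} [NormedAddCommGroup V] [NormedSpace ℝ V] {A B : V → SU2}

/-- Chain rule. It turns the derivatives along curves in the definitions of the integrals into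
values of jointly smooth functions, to which Fubini and Stokes apply. -/
theorem curveDeriv_eq_dirD (hA : SmoothSU2 A) {c : ℝ → V} {t : ℝ} {v : V}
    (hc : HasDerivAt c v t) :
    curveDeriv (fun r => A (c r)) t = dirD v (fun y => (A y).1) (c t) := by
  ext i j
  exact (((hA i j).differentiable (by simp) (c t)).hasFDerivAt.comp_hasDerivAt t hc).deriv

/-- Homotopies are prescribed only on `[0, 1]`. At its ends the derivative is still determined,
since `[0, 1]` has unique derivatives and both curves are smooth on `ℝ`. -/
theorem curveDeriv_congr {f g : ℝ → SU2} (hf : SmoothSU2 f) (hg : SmoothSU2 g)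
    (h : Set.EqOn f g (Set.Icc 0 1)) {t : ℝ} (ht : t ∈ Set.Icc (0 : ℝ) 1) :
    curveDeriv f t = curveDeriv g t := by
  ext i j
  have df := ((hf i j).differentiable (by simp) t).hasDerivAt.hasDerivWithinAt (s := Set.Icc 0 1)
  have dg := ((hg i j).differentiable (by simp) t).hasDerivAt.hasDerivWithinAt (s := Set.Icc 0 1)
  exact (uniqueDiffOn_Icc_zero_one t ht).eq_deriv _ df
    (dg.congr (fun r hr => by rw [h hr]) (by rw [h ht]))

theorem curveDeriv_const (g : SU2) (t : ℝ) : curveDeriv (fun _ => g) t = 0 := by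
  ext i j
  simp [curveDeriv]

theorem curveDeriv_mul {f g : ℝ → SU2} (hf : SmoothSU2 f) (hg : SmoothSU2 g) (t : ℝ) :
    curveDeriv (fun r => f r * g r) t =
      curveDeriv f t * (g t).1 + (f t).1 * curveDeriv g t := by
  have e : ∀ {h : ℝ → SU2}, SmoothSU2 h → curveDeriv h t = dirD 1 (fun y => (h y).1) t :=
    fun hh => curveDeriv_eq_dirD hh (hasDerivAt_id t)
  rw [e hf, e hg, e (hf.mul hg)]
  exact dirD_mul hf.smoothMat hg.smoothMat 1 t

theorem contDiff_traceMixed (hA : SmoothSU2 A) (hB : SmoothSU2 B) (u v : V) :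
    ContDiff ℝ ∞ fun y => traceMixed (A y) (B y) (dirD u (fun y => (A y).1) y)
      (dirD u (fun y => (B y).1) y) (dirD v (fun y => (A y).1) y)
      (dirD v (fun y => (B y).1) y) := by
  have hA' := hA.smoothMat.dirD
  have hB' := hB.smoothMat.dirD
  exact ((hB.inv.smoothMat.mul hA.inv.smoothMat).mul
    (((hA' u).mul (hB' v)).sub ((hA' v).mul (hB' u)))).trace

/-- The pullback of `C_{2,2}` along a pair of maps into `SU(2)`. -/
def c22Pull (A B : V → SU2) (u v y : V) : ℝ :=
  c22Form (A y) (B y) (dirD u (fun y => (A y).1) y) (dirD u (fun y => (B y).1) y)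
    (dirD v (fun y => (A y).1) y) (dirD v (fun y => (B y).1) y)

/-- The pullback of `ν` along a map into `SU(2)`. -/
def nuPull (A : V → SU2) (u v w y : V) : ℝ :=
  nuForm (A y) ![dirD u (fun y => (A y).1) y, dirD v (fun y => (A y).1) y,
    dirD w (fun y => (A y).1) y]

theorem contDiff_nuPull (hA : SmoothSU2 A) (u v w : V) : ContDiff ℝ ∞ (nuPull A u v w) := by
  have hi := hA.inv.smoothMat
  have hd := hA.smoothMat.dirD
  have e : ∀ u v w : V, ContDiff ℝ ∞ fun y => ((((A y)⁻¹).1 * dirD u (fun y => (A y).1) y) *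
      (((A y)⁻¹).1 * dirD v (fun y => (A y).1) y) *
      (((A y)⁻¹).1 * dirD w (fun y => (A y).1) y)).trace := fun u v w =>
    (((hi.mul (hd u)).mul (hi.mul (hd v))).mul (hi.mul (hd w))).trace
  change ContDiff ℝ ∞ fun y => ((1 / (2 * Real.pi * Complex.I)) ^ 2 * (-1 / 6) *
    traceCube (A y) ![dirD u (fun y => (A y).1) y, dirD v (fun y => (A y).1) y,
      dirD w (fun y => (A y).1) y]).re
  simp only [traceCube_eq, altTrace]
  exact Complex.reCLM.contDiff.comp
    (contDiff_const.mul (contDiff_const.mul ((e u v w).sub (e u w v))))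

theorem contDiff_c22Pull (hA : SmoothSU2 A) (hB : SmoothSU2 B) (u v : V) :
    ContDiff ℝ ∞ (c22Pull A B u v) :=
  Complex.reCLM.contDiff.comp (contDiff_const.mul (contDiff_traceMixed hA hB u v))

/-- The relation `ν(AB) = ν(A) + ν(B) + dC_{2,2}`. The constants fit because `(-1/6)(-3) = 1/2`,
with `-3` the factor in `traceCube_mul`. -/
theorem nuPull_mul (hA : SmoothSU2 A) (hB : SmoothSU2 B) (u v w y : V) :
    nuPull (fun y => A y * B y) u v w y = nuPull A u v w y + nuPull B u v w y +
      (fderiv ℝ (c22Pull A B v w) y u + -fderiv ℝ (c22Pull A B u w) y v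
        + fderiv ℝ (c22Pull A B u v) y w) := by
  have hd : ∀ x x' x'' : V, fderiv ℝ (c22Pull A B x x') y x'' =
      ((1 / (2 * Real.pi * Complex.I)) ^ 2 * (1 / 2) * fderiv ℝ (fun y => traceMixed (A y) (B y)
      (dirD x (fun y => (A y).1) y) (dirD x (fun y => (B y).1) y) (dirD x' (fun y => (A y).1) y)
      (dirD x' (fun y => (B y).1) y)) y x'').re := by
    intro x x' x''
    have h1 := ((contDiff_traceMixed hA hB x x').differentiable (by simp) y).hasFDerivAt.const_mul
      ((1 / (2 * Real.pi * Complex.I)) ^ 2 * (1 / 2))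
    exact congrArg (fun L => L x'') (Complex.reCLM.hasFDerivAt.comp y h1).fderiv
  have h := traceCube_mul hA hB u v w y
  dsimp only at h
  change ((1 / (2 * Real.pi * Complex.I)) ^ 2 * (-1 / 6) * traceCube _ _).re =
    ((1 / (2 * Real.pi * Complex.I)) ^ 2 * (-1 / 6) * traceCube _ _).re +
    ((1 / (2 * Real.pi * Complex.I)) ^ 2 * (-1 / 6) * traceCube _ _).re + _
  rw [h, hd, hd, hd, ← Complex.neg_re, ← Complex.add_re, ← Complex.add_re, ← Complex.add_re,
    ← Complex.add_re]
  congr 1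
  ring

end

/-! ### Integrals over families of loops -/

/-- The map `(s, t, φ) ↦ F(s, t)(e^{iφ})`. -/
def evalFamily (F : ℝ → ℝ → LG) (y : ℝ × ℝ × ℝ) : SU2 := (F y.1 y.2.1).1 (Circle.exp y.2.2)

theorem hasDerivAt_slot1 (s t φ : ℝ) :
    HasDerivAt (fun r : ℝ => (r, t, φ)) ((1 : ℝ), (0 : ℝ), (0 : ℝ)) s :=
  (hasDerivAt_id s).prodMk (hasDerivAt_const s (t, φ))

theorem hasDerivAt_slot2 {E : Type} [NormedAddCommGroup E] [NormedSpace ℝ E] (s : E) (t φ : ℝ) :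
    HasDerivAt (fun r : ℝ => (s, r, φ)) ((0 : E), (1 : ℝ), (0 : ℝ)) t :=
  (hasDerivAt_const t s).prodMk ((hasDerivAt_id t).prodMk (hasDerivAt_const t φ))

theorem hasDerivAt_slot3 {E : Type} [NormedAddCommGroup E] [NormedSpace ℝ E] (s : E) (t φ : ℝ) :
    HasDerivAt (fun r : ℝ => (s, t, r)) ((0 : E), (0 : ℝ), (1 : ℝ)) φ :=
  (hasDerivAt_const φ s).prodMk ((hasDerivAt_const φ t).prodMk (hasDerivAt_id φ))

theorem nuIntegral_eq {F : ℝ → ℝ → LG} (hF : SmoothSU2 (evalFamily F)) :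
    nuIntegral F = boxIntegral (nuPull (evalFamily F) (1, 0, 0) (0, 1, 0) (0, 0, 1)) := by
  have key : ∀ s t φ : ℝ, nuForm ((F s t).1 (Circle.exp φ))
      ![curveDeriv (fun r => (F r t).1 (Circle.exp φ)) s,
        curveDeriv (fun r => (F s r).1 (Circle.exp φ)) t,
        curveDeriv (fun r => (F s t).1 (Circle.exp r)) φ] =
      nuPull (evalFamily F) (1, 0, 0) (0, 1, 0) (0, 0, 1) (s, t, φ) := by
    intro s t φ
    rw [nuPull, ← curveDeriv_eq_dirD hF (hasDerivAt_slot1 s t φ),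
      ← curveDeriv_eq_dirD hF (hasDerivAt_slot2 s t φ),
      ← curveDeriv_eq_dirD hF (hasDerivAt_slot3 s t φ)]
    rfl
  simp only [nuIntegral, key]
  rfl

/-- The parameter `x` serves both as the homotopy variable, in the Polyakov–Wiegmann formula, and as
the variable of a plot, for smooth dependence. -/
theorem c22Integral_eq {E : Type} [NormedAddCommGroup E] [NormedSpace ℝ E] {P P' : E → ℝ → LG}
    (hP : SmoothSU2 fun y : E × ℝ × ℝ => (P y.1 y.2.1).1 (Circle.exp y.2.2))
    (hP' : SmoothSU2 fun y : E × ℝ × ℝ => (P' y.1 y.2.1).1 (Circle.exp y.2.2)) (x : E) :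
    c22Integral (P x) (P' x) = ∫ t in (0 : ℝ)..1, ∫ φ in (0 : ℝ)..(2 * Real.pi),
      c22Pull (fun y : E × ℝ × ℝ => (P y.1 y.2.1).1 (Circle.exp y.2.2))
        (fun y : E × ℝ × ℝ => (P' y.1 y.2.1).1 (Circle.exp y.2.2)) (0, 1, 0) (0, 0, 1)
        (x, t, φ) := by
  rw [c22Integral]
  congr 1
  funext t
  congr 1
  funext φ
  rw [c22Pull, ← curveDeriv_eq_dirD hP (hasDerivAt_slot2 x t φ),
    ← curveDeriv_eq_dirD hP (hasDerivAt_slot3 x t φ),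
    ← curveDeriv_eq_dirD hP' (hasDerivAt_slot2 x t φ),
    ← curveDeriv_eq_dirD hP' (hasDerivAt_slot3 x t φ)]

/-- The Polyakov–Wiegmann formula. -/
theorem nuIntegral_mul {F G : ℝ → ℝ → LG} (hF : SmoothSU2 (evalFamily F))
    (hG : SmoothSU2 (evalFamily G))
    (hF0 : ∀ s ∈ Set.Icc (0 : ℝ) 1, F s 0 = F 0 0) (hF1 : ∀ s ∈ Set.Icc (0 : ℝ) 1, F s 1 = F 0 1)
    (hG0 : ∀ s ∈ Set.Icc (0 : ℝ) 1, G s 0 = G 0 0)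
    (hG1 : ∀ s ∈ Set.Icc (0 : ℝ) 1, G s 1 = G 0 1) :
    nuIntegral (fun s t => F s t * G s t) = nuIntegral F + nuIntegral G +
      (c22Integral (F 1) (G 1) - c22Integral (F 0) (G 0)) := by
  have hFG : SmoothSU2 (evalFamily fun s t => F s t * G s t) := hF.mul hG
  have c1 := contDiff_c22Pull hF hG (0, 1, 0) (0, 0, 1)
  have c2 := contDiff_c22Pull hF hG (1, 0, 0) (0, 0, 1)
  have c3 := contDiff_c22Pull hF hG (1, 0, 0) (0, 1, 0)
  -- The ends of the homotopy are fixed, so the `s`-derivative vanishes at `t = 0, 1`. This kills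
  -- the `ds∧dφ` coefficient there, which is the boundary hypothesis of Stokes.
  have zero : ∀ {F : ℝ → ℝ → LG}, SmoothSU2 (evalFamily F) → ∀ t,
      (∀ s ∈ Set.Icc (0 : ℝ) 1, F s t = F 0 t) → ∀ s ∈ Set.Icc (0 : ℝ) 1, ∀ φ,
      dirD (1, 0, 0) (fun y => (evalFamily F y).1) (s, t, φ) = 0 := by
    intro F hF t h s hs φ
    rw [← curveDeriv_eq_dirD hF (hasDerivAt_slot1 s t φ),
      curveDeriv_congr (g := fun _ => (F 0 t).1 (Circle.exp φ))
        (hF.comp (by fun_prop : ContDiff ℝ ∞ fun r : ℝ => (r, t, φ))) (SmoothSU2.const _) ?_ hs,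
      curveDeriv_const]
    intro r hr
    exact congrArg (fun γ : LG => γ.1 (Circle.exp φ)) (h r hr)
  have van : ∀ t, (∀ s ∈ Set.Icc (0 : ℝ) 1, F s t = F 0 t) →
      (∀ s ∈ Set.Icc (0 : ℝ) 1, G s t = G 0 t) → ∀ s ∈ Set.Icc (0 : ℝ) 1, ∀ φ,
      c22Pull (evalFamily F) (evalFamily G) (1, 0, 0) (0, 0, 1) (s, t, φ) = 0 := by
    intro t h h' s hs φ
    rw [c22Pull, zero hF t h s hs, zero hG t h' s hs]
    simp [c22Form]
  have hper : ∀ s t, c22Pull (evalFamily F) (evalFamily G) (1, 0, 0) (0, 1, 0)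
      (s, t, 2 * Real.pi) = c22Pull (evalFamily F) (evalFamily G) (1, 0, 0) (0, 1, 0)
      (s, t, 0) := by
    intro s t
    have e : ∀ (F : ℝ → ℝ → LG) (s t : ℝ), evalFamily F (s, t, 2 * Real.pi) =
        evalFamily F (s, t, 0) := fun F s t => by
      simp [evalFamily, Circle.exp_two_pi, Circle.exp_zero]
    have e1 : ∀ {F : ℝ → ℝ → LG}, SmoothSU2 (evalFamily F) →
        dirD (1, 0, 0) (fun y => (evalFamily F y).1) (s, t, 2 * Real.pi) =
        dirD (1, 0, 0) (fun y => (evalFamily F y).1) (s, t, 0) := fun {F} hF => by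
      rw [← curveDeriv_eq_dirD hF (hasDerivAt_slot1 s t _),
        ← curveDeriv_eq_dirD hF (hasDerivAt_slot1 s t _)]
      simp only [e]
    have e2 : ∀ {F : ℝ → ℝ → LG}, SmoothSU2 (evalFamily F) →
        dirD (0, 1, 0) (fun y => (evalFamily F y).1) (s, t, 2 * Real.pi) =
        dirD (0, 1, 0) (fun y => (evalFamily F y).1) (s, t, 0) := fun {F} hF => by
      rw [← curveDeriv_eq_dirD hF (hasDerivAt_slot2 s t _),
        ← curveDeriv_eq_dirD hF (hasDerivAt_slot2 s t _)]
      simp only [e]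
    rw [c22Pull, c22Pull, e, e, e1 hF, e1 hG, e2 hF, e2 hG]
  have hnF := (contDiff_nuPull hF (1, 0, 0) (0, 1, 0) (0, 0, 1)).continuous
  have hnG := (contDiff_nuPull hG (1, 0, 0) (0, 1, 0) (0, 0, 1)).continuous
  rw [nuIntegral_eq hFG, nuIntegral_eq hF, nuIntegral_eq hG, c22Integral_eq hF hG,
    c22Integral_eq hF hG]
  have h := boxIntegral_extDeriv c1 c2 c3 (van 0 hF0 hG0) (van 1 hF1 hG1) hper
  refine Eq.trans ?_ (congrArg (boxIntegral (nuPull (evalFamily F) (1, 0, 0) (0, 1, 0) (0, 0, 1))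
    + boxIntegral (nuPull (evalFamily G) (1, 0, 0) (0, 1, 0) (0, 0, 1)) + ·) h)
  rw [← boxIntegral_add hnF hnG]
  refine Eq.trans ?_ (boxIntegral_add (hnF.add hnG) (((continuous_fderiv_apply c1 _).add
    (continuous_fderiv_apply c2 _).neg).add (continuous_fderiv_apply c3 _)))
  congr 1
  funext y
  exact nuPull_mul hF hG (1, 0, 0) (0, 1, 0) (0, 0, 1) y

theorem nuIntegral_const_fst (σ : ℝ → LG) : nuIntegral (fun _ t => σ t) = 0 := by
  have e : ∀ (h : SU2) (Y Z : Matrix (Fin 2) (Fin 2) ℂ), nuForm h ![0, Y, Z] = 0 := by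
    intro h Y Z
    change (_ * traceCube h ![0, Y, Z]).re = 0
    rw [traceCube_eq, altTrace]
    simp
  simp only [nuIntegral, curveDeriv_const, e, intervalIntegral.integral_zero]

theorem c22Integral_congr {σ σ' τ τ' : BasedPath} (h : ∀ t ∈ Set.Icc (0 : ℝ) 1, σ t = σ' t)
    (h' : ∀ t ∈ Set.Icc (0 : ℝ) 1, τ t = τ' t) : c22Integral σ τ = c22Integral σ' τ' := by
  rw [c22Integral, c22Integral]
  refine intervalIntegral.integral_congr fun t ht => ?_
  rw [Set.uIcc_of_le zero_le_one] at ht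
  refine intervalIntegral.integral_congr fun φ _ => ?_
  have sm : ∀ σ : BasedPath, SmoothSU2 fun r => (σ r).1 (Circle.exp φ) := fun σ =>
    σ.smooth.comp (by fun_prop : ContDiff ℝ ∞ fun r : ℝ => (r, φ))
  have e : ∀ {σ σ' : BasedPath}, (∀ t ∈ Set.Icc (0 : ℝ) 1, σ t = σ' t) →
      curveDeriv (fun r => (σ r).1 (Circle.exp φ)) t =
        curveDeriv (fun r => (σ' r).1 (Circle.exp φ)) t := fun {σ σ'} h =>
    curveDeriv_congr (sm σ) (sm σ') (fun r hr => by
      change (σ r).1 _ = (σ' r).1 _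
      rw [h r hr]) ht
  simp only [h t ht, h' t ht, e h, e h']

theorem contDiff_intervalIntegral₂ {E : Type} [NormedAddCommGroup E] [NormedSpace ℝ E]
    [FiniteDimensional ℝ E] {g : E × ℝ × ℝ → ℝ} (hg : ContDiff ℝ ∞ g) (a b c d : ℝ) :
    ContDiff ℝ ∞ fun x => ∫ t in a..b, ∫ φ in c..d, g (x, t, φ) := by
  have h : ContDiff ℝ ∞ fun y : (E × ℝ) × ℝ => g (y.1.1, y.1.2, y.2) := hg.comp (by fun_prop)
  exact contDiff_intervalIntegral (contDiff_intervalIntegral h c d) a b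

theorem contDiff_intervalIntegral₃ {E : Type} [NormedAddCommGroup E] [NormedSpace ℝ E]
    [FiniteDimensional ℝ E] {g : E × ℝ × ℝ × ℝ → ℝ} (hg : ContDiff ℝ ∞ g) (a b c d a' b' : ℝ) :
    ContDiff ℝ ∞ fun x => ∫ s in a..b, ∫ t in c..d, ∫ φ in a'..b', g (x, s, t, φ) := by
  have h : ContDiff ℝ ∞ fun y : (E × ℝ) × ℝ × ℝ => g (y.1.1, y.1.2, y.2) :=
    hg.comp (by fun_prop)
  exact contDiff_intervalIntegral (contDiff_intervalIntegral₂ h c d a' b') a b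

theorem contDiff_c22Integral {n : ℕ} {P P' : Eu n → BasedPath} (hP : IsPlot P)
    (hP' : IsPlot P') : ContDiff ℝ ∞ fun x => c22Integral (P x) (P' x) := by
  have hP : SmoothSU2 fun y : Eu n × ℝ × ℝ => (P y.1 y.2.1).1 (Circle.exp y.2.2) := hP
  have hP' : SmoothSU2 fun y : Eu n × ℝ × ℝ => (P' y.1 y.2.1).1 (Circle.exp y.2.2) := hP'
  have e := c22Integral_eq (P := fun x => P x) (P' := fun x => P' x) hP hP'
  simp only [e]
  exact contDiff_intervalIntegral₂ (contDiff_c22Pull hP hP' _ _) _ _ _ _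

theorem contDiff_nuIntegral {n : ℕ} {F : Eu n → ℝ → ℝ → LG}
    (hF : SmoothSU2 fun y : Eu n × ℝ × ℝ × ℝ => (F y.1 y.2.1 y.2.2.1).1 (Circle.exp y.2.2.2)) :
    ContDiff ℝ ∞ fun x => nuIntegral (F x) := by
  have key : ∀ (x : Eu n) (s t φ : ℝ), nuForm ((F x s t).1 (Circle.exp φ))
      ![curveDeriv (fun r => (F x r t).1 (Circle.exp φ)) s,
        curveDeriv (fun r => (F x s r).1 (Circle.exp φ)) t,
        curveDeriv (fun r => (F x s t).1 (Circle.exp r)) φ] =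
      nuPull (fun y : Eu n × ℝ × ℝ × ℝ => (F y.1 y.2.1 y.2.2.1).1 (Circle.exp y.2.2.2))
        (0, 1, 0, 0) (0, 0, 1, 0) (0, 0, 0, 1) (x, s, t, φ) := by
    intro x s t φ
    rw [nuPull, ← curveDeriv_eq_dirD hF ((hasDerivAt_const s x).prodMk (hasDerivAt_slot1 s t φ)),
      ← curveDeriv_eq_dirD hF ((hasDerivAt_const t x).prodMk (hasDerivAt_slot2 s t φ)),
      ← curveDeriv_eq_dirD hF ((hasDerivAt_const φ x).prodMk (hasDerivAt_slot3 s t φ))]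
  simp only [nuIntegral, key]
  exact contDiff_intervalIntegral₃ (contDiff_nuPull hF _ _ _) _ _ _ _ _ _

theorem c22Form_conj (z : Circle) (h₁ h₂ : SU2) (X₁ X₂ Y₁ Y₂ : Matrix (Fin 2) (Fin 2) ℂ) :
    c22Form (conjSU2 z h₁) (conjSU2 z h₂) (conjMat z X₁) (conjMat z X₂) (conjMat z Y₁)
      (conjMat z Y₂) = c22Form h₁ h₂ X₁ X₂ Y₁ Y₂ := by
  have hi : ∀ h : SU2, ((conjSU2 z h)⁻¹).1 = conjMat z (h⁻¹).1 := fun h => by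
    rw [← map_inv]
    rfl
  have hs : ∀ X Y, conjMat z X - conjMat z Y = conjMat z (X - Y) := fun X Y => by
    simp only [conjMat, Matrix.mul_sub, Matrix.sub_mul]
  simp only [c22Form, hi, conjMat_mul, hs, trace_conjMat]

theorem c22Integral_conj (z : Circle) (σ τ : BasedPath) :
    c22Integral (σ.conj z) (τ.conj z) = c22Integral σ τ := by
  have e : ∀ (σ : BasedPath) (t : ℝ) (w : Circle), (σ.conj z t).1 w = conjSU2 z ((σ t).1 w) :=
    fun _ _ _ => rfl
  simp only [c22Integral, e, curveDeriv_conj, c22Form_conj]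

/-- By the Leibniz rule each side becomes the same three terms: `tr(h₂⁻¹h₁⁻¹dh₁dh₂)`,
`tr(h₃⁻¹h₂⁻¹dh₂dh₃)` and `tr(h₃⁻¹h₂⁻¹h₁⁻¹dh₁ h₂ dh₃)`, up to the common factor. -/
theorem c22Form_cocycle (h₁ h₂ h₃ : SU2) (X₁ X₂ X₃ Y₁ Y₂ Y₃ : Matrix (Fin 2) (Fin 2) ℂ) :
    c22Form h₁ h₂ X₁ X₂ Y₁ Y₂ +
      c22Form (h₁ * h₂) h₃ (X₁ * h₂.1 + h₁.1 * X₂) X₃ (Y₁ * h₂.1 + h₁.1 * Y₂) Y₃ =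
    c22Form h₂ h₃ X₂ X₃ Y₂ Y₃ +
      c22Form h₁ (h₂ * h₃) X₁ (X₂ * h₃.1 + h₂.1 * X₃) Y₁ (Y₂ * h₃.1 + h₂.1 * Y₃) := by
  have hm : ∀ g h : SU2, ((g * h)⁻¹).1 = (h⁻¹).1 * (g⁻¹).1 := fun g h =>
    congrArg Subtype.val (mul_inv_rev g h)
  have e1 : ∀ X : Matrix (Fin 2) (Fin 2) ℂ, (h₁⁻¹).1 * (h₁.1 * X) = X := fun X => by
    rw [← Matrix.mul_assoc, SU2_inv_mul, Matrix.one_mul]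
  have e2 : ∀ X : Matrix (Fin 2) (Fin 2) ℂ, ((h₃⁻¹).1 * ((h₂⁻¹).1 * ((h₁⁻¹).1 * (X * h₃.1)))).trace
      = ((h₂⁻¹).1 * ((h₁⁻¹).1 * X)).trace := fun X => by
    rw [Matrix.trace_mul_comm]
    simp only [Matrix.mul_assoc, SU2_mul_inv, Matrix.mul_one]
  simp only [c22Form, hm, ← Complex.add_re, ← mul_add]
  congr 2
  have e3 : ∀ X Y : Matrix (Fin 2) (Fin 2) ℂ,
      ((h₃⁻¹).1 * ((h₂⁻¹).1 * ((h₁⁻¹).1 * (X * (Y * h₃.1))))).trace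
      = ((h₂⁻¹).1 * ((h₁⁻¹).1 * (X * Y))).trace := fun X Y => by
    rw [← Matrix.mul_assoc X, e2]
  simp only [Matrix.mul_add, Matrix.add_mul, Matrix.mul_sub, Matrix.mul_assoc, Matrix.trace_add,
    Matrix.trace_sub, e1, e3]
  ring

theorem c22Integral_cocycle (σ₁ σ₂ σ₃ : BasedPath) :
    c22Integral σ₁ σ₂ + c22Integral (σ₁ * σ₂ : BasedPath) σ₃ =
      c22Integral σ₂ σ₃ + c22Integral σ₁ (σ₂ * σ₃ : BasedPath) := by
  have hP : ∀ σ : BasedPath, SmoothSU2 fun y : ℝ × ℝ × ℝ => (σ y.2.1).1 (Circle.exp y.2.2) :=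
    fun σ => SmoothSU2.comp (F := fun y : ℝ × ℝ => (σ y.1).1 (Circle.exp y.2)) σ.smooth contDiff_snd
  have hc : ∀ σ τ : BasedPath, Continuous fun y : ℝ × ℝ =>
      c22Form ((σ y.1).1 (Circle.exp y.2)) ((τ y.1).1 (Circle.exp y.2))
        (curveDeriv (fun r => (σ r).1 (Circle.exp y.2)) y.1)
        (curveDeriv (fun r => (τ r).1 (Circle.exp y.2)) y.1)
        (curveDeriv (fun r => (σ y.1).1 (Circle.exp r)) y.2)
        (curveDeriv (fun r => (τ y.1).1 (Circle.exp r)) y.2) := by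
    intro σ τ
    have h := (contDiff_c22Pull (hP σ) (hP τ) (0, 1, 0) (0, 0, 1)).continuous.comp
      (by fun_prop : Continuous fun y : ℝ × ℝ => ((0 : ℝ), y.1, y.2))
    refine h.congr fun y => ?_
    rw [Function.comp_apply, c22Pull,
      ← curveDeriv_eq_dirD (hP σ) (hasDerivAt_slot2 (0 : ℝ) y.1 y.2),
      ← curveDeriv_eq_dirD (hP σ) (hasDerivAt_slot3 (0 : ℝ) y.1 y.2),
      ← curveDeriv_eq_dirD (hP τ) (hasDerivAt_slot2 (0 : ℝ) y.1 y.2),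
      ← curveDeriv_eq_dirD (hP τ) (hasDerivAt_slot3 (0 : ℝ) y.1 y.2)]
  have add : ∀ f g : ℝ × ℝ → ℝ, Continuous f → Continuous g →
      (∫ t in (0 : ℝ)..1, ∫ φ in (0 : ℝ)..(2 * Real.pi), f (t, φ)) +
        (∫ t in (0 : ℝ)..1, ∫ φ in (0 : ℝ)..(2 * Real.pi), g (t, φ)) =
      ∫ t in (0 : ℝ)..1, ∫ φ in (0 : ℝ)..(2 * Real.pi), (f (t, φ) + g (t, φ)) := by
    intro f g hf hg
    rw [← intervalIntegral.integral_add
      ((continuous_integral_inner hf _ _).intervalIntegrable _ _)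
      ((continuous_integral_inner hg _ _).intervalIntegrable _ _)]
    congr 1
    funext t
    have ht : Continuous fun φ : ℝ => (t, φ) := by fun_prop
    exact (intervalIntegral.integral_add ((hf.comp ht).intervalIntegrable _ _)
      ((hg.comp ht).intervalIntegrable _ _)).symm
  refine (add _ _ (hc σ₁ σ₂) (hc (σ₁ * σ₂) σ₃)).trans
    (Eq.trans ?_ (add _ _ (hc σ₂ σ₃) (hc σ₁ (σ₂ * σ₃))).symm)
  congr 1
  funext t
  congr 1
  funext φ
  have s1 : ∀ (σ : BasedPath) (φ : ℝ), SmoothSU2 fun r => (σ r).1 (Circle.exp φ) := fun σ φ =>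
    σ.smooth.comp (by fun_prop : ContDiff ℝ ∞ fun r : ℝ => (r, φ))
  have s2 : ∀ (σ : BasedPath) (t : ℝ), SmoothSU2 fun r => (σ t).1 (Circle.exp r) := fun σ t =>
    σ.smooth.comp (by fun_prop : ContDiff ℝ ∞ fun r : ℝ => (t, r))
  have hm : ∀ (σ τ : BasedPath) (t : ℝ) (w : Circle),
      ((σ * τ : BasedPath) t).1 w = (σ t).1 w * (τ t).1 w := fun _ _ _ _ => rfl
  simp only [hm]
  rw [curveDeriv_mul (s1 σ₁ φ) (s1 σ₂ φ), curveDeriv_mul (s1 σ₂ φ) (s1 σ₃ φ),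
    curveDeriv_mul (s2 σ₁ t) (s2 σ₂ t), curveDeriv_mul (s2 σ₂ t) (s2 σ₃ t)]
  exact c22Form_cocycle _ _ _ _ _ _ _ _ _

/-! ## Contracting the complement of a point in `SU(2)` -/

/-- For determinant one the inverse is the adjugate, and for a unitary matrix it is the adjoint;
comparing entries identifies `SU(2)` with the unit quaternions. -/
theorem SU2_entries (h : SU2) : h.1 1 0 = -(starRingEnd ℂ) (h.1 0 1) ∧
    h.1 1 1 = (starRingEnd ℂ) (h.1 0 0) := by
  obtain ⟨hu, hd⟩ := Matrix.mem_specialUnitaryGroup_iff.1 h.2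
  have h1 : star h.1 * h.1 = 1 := Matrix.mem_unitaryGroup_iff'.1 hu
  have h2 : h.1 * h.1.adjugate = 1 := by rw [Matrix.mul_adjugate, hd, one_smul]
  have h3 : star h.1 = h.1.adjugate := left_inv_eq_right_inv h1 h2
  rw [Matrix.adjugate_fin_two] at h3
  have e1 := congrFun (congrFun h3 0) 0
  have e2 := congrFun (congrFun h3 1) 0
  simp [Matrix.star_apply] at e1 e2
  exact ⟨by rw [e2, neg_neg], e1.symm⟩

theorem SU2_normSq (h : SU2) : Complex.normSq (h.1 0 0) + Complex.normSq (h.1 0 1) = 1 := by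
  have hd := (Matrix.mem_specialUnitaryGroup_iff.1 h.2).2
  obtain ⟨h1, h2⟩ := SU2_entries h
  rw [Matrix.det_fin_two, h1, h2, mul_neg, sub_neg_eq_add, Complex.mul_conj, Complex.mul_conj] at hd
  exact_mod_cast hd

theorem SU2_ext {g h : SU2} (h0 : g.1 0 0 = h.1 0 0) (h1 : g.1 0 1 = h.1 0 1) : g = h := by
  refine Subtype.ext ?_
  obtain ⟨a1, a2⟩ := SU2_entries g
  obtain ⟨b1, b2⟩ := SU2_entries h
  ext i j
  fin_cases i <;> fin_cases j <;> simp [h0, h1, a1, a2, b1, b2]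

theorem quat_mem {a b : ℂ} (h : Complex.normSq a + Complex.normSq b = 1) :
    !![a, b; -(starRingEnd ℂ) b, (starRingEnd ℂ) a] ∈ Matrix.specialUnitaryGroup (Fin 2) ℂ := by
  have h' : a * (starRingEnd ℂ) a + b * (starRingEnd ℂ) b = 1 := by
    rw [Complex.mul_conj, Complex.mul_conj]
    exact_mod_cast h
  rw [Matrix.mem_specialUnitaryGroup_iff, Matrix.mem_unitaryGroup_iff]
  refine ⟨?_, ?_⟩
  · ext i j
    fin_cases i <;> fin_cases j <;>
      simp [Matrix.mul_apply, Matrix.star_apply, Fin.sum_univ_two] <;>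
      first | linear_combination h' | ring
  · rw [Matrix.det_fin_two_of]
    linear_combination h'

/-- The norm of the quaternion with coordinates `a`, `b`. -/
def quatNorm (a b : ℂ) : ℝ := Real.sqrt (Complex.normSq a + Complex.normSq b)

theorem normSq_div_quatNorm {a b : ℂ} (h : Complex.normSq a + Complex.normSq b ≠ 0) :
    Complex.normSq (((quatNorm a b)⁻¹ : ℝ) * a) + Complex.normSq (((quatNorm a b)⁻¹ : ℝ) * b) = 1 := by
  have hp : 0 ≤ Complex.normSq a + Complex.normSq b :=
    add_nonneg (Complex.normSq_nonneg _) (Complex.normSq_nonneg _)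
  rw [Complex.normSq_mul, Complex.normSq_mul, Complex.normSq_ofReal, ← mul_add, ← mul_inv, quatNorm,
    Real.mul_self_sqrt hp, inv_mul_cancel₀ h]

open Classical in
/-- The normalisation of the quaternion with coordinates `a`, `b`, as an element of `SU(2)`. -/
def normalize (a b : ℂ) : SU2 :=
  if h : Complex.normSq a + Complex.normSq b = 0 then 1
  else ⟨_, quat_mem (normSq_div_quatNorm h)⟩

theorem normalize_val {a b : ℂ} (h : Complex.normSq a + Complex.normSq b ≠ 0) :
    (normalize a b).1 = !![((quatNorm a b)⁻¹ : ℝ) * a, ((quatNorm a b)⁻¹ : ℝ) * b;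
      -(starRingEnd ℂ) (((quatNorm a b)⁻¹ : ℝ) * b), (starRingEnd ℂ) (((quatNorm a b)⁻¹ : ℝ) * a)] := by
  rw [normalize, dif_neg h]

theorem normalize_self (h : SU2) : normalize (h.1 0 0) (h.1 0 1) = h := by
  have h1 := SU2_normSq h
  have h0 : Complex.normSq (h.1 0 0) + Complex.normSq (h.1 0 1) ≠ 0 := by
    rw [h1]
    exact one_ne_zero
  apply SU2_ext <;> rw [normalize_val h0] <;> simp [quatNorm, h1]

theorem normalize_one : normalize 1 0 = 1 := normalize_self 1

theorem smooth_normalize {V : Type} [NormedAddCommGroup V] [NormedSpace ℝ V] {a b : V → ℂ}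
    (ha : ContDiff ℝ ∞ a) (hb : ContDiff ℝ ∞ b)
    (h : ∀ y, Complex.normSq (a y) + Complex.normSq (b y) ≠ 0) :
    SmoothSU2 fun y => normalize (a y) (b y) := by
  have hn : ∀ {c : V → ℂ}, ContDiff ℝ ∞ c → ContDiff ℝ ∞ fun y => Complex.normSq (c y) := by
    intro c hc
    simp only [Complex.normSq_apply]
    have h1 : ContDiff ℝ ∞ fun y => (c y).re := Complex.reCLM.contDiff.comp hc
    have h2 : ContDiff ℝ ∞ fun y => (c y).im := Complex.imCLM.contDiff.comp hc
    exact (h1.mul h1).add (h2.mul h2)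
  have hp : ∀ y, 0 < Complex.normSq (a y) + Complex.normSq (b y) := fun y =>
    lt_of_le_of_ne (add_nonneg (Complex.normSq_nonneg _) (Complex.normSq_nonneg _)) (h y).symm
  have hq : ContDiff ℝ ∞ fun y => (((quatNorm (a y) (b y))⁻¹ : ℝ) : ℂ) :=
    Complex.ofRealCLM.contDiff.comp (ContDiff.inv (ContDiff.sqrt ((hn ha).add (hn hb)) h)
      fun y => (Real.sqrt_pos.2 (hp y)).ne')
  have h1 := hq.mul ha
  have h2 := hq.mul hb
  intro i j
  simp only [normalize_val (h _)]
  fin_cases i <;> fin_cases j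
  · exact h1
  · exact h2
  · exact (Complex.conjCLE.contDiff.comp h2).neg
  · exact Complex.conjCLE.contDiff.comp h1

/-- The element `-1` of `SU(2)`. -/
def negOne : SU2 := normalize (-1) 0

theorem negOne_val : negOne.1 = -1 := by
  rw [negOne, normalize_val (by simp)]
  ext i j
  fin_cases i <;> fin_cases j <;> simp [quatNorm]

theorem negOne_mul_self : negOne * negOne = 1 := by
  refine Subtype.ext ?_
  change negOne.1 * negOne.1 = 1
  rw [negOne_val]
  simp

theorem negOne_mul_comm (g : SU2) : negOne * g = g * negOne := by
  refine Subtype.ext ?_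
  change negOne.1 * g.1 = g.1 * negOne.1
  rw [negOne_val]
  simp

/-- The normalised segment from `1` to `h`. -/
def blend (s : ℝ) (h : SU2) : SU2 := normalize ((1 - s : ℝ) + s * h.1 0 0) (s * h.1 0 1)

theorem blend_zero (h : SU2) : blend 0 h = 1 := by simp [blend, normalize_one]

theorem blend_one (h : SU2) : blend 1 h = h := by simp [blend, normalize_self]

/-- The straight segment from `1` to a unit quaternion `h` meets `0` only if `h` is a nonpositive
real multiple of `1`, that is `h = -1`. -/
theorem blend_ne_zero {s : ℝ} {h : SU2} (hs : s ∈ Set.Icc (0 : ℝ) 1) (hh : h ≠ negOne) :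
    Complex.normSq ((1 - s : ℝ) + s * h.1 0 0) + Complex.normSq (s * h.1 0 1) ≠ 0 := by
  intro e
  have n0 := Complex.normSq_nonneg ((1 - s : ℝ) + s * h.1 0 0)
  have n1 := Complex.normSq_nonneg (s * h.1 0 1)
  have e0 : ((1 - s : ℝ) : ℂ) + s * h.1 0 0 = 0 := Complex.normSq_eq_zero.1 (by linarith)
  have e1 : (s : ℂ) * h.1 0 1 = 0 := Complex.normSq_eq_zero.1 (by linarith)
  have hs0 : (s : ℂ) ≠ 0 := by
    intro h0
    rw [h0] at e0
    have : s = 0 := by exact_mod_cast h0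
    rw [this] at e0
    simp at e0
  have h01 : h.1 0 1 = 0 := (mul_eq_zero.1 e1).resolve_left hs0
  have hn := SU2_normSq h
  rw [h01, map_zero, add_zero] at hn
  have hs0' : s ≠ 0 := by exact_mod_cast hs0
  have hc : h.1 0 0 = ((-(1 - s) / s : ℝ) : ℂ) := by
    push_cast
    push_cast at e0
    field_simp
    linear_combination e0
  rw [hc, Complex.normSq_ofReal] at hn
  have hle : -(1 - s) / s ≤ 0 := div_nonpos_of_nonpos_of_nonneg (by linarith [hs.2]) hs.1
  have hm : -(1 - s) / s = -1 := by nlinarith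
  apply hh
  apply SU2_ext
  · rw [hc, hm, negOne_val]
    simp
  · rw [h01, negOne_val]
    simp

theorem SmoothSU2.blend {V : Type} [NormedAddCommGroup V] [NormedSpace ℝ V] {s : V → ℝ}
    {A : V → SU2} (hs : ContDiff ℝ ∞ s) (hA : SmoothSU2 A) (hI : ∀ y, s y ∈ Set.Icc (0 : ℝ) 1)
    (hne : ∀ y, A y ≠ negOne) : SmoothSU2 fun y => blend (s y) (A y) := by
  have hs' : ContDiff ℝ ∞ fun y => (s y : ℂ) := Complex.ofRealCLM.contDiff.comp hs
  have hs'' : ContDiff ℝ ∞ fun y => ((1 - s y : ℝ) : ℂ) :=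
    Complex.ofRealCLM.contDiff.comp (contDiff_const.sub hs)
  exact smooth_normalize (hs''.add (hs'.mul (hA 0 0))) (hs'.mul (hA 0 1))
    fun y => blend_ne_zero (hI y) (hne y)

theorem SmoothSU2.continuous {V : Type} [NormedAddCommGroup V] [NormedSpace ℝ V] {A : V → SU2}
    (hA : SmoothSU2 A) : Continuous A :=
  continuous_induced_rng.2 (continuous_matrix fun i j => (hA i j).continuous)

/-- A smooth surface in `SU(2)` misses a point. -/
theorem exists_missed_point {ρ : ℝ × ℝ → SU2} (hρ : SmoothSU2 ρ) :
    ∃ g : SU2, g ≠ 1 ∧ ∀ y, ρ y ≠ g := by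
  -- The cone over the surface is a smooth image of `ℝ³` in `ℂ² = ℝ⁴`, so its complement is dense.
  let f : ℝ × ℝ × ℝ → ℂ × ℂ := fun y => (y.1 * (ρ y.2).1 0 0, y.1 * (ρ y.2).1 0 1)
  have hf : ContDiff ℝ ∞ f := by
    have h1 : ContDiff ℝ ∞ fun y : ℝ × ℝ × ℝ => (y.1 : ℂ) :=
      Complex.ofRealCLM.contDiff.comp contDiff_fst
    exact (h1.mul ((hρ 0 0).comp contDiff_snd)).prodMk (h1.mul ((hρ 0 1).comp contDiff_snd))
  have hd : Dense (Set.range f)ᶜ := by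
    refine (hf.of_le (by simp)).dense_compl_range_of_finrank_lt_finrank ?_
    simp [Module.finrank_prod]
  -- Requiring a nonreal first coordinate makes the normalised point different from `1`.
  have ho : IsOpen {v : ℂ × ℂ | v.1.im ≠ 0} :=
    isOpen_ne_fun (Complex.continuous_im.comp continuous_fst) continuous_const
  obtain ⟨v, hv, hvf⟩ := hd.inter_open_nonempty _ ho ⟨(Complex.I, 0), by simp⟩
  have hv0 : v.1 ≠ 0 := fun h => hv (by rw [h, Complex.zero_im])
  have hn : Complex.normSq v.1 + Complex.normSq v.2 ≠ 0 := by
    have := Complex.normSq_pos.2 hv0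
    have := Complex.normSq_nonneg v.2
    positivity
  have hq : quatNorm v.1 v.2 ≠ 0 := by
    have := Complex.normSq_pos.2 hv0
    have := Complex.normSq_nonneg v.2
    exact (Real.sqrt_pos.2 (by positivity)).ne'
  have hq' : (quatNorm v.1 v.2 : ℂ) ≠ 0 := by exact_mod_cast hq
  refine ⟨normalize v.1 v.2, ?_, ?_⟩
  · intro h
    have h1 := congrArg (fun h : SU2 => (h.1 0 0).im) h
    simp only [normalize_val hn] at h1
    simp [hq] at h1
    exact hv h1
  · intro y hy
    apply hvf
    -- If the surface met `v/|v|`, then `v` would lie on the cone at height `|v|`.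
    refine ⟨(quatNorm v.1 v.2, y), ?_⟩
    simp only [f, hy, normalize_val hn]
    ext <;> simp [hq']

/-- Left translation by `(-g)⁻¹` sends `g` to `-1`, so a family that misses `g` becomes one to which
`blend` applies. -/
theorem inv_mul_ne_negOne {g h : SU2} (hgh : h ≠ g) : (negOne * g)⁻¹ * h ≠ negOne := by
  intro e
  apply hgh
  rw [inv_mul_eq_iff_eq_mul, negOne_mul_comm, mul_assoc, negOne_mul_self, mul_one] at e
  exact e

theorem negOne_mul_ne_negOne {g : SU2} (hg : g ≠ 1) : negOne * g ≠ negOne := by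
  intro e
  exact hg (mul_eq_left.1 e)

/-- By compactness, missing `g` is an open condition on the parameter. The angles `[-π, π]` cover
the circle, and `[-1, 2]` contains the range of the function from `exists_smooth_clamp`. -/
theorem eventually_forall_ne {n : ℕ} {A : Eu n × ℝ × ℝ → SU2} (hA : SmoothSU2 A) {x₀ : Eu n}
    {g : SU2} (h : ∀ t φ, A (x₀, t, φ) ≠ g) :
    ∀ᶠ x in 𝓝 x₀, ∀ y ∈ Set.Icc (-1 : ℝ) 2 ×ˢ Set.Icc (-Real.pi) Real.pi, A (x, y) ≠ g := by
  refine (isCompact_Icc.prod isCompact_Icc).eventually_forall_of_forall_eventually ?_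
  rintro ⟨t, φ⟩ -
  exact hA.continuous.continuousAt.eventually_ne (h t φ)

theorem exists_circle_exp (w : Circle) : ∃ φ ∈ Set.Icc (-Real.pi) Real.pi, Circle.exp φ = w :=
  ⟨Complex.arg w, Set.Ioc_subset_Icc_self (Complex.arg_mem_Ioc _), Circle.exp_arg w⟩

theorem smoothTransition_mem (t : ℝ) : Real.smoothTransition t ∈ Set.Icc (0 : ℝ) 1 :=
  ⟨Real.smoothTransition.nonneg t, Real.smoothTransition.le_one t⟩

/-- A smooth function with values in `[-1, 2]` that is the identity on `[0, 1]`. -/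
theorem exists_smooth_clamp : ∃ χ : ℝ → ℝ, ContDiff ℝ ∞ χ ∧ (∀ t, χ t ∈ Set.Icc (-1 : ℝ) 2) ∧
    ∀ t ∈ Set.Icc (0 : ℝ) 1, χ t = t := by
  -- This bump is `1` within `1/2` of the centre, on `[0, 1]`, and `0` beyond distance `1`; so `t ·
  -- b(t)` stays in `[-1, 2]`.
  let b : ContDiffBump (1 / 2 : ℝ) := ⟨1 / 2, 1, by norm_num, by norm_num⟩
  refine ⟨fun t => t * b t, contDiff_id.mul b.contDiff, fun t => ?_, fun t ht => ?_⟩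
  · by_cases h : t ∈ Set.Icc (-1 : ℝ) 2
    · have h0 := b.nonneg (x := t)
      have h1 := b.le_one (x := t)
      constructor <;> nlinarith [h.1, h.2]
    · change t * b t ∈ _
      rw [b.zero_of_le_dist]
      · norm_num
      · by_contra hlt
        apply h
        rw [not_le, Real.dist_eq, abs_lt] at hlt
        have : b.rOut = 1 := rfl
        constructor <;> linarith [hlt.1, hlt.2]
  · have : b t = 1 := b.one_of_mem_closedBall (by
      rw [Metric.mem_closedBall, Real.dist_eq, abs_le]
      have : b.rIn = 1 / 2 := rfl
      constructor <;> linarith [ht.1, ht.2])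
    simp only [this, mul_one]

/-! ## Smooth families of paths and of homotopies -/

/-- The loop given by a function on the circle. -/
def loopOf (c : Circle → SU2) (h : SmoothSU2 fun t : ℝ => c (Circle.exp t)) : LG := ⟨c, h⟩

/-- The path of loops given by a function on `ℝ × S¹`. -/
def pathOf (c : ℝ → Circle → SU2) (h : SmoothSU2 fun y : ℝ × ℝ => c y.1 (Circle.exp y.2))
    (h0 : ∀ w, c 0 w = 1) : BasedPath where
  toFun t := loopOf (c t)
    (h.comp (f := fun φ : ℝ => (t, φ)) (contDiff_const.prodMk contDiff_id))
  smooth := h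
  start := Subtype.ext (funext h0)

/-- Plots of `LG` lift locally to smooth families of paths from `1`. -/
theorem exists_path_lift {n : ℕ} {P : Eu n → LG} (hP : IsPlot P) (x₀ : Eu n) :
    ∃ σ : Eu n → BasedPath, IsPlot σ ∧ ∀ᶠ y in 𝓝 x₀, σ y 1 = P y := by
  have hP : SmoothSU2 fun y : Eu n × ℝ => (P y.1).1 (Circle.exp y.2) := hP
  obtain ⟨g, hg, hmiss⟩ := exists_missed_point
    (hP.comp (by fun_prop : ContDiff ℝ ∞ fun y : ℝ × ℝ => (x₀, y.2)))
  have hmiss' : ∀ (t φ : ℝ), (P x₀).1 (Circle.exp φ) ≠ g := fun t φ => hmiss (t, φ)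
  have hev := eventually_forall_ne
    (hP.comp (by fun_prop : ContDiff ℝ ∞ fun y : Eu n × ℝ × ℝ => (y.1, y.2.2))) hmiss'
  obtain ⟨u, hu, ho, hx⟩ := eventually_nhds_iff.mp hev
  obtain ⟨f, hf, hfu, hfx⟩ := exists_local_id ho hx
  have hne : ∀ x w, (P (f x)).1 w ≠ g := by
    intro x w
    obtain ⟨φ, hφ, rfl⟩ := exists_circle_exp w
    exact hu (f x) (hfu x) (0, φ) ⟨by norm_num, hφ⟩
  -- With `k = -g`, both `k` and `k⁻¹P` avoid `-1`. The path `blend(t, k) · blend(t, k⁻¹P)` runs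
  -- from `1` to `k · k⁻¹P = P`.
  set k : SU2 := negOne * g with hk
  have hk1 : k ≠ negOne := negOne_mul_ne_negOne hg
  have hsm : SmoothSU2 fun y : Eu n × ℝ × ℝ => blend (Real.smoothTransition y.2.1) k *
      blend (Real.smoothTransition y.2.1) (k⁻¹ * (P (f y.1)).1 (Circle.exp y.2.2)) := by
    have hT : ContDiff ℝ ∞ fun y : Eu n × ℝ × ℝ => Real.smoothTransition y.2.1 :=
      Real.smoothTransition.contDiff.comp (by fun_prop)
    refine SmoothSU2.mul (SmoothSU2.blend hT (SmoothSU2.const k) (fun _ => smoothTransition_mem _)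
      fun _ => hk1) (SmoothSU2.blend hT (SmoothSU2.mul (SmoothSU2.const _) ?_)
      (fun _ => smoothTransition_mem _) fun y => inv_mul_ne_negOne (hne _ _))
    exact hP.comp (f := fun y : Eu n × ℝ × ℝ => (f y.1, y.2.2))
      ((hf.comp contDiff_fst).prodMk (by fun_prop))
  have hs : ∀ x, SmoothSU2 fun y : ℝ × ℝ => blend (Real.smoothTransition y.1) k *
      blend (Real.smoothTransition y.1) (k⁻¹ * (P (f x)).1 (Circle.exp y.2)) := fun x =>
    hsm.comp (f := fun y : ℝ × ℝ => (x, y.1, y.2)) (by fun_prop)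
  let σ : Eu n → BasedPath := fun x => pathOf (fun t w => blend (Real.smoothTransition t) k *
    blend (Real.smoothTransition t) (k⁻¹ * (P (f x)).1 w)) (hs x) (fun w => by
      rw [Real.smoothTransition.zero, blend_zero, blend_zero, one_mul])
  refine ⟨σ, hsm, ?_⟩
  filter_upwards [hfx] with y hy
  refine Subtype.ext (funext fun w => ?_)
  change blend (Real.smoothTransition 1) k *
    blend (Real.smoothTransition 1) (k⁻¹ * (P (f y)).1 w) = (P y).1 w
  rw [Real.smoothTransition.one, blend_one, blend_one, mul_inv_cancel_left, hy]

/-- Smooth families of paths with common ends are locally homotopic, smoothly in the parameter. -/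
theorem exists_homotopy {n : ℕ} {σ τ : Eu n → BasedPath} (hσ : IsPlot σ) (hτ : IsPlot τ)
    (hst : ∀ y, σ y 1 = τ y 1) (x₀ : Eu n) : ∃ F : Eu n → ℝ → ℝ → LG,
      (SmoothSU2 fun y : Eu n × ℝ × ℝ × ℝ => (F y.1 y.2.1 y.2.2.1).1 (Circle.exp y.2.2.2)) ∧
      ∀ᶠ y in 𝓝 x₀, IsHomotopy (F y) (σ y) (τ y) := by
  have hσ : SmoothSU2 fun y : Eu n × ℝ × ℝ => (σ y.1 y.2.1).1 (Circle.exp y.2.2) := hσ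
  have hτ : SmoothSU2 fun y : Eu n × ℝ × ℝ => (τ y.1 y.2.1).1 (Circle.exp y.2.2) := hτ
  -- It suffices to contract `ρ = τσ⁻¹`, which is `1` at both ends, and multiply by `σ`.
  let ρ : Eu n → ℝ → LG := fun x t => τ x t * (σ x t)⁻¹
  have hρ : SmoothSU2 fun y : Eu n × ℝ × ℝ => (ρ y.1 y.2.1).1 (Circle.exp y.2.2) := hτ.mul hσ.inv
  obtain ⟨g, hg, hmiss⟩ := exists_missed_point
    (hρ.comp (by fun_prop : ContDiff ℝ ∞ fun y : ℝ × ℝ => (x₀, y.1, y.2)))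
  obtain ⟨u, hu, ho, hx⟩ := eventually_nhds_iff.mp
    (eventually_forall_ne hρ fun t φ => hmiss (t, φ))
  obtain ⟨f, hf, hfu, hfx⟩ := exists_local_id ho hx
  obtain ⟨χ, hχ, hχI, hχid⟩ := exists_smooth_clamp
  -- The point `g` is known to be missed only for `t` in a compact interval; inserting the clamp `χ`
  -- makes the homotopy defined and smooth for all real `t` without changing it on `[0, 1]`.
  have hne : ∀ x t w, (ρ (f x) (χ t)).1 w ≠ g := by
    intro x t w
    obtain ⟨φ, hφ, rfl⟩ := exists_circle_exp w
    exact hu (f x) (hfu x) (χ t, φ) ⟨hχI t, hφ⟩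
  set k : SU2 := negOne * g with hk
  have hk1 : k⁻¹ ≠ negOne := by
    have := inv_mul_ne_negOne (h := 1) hg.symm
    rwa [mul_one] at this
  let T := Real.smoothTransition
  -- The correction factor `blend(s, k⁻¹)⁻¹` makes the contraction constantly `1` where `ρ = 1`, so
  -- the ends stay fixed. At `s = 0` the expression is `σ`, at `s = 1` it is `k · k⁻¹ρ · σ = τ`.
  have hsm : SmoothSU2 fun y : Eu n × ℝ × ℝ × ℝ => (blend (T y.2.1) k⁻¹)⁻¹ *
      blend (T y.2.1) (k⁻¹ * (ρ (f y.1) (χ y.2.2.1)).1 (Circle.exp y.2.2.2)) *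
        (σ (f y.1) y.2.2.1).1 (Circle.exp y.2.2.2) := by
    have hT : ContDiff ℝ ∞ fun y : Eu n × ℝ × ℝ × ℝ => T y.2.1 :=
      Real.smoothTransition.contDiff.comp (by fun_prop)
    have hf' : ContDiff ℝ ∞ fun y : Eu n × ℝ × ℝ × ℝ => f y.1 := hf.comp contDiff_fst
    have hχ' : ContDiff ℝ ∞ fun y : Eu n × ℝ × ℝ × ℝ => χ y.2.2.1 := hχ.comp (by fun_prop)
    refine SmoothSU2.mul (SmoothSU2.mul (SmoothSU2.inv (SmoothSU2.blend hT (SmoothSU2.const _)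
      (fun _ => smoothTransition_mem _) fun _ => hk1)) (SmoothSU2.blend hT
      (SmoothSU2.mul (SmoothSU2.const _) ?_) (fun _ => smoothTransition_mem _)
      fun y => inv_mul_ne_negOne (hne _ _ _))) ?_
    · exact hρ.comp (f := fun y : Eu n × ℝ × ℝ × ℝ => (f y.1, χ y.2.2.1, y.2.2.2))
        (hf'.prodMk (hχ'.prodMk (by fun_prop)))
    · exact hσ.comp (f := fun y : Eu n × ℝ × ℝ × ℝ => (f y.1, y.2.2.1, y.2.2.2))
        (hf'.prodMk (by fun_prop))
  have hs : ∀ x s t, SmoothSU2 fun φ : ℝ => (blend (T s) k⁻¹)⁻¹ *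
      blend (T s) (k⁻¹ * (ρ (f x) (χ t)).1 (Circle.exp φ)) * (σ (f x) t).1 (Circle.exp φ) :=
    fun x s t => hsm.comp (f := fun φ : ℝ => (x, s, t, φ)) (by fun_prop)
  have hs' : ∀ x, SmoothSU2 fun z : ℝ × ℝ × ℝ => (blend (T z.1) k⁻¹)⁻¹ *
      blend (T z.1) (k⁻¹ * (ρ (f x) (χ z.2.1)).1 (Circle.exp z.2.2)) *
        (σ (f x) z.2.1).1 (Circle.exp z.2.2) :=
    fun x => hsm.comp (f := fun z : ℝ × ℝ × ℝ => (x, z.1, z.2.1, z.2.2)) (by fun_prop)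
  let F : Eu n → ℝ → ℝ → LG := fun x s t => loopOf (fun w => (blend (T s) k⁻¹)⁻¹ *
    blend (T s) (k⁻¹ * (ρ (f x) (χ t)).1 w) * (σ (f x) t).1 w) (hs x s t)
  refine ⟨F, hsm, ?_⟩
  filter_upwards [hfx] with y hy
  have ext : ∀ {γ γ' : LG}, (∀ w, γ.1 w = γ'.1 w) → γ = γ' := fun h => Subtype.ext (funext h)
  have hend : ∀ t, ρ (f y) t = 1 → t ∈ Set.Icc (0 : ℝ) 1 → ∀ s, F y s t = σ y t := by
    intro t h1 ht s
    refine ext fun w => ?_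
    change (blend (T s) k⁻¹)⁻¹ * blend (T s) (k⁻¹ * (ρ (f y) (χ t)).1 w) * (σ (f y) t).1 w = _
    rw [hχid t ht, h1]
    change (blend (T s) k⁻¹)⁻¹ * blend (T s) (k⁻¹ * 1) * (σ (f y) t).1 w = _
    rw [mul_one, inv_mul_cancel, one_mul, hy]
  refine ⟨hs' y, fun t ht => ext fun w => ?_, fun t ht => ext fun w => ?_, fun s _ => ?_, fun s _ => ?_⟩
  · change (blend (T 0) k⁻¹)⁻¹ * blend (T 0) (k⁻¹ * (ρ (f y) (χ t)).1 w) * (σ (f y) t).1 w = _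
    have : T 0 = 0 := Real.smoothTransition.zero
    rw [this, blend_zero, blend_zero, inv_one, one_mul, one_mul, hy]
  · change (blend (T 1) k⁻¹)⁻¹ * blend (T 1) (k⁻¹ * (ρ (f y) (χ t)).1 w) * (σ (f y) t).1 w = _
    have : T 1 = 1 := Real.smoothTransition.one
    rw [this, blend_one, blend_one, hχid t ht, inv_mul_cancel_left, hy]
    change (τ y t).1 w * ((σ y t).1 w)⁻¹ * (σ y t).1 w = _
    rw [inv_mul_cancel_right]
  · rw [hend 0 (by simp only [ρ, (σ _).start, (τ _).start, inv_one, mul_one]) (by simp),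
      (σ y).start]
  · exact hend 1 (by simp only [ρ, hst, mul_inv_cancel]) (by simp) s

/-! ## The bundle `Q` is principal up to the stabiliser -/

theorem qPt_smul (σ : BasedPath) (z w : Circle) : z • qPt σ w = qPt σ (z * w) := rfl

theorem qPt_eq_of_homotopy {F : ℝ → ℝ → LG} {σ τ : BasedPath} (h : IsHomotopy F σ τ) (w : Circle) :
    qPt τ w = qPt σ (w * Circle.exp (2 * Real.pi * nuIntegral F)) :=
  (Quot.sound ⟨F, h, rfl⟩ : qPt σ _ = qPt τ w).symm

theorem isSubduction_proj_Q : IsSubduction Q.proj := by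
  intro n p hp x
  obtain ⟨σ, hσ, he⟩ := exists_path_lift hp x
  exact ⟨fun y => qPt (σ y) 1,
    (quotMap qRel).smooth n (fun y => (σ y, 1)) ⟨hσ, isPlot_const⟩, he⟩

theorem isPlot_exp {n : ℕ} {f : Eu n → ℝ} (hf : ContDiff ℝ ∞ f) :
    IsPlot fun x => Circle.exp (f x) := by
  change ContDiff ℝ ∞ fun x => ((Circle.exp (f x) : Circle) : ℂ)
  simp only [Circle.coe_exp]
  exact ((Complex.ofRealCLM.contDiff.comp hf).mul contDiff_const).cexp

theorem isPlot_mul_circle {n : ℕ} {z w : Eu n → Circle} (hz : IsPlot z) (hw : IsPlot w) :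
    IsPlot fun x => z x * w x := dSmooth_mul_circle n (fun x => (z x, w x)) ⟨hz, hw⟩

theorem isPlot_inv_circle {n : ℕ} {z : Eu n → Circle} (hz : IsPlot z) :
    IsPlot fun x => (z x)⁻¹ := dSmooth_inv_circle n z hz

/-- Local lifts to pairs (path, phase) have homotopic paths. The ratio of the points is the ratio of
the phases times `exp(2πi∫F^*ν)`, smooth because the homotopy depends smoothly on the parameter. -/
theorem Q_trans {n : ℕ} {p q : Eu n → Q.Total} (hp : IsPlot p) (hq : IsPlot q)
    (h : ∀ y, Q.proj (p y) = Q.proj (q y)) (x : Eu n) :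
    ∃ z : Eu n → Circle, IsPlot z ∧ ∀ᶠ y in 𝓝 x, q y = z y • p y := by
  obtain ⟨a, ha, hap⟩ := hp x
  obtain ⟨b, hb, hbq⟩ := hq x
  obtain ⟨u, hu, ho, hx⟩ := eventually_nhds_iff.mp (hap.and hbq)
  obtain ⟨f, hf, hfu, hfx⟩ := exists_local_id ho hx
  have hend : ∀ y, (a (f y)).1 1 = (b (f y)).1 1 := by
    intro y
    have e := h (f y)
    rw [← (hu (f y) (hfu y)).1, ← (hu (f y) (hfu y)).2] at e
    exact e
  obtain ⟨F, hF, hFh⟩ := exists_homotopy (σ := fun y => (a (f y)).1) (τ := fun y => (b (f y)).1)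
    (isPlot_reparam ha.1 hf) (isPlot_reparam hb.1 hf) hend x
  refine ⟨fun y => (b y).2 * Circle.exp (2 * Real.pi * nuIntegral (F y)) * ((a y).2)⁻¹,
    isPlot_mul_circle (isPlot_mul_circle hb.2 (isPlot_exp (contDiff_const.mul
      (contDiff_nuIntegral hF)))) (isPlot_inv_circle ha.2), ?_⟩
  filter_upwards [hap, hbq, hfx, hFh] with y h1 h2 h3 h4
  rw [← h1, ← h2]
  rw [h3] at h4
  refine (qPt_eq_of_homotopy h4 (b y).2).trans ?_
  change _ = qPt (a y).1 (_ * (a y).2)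
  rw [inv_mul_cancel_right]

/-! ## The product on `Q` -/

/-- The path `F(s, ·)` of a homotopy. -/
def IsHomotopy.path {F : ℝ → ℝ → LG} {σ τ : BasedPath} (h : IsHomotopy F σ τ) {s : ℝ}
    (hs : s ∈ Set.Icc (0 : ℝ) 1) : BasedPath where
  toFun := F s
  smooth := h.smooth.comp (f := fun y : ℝ × ℝ => (s, y.1, y.2)) (by fun_prop)
  start := h.bot s hs

theorem BasedPath.ext {σ τ : BasedPath} (h : ∀ t, σ t = τ t) : σ = τ := by
  obtain ⟨σ, h1, h2⟩ := σ
  obtain ⟨τ, h3, h4⟩ := τ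
  have : σ = τ := funext h
  subst this
  rfl

theorem BasedPath.smooth_family (ρ : BasedPath) : SmoothSU2 (evalFamily fun _ t => ρ t) :=
  SmoothSU2.comp (F := fun y : ℝ × ℝ => (ρ y.1).1 (Circle.exp y.2)) ρ.smooth contDiff_snd

theorem IsHomotopy.mul_left {F : ℝ → ℝ → LG} {σ τ : BasedPath} (h : IsHomotopy F σ τ)
    (ρ : BasedPath) : IsHomotopy (fun s t => ρ t * F s t) (ρ * σ) (ρ * τ) where
  smooth := SmoothSU2.mul ρ.smooth_family h.smooth
  left t ht := congrArg (ρ t * ·) (h.left t ht)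
  right t ht := congrArg (ρ t * ·) (h.right t ht)
  bot s hs := by rw [h.bot s hs, ρ.start, mul_one]
  top s hs := congrArg (ρ 1 * ·) (h.top s hs)

theorem IsHomotopy.mul_right {F : ℝ → ℝ → LG} {σ τ : BasedPath} (h : IsHomotopy F σ τ)
    (ρ : BasedPath) : IsHomotopy (fun s t => F s t * ρ t) (σ * ρ) (τ * ρ) where
  smooth := SmoothSU2.mul h.smooth ρ.smooth_family
  left t ht := congrArg (· * ρ t) (h.left t ht)
  right t ht := congrArg (· * ρ t) (h.right t ht)
  bot s hs := by rw [h.bot s hs, ρ.start, mul_one]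
  top s hs := congrArg (· * ρ 1) (h.top s hs)

/-- Polyakov–Wiegmann with one factor independent of `s`, whose own `ν`-integral vanishes. -/
theorem IsHomotopy.nuIntegral_mul_left {F : ℝ → ℝ → LG} {σ τ : BasedPath} (h : IsHomotopy F σ τ)
    (ρ : BasedPath) : nuIntegral (fun s t => ρ t * F s t) =
      nuIntegral F + (c22Integral ρ τ - c22Integral ρ σ) := by
  have h0 : (0 : ℝ) ∈ Set.Icc (0 : ℝ) 1 := by simp
  have h1 : (1 : ℝ) ∈ Set.Icc (0 : ℝ) 1 := by simp
  have e1 : c22Integral ρ (F 1) = c22Integral ρ τ :=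
    c22Integral_congr (τ := h.path h1) (fun _ _ => rfl) h.right
  have e0 : c22Integral ρ (F 0) = c22Integral ρ σ :=
    c22Integral_congr (τ := h.path h0) (fun _ _ => rfl) h.left
  rw [← e1, ← e0, nuIntegral_mul (F := fun _ t => ρ t) ρ.smooth_family h.smooth (fun _ _ => rfl)
    (fun _ _ => rfl) (fun s hs => (h.bot s hs).trans (h.bot 0 h0).symm)
    (fun s hs => (h.top s hs).trans (h.top 0 h0).symm), nuIntegral_const_fst, zero_add]

theorem IsHomotopy.nuIntegral_mul_right {F : ℝ → ℝ → LG} {σ τ : BasedPath} (h : IsHomotopy F σ τ)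
    (ρ : BasedPath) : nuIntegral (fun s t => F s t * ρ t) =
      nuIntegral F + (c22Integral τ ρ - c22Integral σ ρ) := by
  have h0 : (0 : ℝ) ∈ Set.Icc (0 : ℝ) 1 := by simp
  have h1 : (1 : ℝ) ∈ Set.Icc (0 : ℝ) 1 := by simp
  have e1 : c22Integral (F 1) ρ = c22Integral τ ρ :=
    c22Integral_congr (σ := h.path h1) h.right (fun _ _ => rfl)
  have e0 : c22Integral (F 0) ρ = c22Integral σ ρ :=
    c22Integral_congr (σ := h.path h0) h.left (fun _ _ => rfl)
  rw [← e1, ← e0, nuIntegral_mul (G := fun _ t => ρ t) h.smooth ρ.smooth_family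
    (fun s hs => (h.bot s hs).trans (h.bot 0 h0).symm)
    (fun s hs => (h.top s hs).trans (h.top 0 h0).symm) (fun _ _ => rfl) (fun _ _ => rfl),
    nuIntegral_const_fst, add_zero]

/-- The product `(σ, w)(τ, v) = (στ, wv exp(-∫ 2πi (σ, τ)^* C_{2,2}))`. -/
def mulPair (a b : BasedPath × Circle) : BasedPath × Circle :=
  (a.1 * b.1, a.2 * b.2 * Circle.exp (-(2 * Real.pi * c22Integral a.1 b.1)))

/-- The homotopy multiplied by the path of `a` changes the `ν`-integral by exactly the change of the
`C_{2,2}`-phase in `mulPair`. -/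
theorem mulPair_right (a b b' : BasedPath × Circle) (h : qRel b b') :
    qRel (mulPair a b) (mulPair a b') := by
  obtain ⟨F, hF, e⟩ := h
  refine ⟨_, hF.mul_left a.1, ?_⟩
  rw [hF.nuIntegral_mul_left, mulPair, mulPair, e]
  change a.2 * (b'.2 * _) * _ = a.2 * b'.2 * _ * _
  rw [← mul_assoc a.2, mul_assoc (a.2 * b'.2), mul_assoc (a.2 * b'.2), ← Circle.exp_add,
    ← Circle.exp_add]
  congr 2
  ring

theorem mulPair_left (a a' b : BasedPath × Circle) (h : qRel a a') :
    qRel (mulPair a b) (mulPair a' b) := by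
  obtain ⟨F, hF, e⟩ := h
  refine ⟨_, hF.mul_right b.1, ?_⟩
  rw [hF.nuIntegral_mul_right, mulPair, mulPair, e]
  change a'.2 * _ * b.2 * _ = a'.2 * b.2 * _ * _
  rw [mul_right_comm a'.2, mul_assoc, mul_assoc (a'.2 * b.2), ← Circle.exp_add, ← Circle.exp_add]
  congr 2
  ring

/-- The product on `Q`, making it a central extension of the loop group. -/
def mulQ : Q.Total → Q.Total → Q.Total := Quot.map₂ mulPair mulPair_right mulPair_left

theorem mulQ_qPt (σ τ : BasedPath) (w v : Circle) : mulQ (qPt σ w) (qPt τ v) =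
    qPt (σ * τ) (w * v * Circle.exp (-(2 * Real.pi * c22Integral σ τ))) := rfl

theorem proj_mulQ (a b : Q.Total) : Q.proj (mulQ a b) = Q.proj a * Q.proj b := by
  obtain ⟨a, rfl⟩ := Quot.exists_rep a
  obtain ⟨b, rfl⟩ := Quot.exists_rep b
  rfl

theorem exists_qPt (a : Q.Total) : ∃ σ w, a = qPt σ w := by
  obtain ⟨⟨σ, w⟩, rfl⟩ := Quot.exists_rep a
  exact ⟨σ, w, rfl⟩

theorem smul_mulQ (z : Circle) (a b : Q.Total) : mulQ (z • a) b = z • mulQ a b := by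
  obtain ⟨σ, w, rfl⟩ := exists_qPt a
  obtain ⟨τ, v, rfl⟩ := exists_qPt b
  simp only [qPt_smul, mulQ_qPt, mul_assoc]

theorem mulQ_smul (z : Circle) (a b : Q.Total) : mulQ a (z • b) = z • mulQ a b := by
  obtain ⟨σ, w, rfl⟩ := exists_qPt a
  obtain ⟨τ, v, rfl⟩ := exists_qPt b
  simp only [qPt_smul, mulQ_qPt, mul_assoc, mul_left_comm w z]

/-- Associativity of the phases is `c22Integral_cocycle`; the paths multiply pointwise. -/
theorem mulQ_assoc (a b c : Q.Total) : mulQ (mulQ a b) c = mulQ a (mulQ b c) := by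
  obtain ⟨σ₁, w₁, rfl⟩ := exists_qPt a
  obtain ⟨σ₂, w₂, rfl⟩ := exists_qPt b
  obtain ⟨σ₃, w₃, rfl⟩ := exists_qPt c
  have h := c22Integral_cocycle σ₁ σ₂ σ₃
  have e : σ₁ * σ₂ * σ₃ = σ₁ * (σ₂ * σ₃) := BasedPath.ext fun t => mul_assoc (σ₁ t) (σ₂ t) (σ₃ t)
  simp only [mulQ_qPt, e]
  congr 1
  have e1 : c22Integral σ₁ σ₂ = c22Integral σ₂ σ₃ + c22Integral σ₁ (σ₂ * σ₃ : BasedPath) -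
    c22Integral (σ₁ * σ₂ : BasedPath) σ₃ := by linarith
  rw [mul_right_comm (w₁ * w₂), mul_assoc (w₁ * w₂ * w₃), ← mul_assoc w₁ (w₂ * w₃),
    ← mul_assoc w₁ w₂ w₃, mul_assoc (w₁ * w₂ * w₃), ← Circle.exp_add, ← Circle.exp_add, e1]
  congr 2
  ring

theorem isPlot_mul_path {n : ℕ} {P P' : Eu n → BasedPath} (hP : IsPlot P) (hP' : IsPlot P') :
    IsPlot fun x => P x * P' x := by
  have h : SmoothSU2 fun y : Eu n × ℝ × ℝ => (P y.1 y.2.1).1 (Circle.exp y.2.2) := hP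
  have h' : SmoothSU2 fun y : Eu n × ℝ × ℝ => (P' y.1 y.2.1).1 (Circle.exp y.2.2) := hP'
  exact h.mul h'

theorem isPlot_conj_path {n : ℕ} {P : Eu n → BasedPath} {z : Eu n → Circle} (hP : IsPlot P)
    (hz : IsPlot z) : IsPlot fun x => (P x).conj (z x) := by
  have h : SmoothSU2 fun y : Eu n × ℝ × ℝ => (P y.1 y.2.1).1 (Circle.exp y.2.2) := hP
  have hz : ContDiff ℝ ∞ fun x => (z x : ℂ) := hz
  exact h.conj (z := fun y => z y.1) (hz.comp contDiff_fst)

/-- The product on `Q` as a smooth map. -/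
def mulQMap : SmoothMap (Q.Total × Q.Total) Q.Total where
  toFun x := mulQ x.1 x.2
  smooth := by
    intro n p hp
    refine isPlot_of_eventuallyEq fun x => ?_
    obtain ⟨a, ha, hap⟩ := hp.1 x
    obtain ⟨b, hb, hbp⟩ := hp.2 x
    refine ⟨fun y => Quot.mk _ (mulPair (a y) (b y)), (quotMap qRel).smooth n
      (fun y => mulPair (a y) (b y)) ⟨isPlot_mul_path ha.1 hb.1, isPlot_mul_circle
        (isPlot_mul_circle ha.2 hb.2) (isPlot_exp
          (contDiff_const.mul (contDiff_c22Integral ha.1 hb.1)).neg)⟩, ?_⟩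
    filter_upwards [hap, hbp] with y h1 h2
    change _ = mulQ (p y).1 (p y).2
    rw [← h1, ← h2]
    rfl

/-- The action of `S¹` on `Q` over conjugation of loops, as a smooth map. -/
def conjQMap : SmoothMap (Circle × Q.Total) Q.Total where
  toFun x := conjQ x.1 x.2
  smooth := by
    intro n p hp
    refine isPlot_of_eventuallyEq fun x => ?_
    obtain ⟨a, ha, hap⟩ := hp.2 x
    refine ⟨fun y => Quot.mk _ ((a y).1.conj (p y).1, (a y).2), (quotMap qRel).smooth n
      (fun y => ((a y).1.conj (p y).1, (a y).2)) ⟨isPlot_conj_path ha.1 hp.1, ha.2⟩, ?_⟩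
    filter_upwards [hap] with y h1
    change _ = conjQ (p y).1 (p y).2
    rw [← h1]
    rfl

theorem conjQ_qPt (z : Circle) (σ : BasedPath) (w : Circle) :
    conjQ z (qPt σ w) = qPt (σ.conj z) w := rfl

theorem proj_conjQ (z : Circle) (a : Q.Total) : Q.proj (conjQ z a) = conjLG z (Q.proj a) := by
  obtain ⟨a, rfl⟩ := Quot.exists_rep a
  rfl

theorem conjQ_smul (z u : Circle) (a : Q.Total) : conjQ z (u • a) = u • conjQ z a := by
  obtain ⟨a, rfl⟩ := Quot.exists_rep a
  rfl

theorem conjQ_conjQ (z w : Circle) (a : Q.Total) : conjQ z (conjQ w a) = conjQ (z * w) a := by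
  obtain ⟨σ, v, rfl⟩ := exists_qPt a
  have e : (σ.conj w).conj z = σ.conj (z * w) := BasedPath.ext fun t => by
    change conjLG z (conjLG w (σ t)) = conjLG (z * w) (σ t)
    rw [map_mul]
    rfl
  rw [conjQ_qPt, conjQ_qPt, conjQ_qPt, e]

/-- The `C_{2,2}`-phase is invariant under simultaneous conjugation, so the circle acts by
automorphisms of the product. This is what makes horizontal and vertical faces commute upstairs. -/
theorem conjQ_mulQ (z : Circle) (a b : Q.Total) :
    conjQ z (mulQ a b) = mulQ (conjQ z a) (conjQ z b) := by
  obtain ⟨σ, w, rfl⟩ := exists_qPt a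
  obtain ⟨τ, v, rfl⟩ := exists_qPt b
  have e : (σ * τ).conj z = σ.conj z * τ.conj z := BasedPath.ext fun t =>
    map_mul (conjLG z) (σ t) (τ t)
  rw [mulQ_qPt, conjQ_qPt, conjQ_qPt, conjQ_qPt, mulQ_qPt, e, c22Integral_conj]

/-- The stabiliser of the points of `Q`. -/
def stabQ : Subgroup Circle := MulAction.stabilizer Circle
  (qPt ⟨fun _ => 1, SmoothSU2.const 1, rfl⟩ 1)

theorem exists_smul_Q {a b : Q.Total} (h : Q.proj a = Q.proj b) : ∃ u : Circle, b = u • a := by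
  obtain ⟨z, -, hz⟩ := Q_trans (n := 0) (p := fun _ => a) (q := fun _ => b) isPlot_const
    isPlot_const (fun _ => h) 0
  exact ⟨z 0, hz.self_of_nhds⟩

/-- Multiplication by an element of `Q` commutes with the circle action and moves `a` into the fibre
of `b`; within a fibre points differ by the commutative circle. So all stabilisers agree. -/
theorem smul_eq_self_of_smul_eq_self {z : Circle} {a : Q.Total} (h : z • a = a) (b : Q.Total) :
    z • b = b := by
  obtain ⟨c, hc⟩ := isSubduction_proj_Q.surjective (Q.proj b * (Q.proj a)⁻¹)
  obtain ⟨u, hu⟩ := exists_smul_Q (a := mulQ c a) (b := b) (by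
    rw [proj_mulQ, hc, inv_mul_cancel_right])
  rw [hu, smul_comm, ← mulQ_smul, h]

theorem isPrincipal_Q : Q.IsPrincipal stabQ where
  lift := isSubduction_proj_Q
  trans := Q_trans
  stab _ b := ⟨fun h => smul_eq_self_of_smul_eq_self h _,
    fun h => smul_eq_self_of_smul_eq_self (MulAction.mem_stabilizer_iff.1 h) b⟩

/-! ## The bisimplicial space over `NLG(*) ⋊ NS¹(*)` built from `Q` -/

instance : Mul Q.Total := ⟨mulQ⟩

/-- `Q^p × (S¹)^q`. -/
abbrev NQ (p q : ℕ) : Type := (Fin p → Q.Total) × (Fin q → Circle)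

def projN (p q : ℕ) : SmoothMap (NQ p q) (N p q) :=
  ⟨fun x => (fun k => Q.proj (x.1 k), x.2), fun n _ hP => ⟨fun k => Q.proj.smooth n _ (hP.1 k), hP.2⟩⟩

/-- Lets forms and maps on `N p q` be compared, and maps constructed, on `NQ p q`. -/
theorem isSubduction_projN (p q : ℕ) : IsSubduction (projN p q) := by
  intro n P hP x
  choose L hL hLe using fun k => isSubduction_proj_Q n (fun y => (P y).1 k) (hP.1 k) x
  refine ⟨fun y => (fun k => L k y, (P y).2), ⟨hL, hP.2⟩, ?_⟩
  filter_upwards [Filter.eventually_all.2 hLe] with y hy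
  exact Prod.ext (funext hy) rfl

def faceQ {p : ℕ} (q : ℕ) (i : Fin (p + 2)) : SmoothMap (NQ (p + 1) q) (NQ p q) :=
  ⟨fun x => (face i x.1, x.2), fun n _ hP => ⟨dSmooth_face mulQMap.smooth i n _ hP.1, hP.2⟩⟩

def faceSQ (p : ℕ) {q : ℕ} (i : Fin (q + 2)) : SmoothMap (NQ p (q + 1)) (NQ p q) :=
  ⟨fun x => (fun k => if i = Fin.last (q + 1) then conjQ (x.2 (Fin.last q)) (x.1 k) else x.1 k,
      face i x.2), by
    intro n P hP
    refine ⟨fun k => ?_, dSmooth_face dSmooth_mul_circle i n _ hP.2⟩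
    by_cases hi : i = Fin.last (q + 1)
    · simp only [Function.comp_apply, hi, if_true]
      exact conjQMap.smooth n (fun x => ((P x).2 (Fin.last q), (P x).1 k)) ⟨hP.2 _, hP.1 _⟩
    · simp only [Function.comp_apply, hi, if_false]
      exact hP.1 k⟩

theorem face_map {G H : Type} [Mul G] [Mul H] {f : G → H} (hf : ∀ a b, f (a * b) = f a * f b)
    {p : ℕ} (i : Fin (p + 2)) (g : Fin (p + 1) → G) (j : Fin p) :
    f (face i g j) = face i (fun k => f (g k)) j := by
  unfold face
  split_ifs <;> simp [hf]

theorem projN_faceQ {p : ℕ} (q : ℕ) (i : Fin (p + 2)) (x : NQ (p + 1) q) :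
    projN p q (faceQ q i x) = faceLG q i (projN (p + 1) q x) :=
  Prod.ext (funext fun j => face_map proj_mulQ i x.1 j) rfl

theorem projN_faceSQ (p : ℕ) {q : ℕ} (i : Fin (q + 2)) (x : NQ p (q + 1)) :
    projN p q (faceSQ p i x) = faceS p i (projN p (q + 1) x) := by
  refine Prod.ext (funext fun k => ?_) rfl
  change Q.proj (if i = Fin.last (q + 1) then conjQ (x.2 (Fin.last q)) (x.1 k) else x.1 k) =
    if i = Fin.last (q + 1) then conjLG (x.2 (Fin.last q)) (Q.proj (x.1 k)) else Q.proj (x.1 k)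
  split_ifs
  · exact proj_conjQ _ _
  · rfl

theorem projN_comp_faceQ {p : ℕ} (q : ℕ) (i : Fin (p + 2)) :
    (projN p q).comp (faceQ q i) = (faceLG q i).comp (projN (p + 1) q) :=
  SmoothMap.ext (projN_faceQ q i)

theorem projN_comp_faceSQ (p : ℕ) {q : ℕ} (i : Fin (q + 2)) :
    (projN p q).comp (faceSQ p i) = (faceS p i).comp (projN p (q + 1)) :=
  SmoothMap.ext (projN_faceSQ p i)

theorem pullback_projN_faceLG {p q k : ℕ} (i : Fin (p + 2)) (α : Om p q k) :
    pullback (projN (p + 1) q) (pullback (faceLG q i) α) =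
      pullback (faceQ q i) (pullback (projN p q) α) := by
  rw [pullback_comp, pullback_comp, projN_comp_faceQ]

theorem pullback_projN_faceS {p q k : ℕ} (i : Fin (q + 2)) (α : Om p q k) :
    pullback (projN p (q + 1)) (pullback (faceS p i) α) =
      pullback (faceSQ p i) (pullback (projN p q) α) := by
  rw [pullback_comp, pullback_comp, projN_comp_faceSQ]

/-- A vertical face applies one multiplicative map to every entry of `Q`: conjugation for the last
face, the identity otherwise. Such a map commutes with `face`. -/
theorem faceQ_faceSQ {p q : ℕ} (i : Fin (p + 2)) (j : Fin (q + 2)) :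
    (faceQ q i).comp (faceSQ (p + 1) j) = (faceSQ p j).comp (faceQ (q + 1) i) := by
  refine SmoothMap.ext fun x => Prod.ext (funext fun k => ?_) rfl
  exact (face_map (f := fun a : Q.Total =>
    if j = Fin.last (q + 1) then conjQ (x.2 (Fin.last q)) a else a) (fun a b => by
      split_ifs
      · exact conjQ_mulQ _ a b
      · rfl) i x.1 k).symm

/-- The identification of `Q` with the space in bidegree `(1, 0)`. -/
def toQ : SmoothMap (NQ 1 0) Q.Total := ⟨fun x => x.1 0, fun _ _ hp => hp.1 0⟩

theorem toLG_projN (x : NQ 1 0) : toLG (projN 1 0 x) = Q.proj (toQ x) := rfl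

theorem toLG_faceLG_projN (i : Fin 3) (x : NQ 2 0) :
    toLG (faceLG 0 i (projN 2 0 x)) = Q.proj (toQ (faceQ 0 i x)) := by
  rw [← toLG_projN, projN_faceQ]

theorem toLG_faceS_projN (i : Fin 2) (x : NQ 1 1) :
    toLG (faceS 1 i (projN 1 1 x)) = Q.proj (toQ (faceSQ 1 i x)) := by
  rw [← toLG_projN, projN_faceSQ]

/-! ### Simplicial identities in low degrees -/

theorem toQ_ext {X : Type} [DiffeologicalSpace X] {f g : SmoothMap X (NQ 1 0)}
    (h : ∀ x, toQ (f x) = toQ (g x)) : f = g :=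
  SmoothMap.ext fun x => Prod.ext (funext fun k => by rw [Subsingleton.elim k 0]; exact h x)
    (Subsingleton.elim _ _)

theorem faceSQ_fst_of_ne (p : ℕ) {q : ℕ} {i : Fin (q + 2)} (hi : i ≠ Fin.last (q + 1))
    (x : NQ p (q + 1)) (k : Fin p) : (faceSQ p i x).1 k = x.1 k := if_neg hi

theorem faceSQ_last_fst (p q : ℕ) (x : NQ p (q + 1)) (k : Fin p) :
    (faceSQ p (Fin.last (q + 1)) x).1 k = conjQ (x.2 (Fin.last q)) (x.1 k) := if_pos rfl

theorem toQ_faceSQ_zero (x : NQ 1 1) : toQ (faceSQ 1 0 x) = x.1 0 :=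
  faceSQ_fst_of_ne 1 (q := 0) (i := 0) (by decide) x 0

theorem toQ_faceSQ_one (x : NQ 1 1) : toQ (faceSQ 1 1 x) = conjQ (x.2 0) (x.1 0) :=
  faceSQ_last_fst 1 0 x 0

theorem faceSQ_zero_zero : (faceSQ 1 0).comp (faceSQ 1 (q := 1) 0) =
    (faceSQ 1 (q := 0) 0).comp (faceSQ 1 1) := toQ_ext fun x => by
  change toQ (faceSQ 1 0 (faceSQ 1 0 x)) = toQ (faceSQ 1 0 (faceSQ 1 1 x))
  rw [toQ_faceSQ_zero, toQ_faceSQ_zero, faceSQ_fst_of_ne 1 (by decide),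
    faceSQ_fst_of_ne 1 (by decide)]

theorem faceSQ_one_zero : (faceSQ 1 1).comp (faceSQ 1 (q := 1) 0) =
    (faceSQ 1 (q := 0) 0).comp (faceSQ 1 2) := toQ_ext fun x => by
  change toQ (faceSQ 1 1 (faceSQ 1 0 x)) = toQ (faceSQ 1 0 (faceSQ 1 2 x))
  rw [toQ_faceSQ_zero, toQ_faceSQ_one, faceSQ_fst_of_ne 1 (by decide)]
  exact (faceSQ_last_fst 1 1 x 0).symm

theorem faceSQ_one_one : (faceSQ 1 1).comp (faceSQ 1 (q := 1) 1) =
    (faceSQ 1 (q := 0) 1).comp (faceSQ 1 2) := toQ_ext fun x => by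
  change toQ (faceSQ 1 1 (faceSQ 1 1 x)) = toQ (faceSQ 1 1 (faceSQ 1 2 x))
  rw [toQ_faceSQ_one, toQ_faceSQ_one, faceSQ_fst_of_ne 1 (by decide)]
  exact (conjQ_conjQ (x.2 0) (x.2 1) (x.1 0)).symm.trans
    (congrArg (conjQ (x.2 0)) (faceSQ_last_fst 1 1 x 0).symm)

theorem faceQ_zero_zero : (faceQ 0 0).comp (faceQ 0 (p := 2) 0) =
    (faceQ 0 (p := 1) 0).comp (faceQ 0 1) := toQ_ext fun _ => rfl

theorem faceQ_one_zero : (faceQ 0 1).comp (faceQ 0 (p := 2) 0) =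
    (faceQ 0 (p := 1) 0).comp (faceQ 0 2) := toQ_ext fun _ => rfl

theorem faceQ_two_zero : (faceQ 0 2).comp (faceQ 0 (p := 2) 0) =
    (faceQ 0 (p := 1) 0).comp (faceQ 0 3) := toQ_ext fun _ => rfl

/-- The only one of the horizontal identities used here that needs associativity of `mulQ`. -/
theorem faceQ_one_one : (faceQ 0 1).comp (faceQ 0 (p := 2) 1) =
    (faceQ 0 (p := 1) 1).comp (faceQ 0 2) :=
  toQ_ext fun x => mulQ_assoc (x.1 0) (x.1 1) (x.1 2)

theorem faceQ_two_one : (faceQ 0 2).comp (faceQ 0 (p := 2) 1) =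
    (faceQ 0 (p := 1) 1).comp (faceQ 0 3) := toQ_ext fun _ => rfl

theorem faceQ_two_two : (faceQ 0 2).comp (faceQ 0 (p := 2) 2) =
    (faceQ 0 (p := 1) 2).comp (faceQ 0 3) := toQ_ext fun _ => rfl

/-! ## Points and smooth maps into pullbacks and tensor products -/

namespace CircleBundle
variable {M N X : Type} [DiffeologicalSpace M] [DiffeologicalSpace N] [DiffeologicalSpace X]

theorem pullbackPt_congr (B : CircleBundle M) (f : SmoothMap N M) {x x' : N} {q q' : B.Total}
    {h : f x = B.proj q} {h' : f x' = B.proj q'} {u : Circle} (hx : x' = x) (hq : q' = u • q) :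
    B.pullbackPt f x' q' h' = u • B.pullbackPt f x q h := Subtype.ext (Prod.ext hx hq)

theorem tensorPt_congr {S T : CircleBundle M} {s s' : S.Total} {t t' : T.Total}
    {h : S.proj s = T.proj t} {h' : S.proj s' = T.proj t'} {u v : Circle} (hs : s' = u • s)
    (ht : t' = v • t) : S.tensorPt T s' t' h' = (u * v) • S.tensorPt T s t h := by
  subst hs ht
  rw [tensorPt_smul_left u s (v • t) (by rw [T.proj_smul]; exact h), tensorPt_smul_right v s t h,
    mul_smul]

theorem smul_dual (B : CircleBundle M) {z : Circle} {a b : B.Total} (h : a = z • b) :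
    @Eq B.dual.Total a (@HSMul.hSMul Circle B.dual.Total B.dual.Total _ z⁻¹ b) :=
  h.trans (B.inv_smul_dual z b).symm

/-- The smooth map into a pullback bundle given by its two components. -/
def pullbackLift (B : CircleBundle M) (f : SmoothMap N M) (g : SmoothMap X N)
    (a : SmoothMap X B.Total) (h : ∀ x, f (g x) = B.proj (a x)) :
    SmoothMap X (B.pullback f).Total :=
  ⟨fun x => B.pullbackPt f (g x) (a x) (h x), fun n p hp => ⟨g.smooth n p hp, a.smooth n p hp⟩⟩

/-- The smooth map into a fibre product given by its two components. -/
def fibreProdLift {S T : CircleBundle M} (a : SmoothMap X S.Total) (b : SmoothMap X T.Total)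
    (h : ∀ x, S.proj (a x) = T.proj (b x)) : SmoothMap X (FibreProd S T) :=
  ⟨fun x => ⟨(a x, b x), h x⟩, fun n p hp => ⟨a.smooth n p hp, b.smooth n p hp⟩⟩

/-- The tensor product of smooth maps into two circle bundles. -/
def tensorLift (S T : CircleBundle M) (a : SmoothMap X S.Total) (b : SmoothMap X T.Total)
    (h : ∀ x, S.proj (a x) = T.proj (b x)) : SmoothMap X (S.tensor T).Total :=
  (S.tensorMap T).comp (fibreProdLift a b h)

theorem IsTensorConn.pullback_tensorLift {S T : CircleBundle M} {α : Form S.Total 1}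
    {β : Form T.Total 1} {Θ : Form (S.tensor T).Total 1} (hΘ : S.IsTensorConn T α β Θ)
    (a : SmoothMap X S.Total) (b : SmoothMap X T.Total) (h : ∀ x, S.proj (a x) = T.proj (b x)) :
    LoopTriple.pullback (S.tensorLift T a b h) Θ =
      LoopTriple.pullback a α + LoopTriple.pullback b β :=
  congrArg (LoopTriple.pullback (fibreProdLift a b h)) hΘ

end CircleBundle

/-! ## The sections `s_L` and `s_⋊` -/

def liftH (i : Fin 3) : SmoothMap (NQ 2 0) (QH i).Total :=
  Q.pullbackLift (toLG.comp (faceLG 0 i)) (projN 2 0) (toQ.comp (faceQ 0 i)) (toLG_faceLG_projN i)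

def liftV (i : Fin 2) : SmoothMap (NQ 1 1) (QV i).Total :=
  Q.pullbackLift (toLG.comp (faceS 1 i)) (projN 1 1) (toQ.comp (faceSQ 1 i)) (toLG_faceS_projN i)

/-- `(q₁, q₂) ↦ q₂ ⊗ (q₁q₂)^{⊗-1} ⊗ q₁`. -/
def liftDelta : SmoothMap (NQ 2 0) deltaQ.Total :=
  ((QH 0).tensor (QH 1).dual).tensorLift (QH 2)
    ((QH 0).tensorLift (QH 1).dual (liftH 0) (liftH 1) fun _ => rfl) (liftH 2) fun _ => rfl

/-- `(q, z) ↦ q^{⊗-1} ⊗ zqz⁻¹`. -/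
def liftSemi : SmoothMap (NQ 1 1) semiQ.Total :=
  (QV 0).dual.tensorLift (QV 1) (liftV 0) (liftV 1) fun _ => rfl

theorem deltaPt_congr {a a' : (QH 0).Total} {b b' : (QH 1).Total} {c c' : (QH 2).Total}
    {h₁ : (QH 0).proj a = (QH 1).dual.proj b} {h₁' : (QH 0).proj a' = (QH 1).dual.proj b'}
    {h₂ : (QH 0).proj a = (QH 2).proj c} {h₂' : (QH 0).proj a' = (QH 2).proj c'}
    {u v w : Circle} (ha : a' = u • a) (hb : b' = v • b) (hc : c' = w • c) :
    (((QH 0).tensor (QH 1).dual).tensorPt (QH 2) ((QH 0).tensorPt (QH 1).dual a' b' h₁') c' h₂' :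
      deltaQ.Total) = (u * v⁻¹ * w) •
    (((QH 0).tensor (QH 1).dual).tensorPt (QH 2) ((QH 0).tensorPt (QH 1).dual a b h₁) c h₂ :
      deltaQ.Total) :=
  CircleBundle.tensorPt_congr (CircleBundle.tensorPt_congr ha ((QH 1).smul_dual hb)) hc

/-- Replacing `(q₁, q₂)` by `(u q₁, v q₂)` multiplies the three tensor factors by `v`, `(uv)⁻¹` and
`u`. -/
theorem liftDelta_eq_of_projN {x y : NQ 2 0} (h : projN 2 0 x = projN 2 0 y) :
    liftDelta x = liftDelta y := by
  obtain ⟨u, hu⟩ := exists_smul_Q (congrFun (congrArg (fun w : N _ _ => w.1) h.symm) 0)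
  obtain ⟨v, hv⟩ := exists_smul_Q (congrFun (congrArg (fun w : N _ _ => w.1) h.symm) 1)
  have e0 : liftH 0 x = v • liftH 0 y := Q.pullbackPt_congr (toLG.comp (faceLG 0 0)) h hv
  have e1 : liftH 1 x = (u * v) • liftH 1 y := Q.pullbackPt_congr (toLG.comp (faceLG 0 1)) h (by
    change mulQ (x.1 0) (x.1 1) = (u * v) • mulQ (y.1 0) (y.1 1)
    rw [hu, hv, smul_mulQ, mulQ_smul, mul_smul])
  have e2 : liftH 2 x = u • liftH 2 y := Q.pullbackPt_congr (toLG.comp (faceLG 0 2)) h hu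
  refine (deltaPt_congr (h₁ := rfl) (h₂ := rfl) e0 e1 e2).trans ?_
  have : v * (u * v)⁻¹ * u = 1 := by
    rw [mul_right_comm, mul_comm v u, mul_inv_cancel]
  rw [this]
  exact one_smul _ _

/-- The phase `exp(-2πi∫C_{2,2})` of `mulQ` sits in the dual factor, so it emerges inverted: `q₂ ⊗
(q₁q₂)^{⊗-1} ⊗ q₁` is precisely the formula defining `s_L`. -/
theorem liftDelta_qPt {x : N 2 0} {σ₁ σ₂ : BasedPath}
    (h₀ : toLG (faceLG 0 0 x) = Q.proj (qPt σ₂ 1))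
    (h₁ : toLG (faceLG 0 1 x) = Q.proj (qPt (σ₁ * σ₂) 1))
    (h₂ : toLG (faceLG 0 2 x) = Q.proj (qPt σ₁ 1)) {y : NQ 2 0} (hy₁ : y.1 0 = qPt σ₁ 1)
    (hy₂ : y.1 1 = qPt σ₂ 1) (hx : projN 2 0 y = x) :
    liftDelta y = Circle.exp (2 * Real.pi * c22Integral σ₁ σ₂) •
      (((QH 0).tensor (QH 1).dual).tensorPt (QH 2)
        ((QH 0).tensorPt (QH 1).dual
          (Q.pullbackPt (toLG.comp (faceLG 0 0)) x (qPt σ₂ 1) h₀)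
          (Q.pullbackPt (toLG.comp (faceLG 0 1)) x (qPt (σ₁ * σ₂) 1) h₁) rfl)
        (Q.pullbackPt (toLG.comp (faceLG 0 2)) x (qPt σ₁ 1) h₂) rfl : deltaQ.Total) := by
  have e0 : liftH 0 y = (1 : Circle) • (
      Q.pullbackPt (toLG.comp (faceLG 0 0)) x (qPt σ₂ 1) h₀) :=
    Q.pullbackPt_congr (toLG.comp (faceLG 0 0)) hx (by rw [one_smul]; exact hy₂)
  have e1 : liftH 1 y = Circle.exp (-(2 * Real.pi * c22Integral σ₁ σ₂)) • (
      Q.pullbackPt (toLG.comp (faceLG 0 1)) x (qPt (σ₁ * σ₂) 1) h₁) :=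
    Q.pullbackPt_congr (toLG.comp (faceLG 0 1)) hx (by
      change mulQ (y.1 0) (y.1 1) = _
      rw [hy₁, hy₂, mulQ_qPt, qPt_smul, mul_one, one_mul, mul_one])
  have e2 : liftH 2 y = (1 : Circle) • (
      Q.pullbackPt (toLG.comp (faceLG 0 2)) x (qPt σ₁ 1) h₂) :=
    Q.pullbackPt_congr (toLG.comp (faceLG 0 2)) hx (by rw [one_smul]; exact hy₁)
  refine (deltaPt_congr (h₁ := rfl) (h₂ := rfl) e0 e1 e2).trans ?_
  rw [← Circle.exp_neg, neg_neg, one_mul, mul_one]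

theorem proj_liftDelta (y : NQ 2 0) : deltaQ.proj (liftDelta y) = projN 2 0 y := rfl

theorem exists_path_to (γ : LG) : ∃ σ : BasedPath, Q.proj (qPt σ 1) = γ := by
  obtain ⟨a, ha⟩ := isSubduction_proj_Q.surjective γ
  obtain ⟨σ, w, rfl⟩ := exists_qPt a
  exact ⟨σ, ha⟩

theorem IsSL.apply_projN {sL : SmoothMap (N 2 0) deltaQ.Total} (h : IsSL sL) (y : NQ 2 0) :
    sL (projN 2 0 y) = liftDelta y := by
  obtain ⟨σ₁, h₁⟩ := exists_path_to (Q.proj (y.1 0))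
  obtain ⟨σ₂, h₂⟩ := exists_path_to (Q.proj (y.1 1))
  -- The defining formula for `s_L` concerns only points of phase `1`; these are representatives
  -- over the same base point.
  let y' : NQ 2 0 := (![qPt σ₁ 1, qPt σ₂ 1], y.2)
  have hy' : projN 2 0 y' = projN 2 0 y := Prod.ext (funext fun k => by
    fin_cases k
    · exact h₁
    · exact h₂) rfl
  have h0 : toLG (faceLG 0 0 (projN 2 0 y)) = Q.proj (qPt σ₂ 1) := by
    rw [← hy']; exact toLG_faceLG_projN 0 y'
  have h1 : toLG (faceLG 0 1 (projN 2 0 y)) = Q.proj (qPt (σ₁ * σ₂) 1) := by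
    rw [← hy']; exact toLG_faceLG_projN 1 y'
  have h2 : toLG (faceLG 0 2 (projN 2 0 y)) = Q.proj (qPt σ₁ 1) := by
    rw [← hy']; exact toLG_faceLG_projN 2 y'
  exact (h.2 _ σ₁ σ₂ h0 h1 h2).trans ((liftDelta_qPt h0 h1 h2 rfl rfl hy').symm.trans
    (liftDelta_eq_of_projN hy'))

theorem existsUnique_isSL : ∃! sL, IsSL sL := by
  obtain ⟨s, hs⟩ := (isSubduction_projN 2 0).exists_factor liftDelta
    fun _ _ => liftDelta_eq_of_projN
  refine ⟨s, ⟨fun x => ?_, fun x σ₁ σ₂ h₀ h₁ h₂ => ?_⟩, fun s' hs' => SmoothMap.ext fun x => ?_⟩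
  · obtain ⟨y, rfl⟩ := (isSubduction_projN 2 0).surjective x
    rw [hs, proj_liftDelta]
  · have hx : projN 2 0 (![qPt σ₁ 1, qPt σ₂ 1], x.2) = x := Prod.ext (funext fun k => by
      fin_cases k
      · exact h₂.symm
      · exact h₀.symm) rfl
    rw [← liftDelta_qPt h₀ h₁ h₂ (y := (![qPt σ₁ 1, qPt σ₂ 1], x.2)) rfl rfl hx, ← hs, hx]
  · obtain ⟨y, rfl⟩ := (isSubduction_projN 2 0).surjective x
    rw [hs, hs'.apply_projN]

/-- The action on `Q` commutes with conjugation, so a change of `q` by `u` contributes `u⁻¹` in the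
dual factor and `u` in the other. -/
theorem liftSemi_eq_of_projN {x y : NQ 1 1} (h : projN 1 1 x = projN 1 1 y) :
    liftSemi x = liftSemi y := by
  obtain ⟨u, hu⟩ := exists_smul_Q (congrFun (congrArg (fun w : N _ _ => w.1) h.symm) 0)
  have hz : x.2 = y.2 := congrArg (fun w : N 1 1 => w.2) h
  have e0 : liftV 0 x = u • liftV 0 y := Q.pullbackPt_congr (toLG.comp (faceS 1 0)) h (by
    change toQ (faceSQ 1 0 x) = u • toQ (faceSQ 1 0 y)
    rw [toQ_faceSQ_zero, toQ_faceSQ_zero, hu])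
  have e1 : liftV 1 x = u • liftV 1 y := Q.pullbackPt_congr (toLG.comp (faceS 1 1)) h (by
    change toQ (faceSQ 1 1 x) = u • toQ (faceSQ 1 1 y)
    rw [toQ_faceSQ_one, toQ_faceSQ_one, hu, conjQ_smul, hz])
  refine (CircleBundle.tensorPt_congr (S := (QV 0).dual) (T := QV 1) (h := rfl) ((QV 0).smul_dual e0) e1).trans ?_
  rw [inv_mul_cancel]
  exact one_smul _ _

theorem liftSemi_eq_tensorPt {x : N 1 1} {g : Q.Total} (h₀ : toLG (faceS 1 0 x) = Q.proj g)
    (h₁ : toLG (faceS 1 1 x) = Q.proj (conjQ (x.2 0) g)) {y : NQ 1 1} (hy : y.1 0 = g)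
    (hx : projN 1 1 y = x) :
    liftSemi y = (QV 0).dual.tensorPt (QV 1)
      (Q.pullbackPt (toLG.comp (faceS 1 0)) x g h₀)
      (Q.pullbackPt (toLG.comp (faceS 1 1)) x (conjQ (x.2 0) g) h₁) rfl := by
  have e0 : liftV 0 y = Q.pullbackPt (toLG.comp (faceS 1 0)) x g h₀ :=
    Subtype.ext (Prod.ext hx ((toQ_faceSQ_zero y).trans hy))
  have e1 : liftV 1 y = Q.pullbackPt (toLG.comp (faceS 1 1)) x (conjQ (x.2 0) g) h₁ :=
    Subtype.ext (Prod.ext hx ((toQ_faceSQ_one y).trans (congrArg₂ conjQ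
      (congrFun (congrArg (fun w : N 1 1 => w.2) hx) 0) hy)))
  exact congrArg ((QV 0).dual.tensorMap (QV 1)) (Subtype.ext (Prod.ext e0 e1))

theorem faceS_fst_of_ne (p : ℕ) {q : ℕ} {i : Fin (q + 2)} (hi : i ≠ Fin.last (q + 1))
    (x : N p (q + 1)) (k : Fin p) : (faceS p i x).1 k = x.1 k := if_neg hi

theorem faceS_last_fst (p q : ℕ) (x : N p (q + 1)) (k : Fin p) :
    (faceS p (Fin.last (q + 1)) x).1 k = conjLG (x.2 (Fin.last q)) (x.1 k) := if_pos rfl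

theorem toLG_faceS_zero (x : N 1 1) : toLG (faceS 1 0 x) = x.1 0 :=
  faceS_fst_of_ne 1 (q := 0) (i := 0) (by decide) x 0

theorem toLG_faceS_one (x : N 1 1) : toLG (faceS 1 1 x) = conjLG (x.2 0) (x.1 0) :=
  faceS_last_fst 1 0 x 0

theorem IsSemi.apply_projN {s : SmoothMap (N 1 1) semiQ.Total} (h : IsSemi s) (y : NQ 1 1) :
    s (projN 1 1 y) = liftSemi y := by
  have h₀ : toLG (faceS 1 0 (projN 1 1 y)) = Q.proj (y.1 0) := toLG_faceS_zero _
  have h₁ : toLG (faceS 1 1 (projN 1 1 y)) = Q.proj (conjQ ((projN 1 1 y).2 0) (y.1 0)) :=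
    (toLG_faceS_one _).trans (proj_conjQ _ _).symm
  exact (h.2 _ _ h₀ h₁).trans (liftSemi_eq_tensorPt h₀ h₁ rfl rfl).symm

theorem existsUnique_isSemi : ∃! s, IsSemi s := by
  obtain ⟨s, hs⟩ := (isSubduction_projN 1 1).exists_factor liftSemi
    fun _ _ => liftSemi_eq_of_projN
  refine ⟨s, ⟨fun x => ?_, fun x g h₀ h₁ => ?_⟩, fun s' hs' => SmoothMap.ext fun x => ?_⟩
  · obtain ⟨y, rfl⟩ := (isSubduction_projN 1 1).surjective x
    rw [hs]
    rfl
  · have hx : projN 1 1 (fun _ => g, x.2) = x := Prod.ext (funext fun k => by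
      rw [Subsingleton.elim k 0]
      exact h₀.symm.trans (toLG_faceS_zero x)) rfl
    rw [← liftSemi_eq_tensorPt h₀ h₁ (y := (fun _ => g, x.2)) rfl hx, ← hs, hx]
  · obtain ⟨y, rfl⟩ := (isSubduction_projN 1 1).surjective x
    rw [hs, hs'.apply_projN]

/-! ## The induced connections -/

section
variable {θ : Form Q.Total 1}

theorem pullback_proj_c1 (hθ : Q.IsConnection θ) : pullback Q.proj (c1 θ) = kappa • extD θ :=
  hθ.isEquivariant.pullback_descend_extD isPrincipal_Q kappa

theorem isPrincipal_QH (i : Fin 3) : (QH i).IsPrincipal stabQ := isPrincipal_Q.pullback _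

theorem isPrincipal_QV (i : Fin 2) : (QV i).IsPrincipal stabQ := isPrincipal_Q.pullback _

theorem isEquivariant_thetaH (hθ : Q.IsConnection θ) (i : Fin 3) :
    (QH i).IsEquivariant (thetaH θ i) := hθ.isEquivariant.pullbackConn _

theorem isEquivariant_thetaV (hθ : Q.IsConnection θ) (i : Fin 2) :
    (QV i).IsEquivariant (thetaV θ i) := hθ.isEquivariant.pullbackConn _

theorem isTensorConn_deltaTheta01 (hθ : Q.IsConnection θ) :
    (QH 0).IsTensorConn (QH 1).dual (thetaH θ 0) ((QH 1).dualConn (thetaH θ 1))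
      (deltaTheta01 θ) :=
  CircleBundle.isTensorConn_tensorConn (isPrincipal_QH 0) (isPrincipal_QH 1).dual
    (isEquivariant_thetaH hθ 0) (isEquivariant_thetaH hθ 1).dualConn

theorem isTensorConn_deltaTheta (hθ : Q.IsConnection θ) :
    ((QH 0).tensor (QH 1).dual).IsTensorConn (QH 2) (deltaTheta01 θ) (thetaH θ 2)
      (deltaTheta θ) :=
  CircleBundle.isTensorConn_tensorConn ((isPrincipal_QH 0).tensor (isPrincipal_QH 1).dual)
    (isPrincipal_QH 2)
    ((isTensorConn_deltaTheta01 hθ).isEquivariant (isEquivariant_thetaH hθ 0))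
    (isEquivariant_thetaH hθ 2)

theorem isTensorConn_semiTheta (hθ : Q.IsConnection θ) :
    (QV 0).dual.IsTensorConn (QV 1) ((QV 0).dualConn (thetaV θ 0)) (thetaV θ 1)
      (semiTheta θ) :=
  CircleBundle.isTensorConn_tensorConn (isPrincipal_QV 0).dual (isPrincipal_QV 1)
    (isEquivariant_thetaV hθ 0).dualConn (isEquivariant_thetaV hθ 1)

/-! ## The forms on the bisimplicial space over `NLG(*) ⋊ NS¹(*)` -/

/-- `θ` in bidegree `(1, 0)`. -/
def thetaQ (θ : Form Q.Total 1) : Form (NQ 1 0) 1 := pullback toQ θ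

theorem pullback_projN_c1N (hθ : Q.IsConnection θ) :
    pullback (projN 1 0) (c1N θ) = kappa • extD (thetaQ θ) :=
  congrArg (pullback toQ) (pullback_proj_c1 hθ)

/-- Upstairs `s_L` is the tensor product of the tautological lifts, so the induced connection pulls
back to the alternating sum of the face pullbacks of `θ`. -/
theorem pullback_projN_betaForm (hθ : Q.IsConnection θ) {sL : SmoothMap (N 2 0) deltaQ.Total}
    (h : IsSL sL) : pullback (projN 2 0) (betaForm θ sL) =
      kappa • (pullback (faceQ 0 0) (thetaQ θ) - pullback (faceQ 0 1) (thetaQ θ)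
        + pullback (faceQ 0 2) (thetaQ θ)) := by
  have e : sL.comp (projN 2 0) = liftDelta := SmoothMap.ext h.apply_projN
  have e1 : pullback liftDelta (deltaTheta θ) =
      (pullback (liftH 0) (thetaH θ 0) + pullback (liftH 1) ((QH 1).dualConn (thetaH θ 1)) :
        Form (NQ 2 0) 1) + pullback (liftH 2) (thetaH θ 2) :=
    ((isTensorConn_deltaTheta hθ).pullback_tensorLift _ _ _).trans
      (congrArg (fun α : Form (NQ 2 0) 1 => α + pullback (liftH 2) (thetaH θ 2))
        ((isTensorConn_deltaTheta01 hθ).pullback_tensorLift _ _ _))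
  refine (congrArg (fun f => kappa • pullback f (deltaTheta θ)) e).trans
    (congrArg (fun α : Form (NQ 2 0) 1 => kappa • α) (e1.trans ?_))
  exact congrArg (fun α : Form (NQ 2 0) 1 => α + pullback (liftH 2) (thetaH θ 2))
    (sub_eq_add_neg (pullback (liftH 0) (thetaH θ 0)) (pullback (liftH 1) (thetaH θ 1))).symm

theorem pullback_projN_tau (hθ : Q.IsConnection θ) {s : SmoothMap (N 1 1) semiQ.Total}
    (h : IsSemi s) : pullback (projN 1 1) (tau θ s) =
      kappa • (-pullback (faceSQ 1 0) (thetaQ θ) + pullback (faceSQ 1 1) (thetaQ θ)) := by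
  have e : s.comp (projN 1 1) = liftSemi := SmoothMap.ext h.apply_projN
  exact (congrArg (fun f => kappa • pullback f (semiTheta θ)) e).trans
    (congrArg (fun α : Form (NQ 1 1) 1 => kappa • α)
      ((isTensorConn_semiTheta hθ).pullback_tensorLift _ _ _))

/-! ## The three conditions on `τ` -/

/-- Upstairs both sides are `κ(-ε₀^* + ε₁^*)dθ`. -/
theorem extD_tau (hθ : Q.IsConnection θ) {s : SmoothMap (N 1 1) semiQ.Total} (h : IsSemi s) :
    extD (tau θ s) = -pullback (faceS 1 0) (c1N θ) + pullback (faceS 1 1) (c1N θ) := by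
  refine (isSubduction_projN 1 1).pullback_injective ?_
  rw [pullback_extD, pullback_add, pullback_neg, pullback_projN_faceS, pullback_projN_faceS,
    pullback_projN_c1N hθ, pullback_projN_tau hθ h, extD_smul, extD_add, extD_neg]
  have key : ∀ {V : Type} [AddCommGroup V] [Module ℂ V] (a b : V),
      kappa • (-a + b) = -(kappa • a) + kappa • b := by
    intros
    module
  exact key (V := Form (NQ 1 1) 2) _ _

theorem pullback_faceLG_tau (hθ : Q.IsConnection θ) {sL : SmoothMap (N 2 0) deltaQ.Total}
    (hL : IsSL sL) {s : SmoothMap (N 1 1) semiQ.Total} (h : IsSemi s) :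
    pullback (faceLG 1 0) (tau θ s) - pullback (faceLG 1 1) (tau θ s)
        + pullback (faceLG 1 2) (tau θ s) =
      -pullback (faceS 2 0) (betaForm θ sL) + pullback (faceS 2 1) (betaForm θ sL) := by
  refine (isSubduction_projN 2 1).pullback_injective ?_
  rw [pullback_add, pullback_add, pullback_sub, pullback_neg, pullback_projN_faceS,
    pullback_projN_faceS, pullback_projN_faceLG, pullback_projN_faceLG, pullback_projN_faceLG,
    pullback_projN_betaForm hθ hL, pullback_projN_tau hθ h]
  -- Since the two kinds of faces commute, each side is the horizontal and vertical alternating sum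
  -- of `θ`, taken in either order.
  have c : ∀ (i : Fin 3) (j : Fin 2), pullback (faceQ 1 i) (pullback (faceSQ 1 j) (thetaQ θ)) =
      pullback (faceSQ 2 j) (pullback (faceQ 0 i) (thetaQ θ)) := fun i j => by
    rw [pullback_comp, pullback_comp, faceQ_faceSQ]
  simp only [pullback_smul, pullback_add, pullback_sub, pullback_neg, c]
  have key : ∀ {V : Type} [AddCommGroup V] [Module ℂ V] (a b c d e f : V),
      kappa • (-a + b) - kappa • (-c + d) + kappa • (-e + f) =
        -(kappa • (a - c + e)) + kappa • (b - d + f) := by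
    intros
    module
  exact key (V := Form (NQ 2 1) 1) _ _ _ _ _ _

/-- Upstairs this is the vertical differential applied twice; the simplicial identities leave three
terms, each occurring twice with opposite signs. -/
theorem pullback_faceS_tau (hθ : Q.IsConnection θ) {s : SmoothMap (N 1 1) semiQ.Total}
    (h : IsSemi s) : -pullback (faceS 1 0) (tau θ s) + pullback (faceS 1 1) (tau θ s)
      - pullback (faceS 1 2) (tau θ s) = 0 := by
  refine (isSubduction_projN 1 2).pullback_injective ?_
  rw [pullback_sub, pullback_add, pullback_neg, pullback_projN_faceS, pullback_projN_faceS,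
    pullback_projN_faceS, pullback_projN_tau hθ h]
  simp only [pullback_smul, pullback_add, pullback_neg, pullback_comp, faceSQ_zero_zero,
    faceSQ_one_zero, faceSQ_one_one, pullback_zero]
  have key : ∀ {V : Type} [AddCommGroup V] [Module ℂ V] (a b c : V),
      -(kappa • (-a + b)) + kappa • (-a + c) - kappa • (-b + c) = 0 := by
    intros
    module
  exact key (V := Form (NQ 1 2) 1) _ _ _

/-- The horizontal differential applied twice: six terms cancel in pairs, one pair through
associativity of `mulQ`. -/
theorem dH_betaForm (hθ : Q.IsConnection θ) {sL : SmoothMap (N 2 0) deltaQ.Total}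
    (hL : IsSL sL) : pullback (faceLG 0 0) (betaForm θ sL) - pullback (faceLG 0 1) (betaForm θ sL)
      + pullback (faceLG 0 2) (betaForm θ sL) - pullback (faceLG 0 3) (betaForm θ sL) = 0 := by
  refine (isSubduction_projN 3 0).pullback_injective ?_
  rw [pullback_sub, pullback_add, pullback_sub, pullback_projN_faceLG, pullback_projN_faceLG,
    pullback_projN_faceLG, pullback_projN_faceLG, pullback_projN_betaForm hθ hL]
  simp only [pullback_smul, pullback_add, pullback_sub, pullback_comp, faceQ_zero_zero,
    faceQ_one_zero, faceQ_two_zero, faceQ_one_one, faceQ_two_one, faceQ_two_two, pullback_zero]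
  have key : ∀ {V : Type} [AddCommGroup V] [Module ℂ V] (a b c d e f : V),
      kappa • (a - b + c) - kappa • (a - d + e) + kappa • (b - d + f) - kappa • (c - e + f) = 0 := by
    intros
    module
  exact key (V := Form (NQ 3 0) 1) _ _ _ _ _ _

theorem extD_betaForm (hθ : Q.IsConnection θ) {sL : SmoothMap (N 2 0) deltaQ.Total}
    (hL : IsSL sL) : extD (betaForm θ sL) = pullback (faceLG 0 0) (c1N θ)
      - pullback (faceLG 0 1) (c1N θ) + pullback (faceLG 0 2) (c1N θ) := by
  refine (isSubduction_projN 2 0).pullback_injective ?_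
  rw [pullback_extD, pullback_add, pullback_sub, pullback_projN_faceLG, pullback_projN_faceLG,
    pullback_projN_faceLG, pullback_projN_c1N hθ, pullback_projN_betaForm hθ hL, extD_smul,
    extD_add, extD_sub]
  simp only [pullback_smul, pullback_extD]
  have key : ∀ {V : Type} [AddCommGroup V] [Module ℂ V] (a b c : V),
      kappa • (a - b + c) = kappa • a - kappa • b + kappa • c := by
    intros
    module
  exact key (V := Form (NQ 2 0) 2) _ _ _

theorem extD_c1N (hθ : Q.IsConnection θ) : extD (c1N θ) = 0 := by
  refine (isSubduction_projN 1 0).pullback_injective ?_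
  rw [pullback_extD, pullback_projN_c1N hθ, extD_smul, extD_extD, pullback_zero]
  exact smul_zero _

end

/-! ## The cocycle condition -/

theorem dH_zero {p q r : ℕ} : dH (0 : Om p q r) = 0 :=
  Finset.sum_eq_zero fun i _ => smul_zero ((-1 : ℂ) ^ i.val)

theorem dV_zero {p q r : ℕ} : dV (0 : Om p q r) = 0 :=
  (congrArg (fun α : Om p (q + 1) r => (-1 : ℂ) ^ p • α)
    (Finset.sum_eq_zero fun i _ => smul_zero ((-1 : ℂ) ^ i.val))).trans (smul_zero _)

theorem dF_zero {p q r : ℕ} : dF (0 : Om p q r) = 0 :=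
  (congrArg (fun α : Om p q (r + 1) => (-1 : ℂ) ^ (p + q) • α) extD_zero).trans (smul_zero _)

theorem totH_eq_zero {K : Tot} {p q r : ℕ} (h : ∀ p', p = p' + 1 → K p' q r = 0) :
    totH K p q r = 0 := by
  cases p with
  | zero => rfl
  | succ p => exact (congrArg dH (h p rfl)).trans dH_zero

theorem totV_eq_zero {K : Tot} {p q r : ℕ} (h : ∀ q', q = q' + 1 → K p q' r = 0) :
    totV K p q r = 0 := by
  cases q with
  | zero => rfl
  | succ q => exact (congrArg dV (h q rfl)).trans dV_zero

theorem totF_eq_zero {K : Tot} {p q r : ℕ} (h : ∀ r', r = r' + 1 → K p q r' = 0) :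
    totF K p q r = 0 := by
  cases r with
  | zero => rfl
  | succ r => exact (congrArg dF (h r rfl)).trans dF_zero

theorem dH_one {q r : ℕ} (α : Om 1 q r) : dH α =
    pullback (faceLG q 0) α - pullback (faceLG q 1) α + pullback (faceLG q 2) α := by
  have key : ∀ {V : Type} [AddCommGroup V] [Module ℂ V] (a : Fin 3 → V),
      ∑ i, (-1 : ℂ) ^ i.val • a i = a 0 - a 1 + a 2 := by
    intro V _ _ a
    rw [Fin.sum_univ_three]
    simp [sub_eq_add_neg]
  exact key (V := Om 2 q r) fun i => pullback (faceLG q i) α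

theorem dH_two {q r : ℕ} (α : Om 2 q r) : dH α = pullback (faceLG q 0) α
    - pullback (faceLG q 1) α + pullback (faceLG q 2) α - pullback (faceLG q 3) α := by
  have key : ∀ {V : Type} [AddCommGroup V] [Module ℂ V] (a : Fin 4 → V),
      ∑ i, (-1 : ℂ) ^ i.val • a i = a 0 - a 1 + a 2 - a 3 := by
    intro V _ _ a
    rw [Fin.sum_univ_four]
    simp [sub_eq_add_neg, pow_succ]
  exact key (V := Om 3 q r) fun i => pullback (faceLG q i) α

theorem dV_one_zero {r : ℕ} (α : Om 1 0 r) : dV α =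
    -pullback (faceS 1 0) α + pullback (faceS 1 1) α := by
  have key : ∀ {V : Type} [AddCommGroup V] [Module ℂ V] (a : Fin 2 → V),
      (-1 : ℂ) ^ 1 • ∑ i, (-1 : ℂ) ^ i.val • a i = -a 0 + a 1 := by
    intro V _ _ a
    rw [Fin.sum_univ_two]
    simp
  exact key (V := Om 1 1 r) fun i => pullback (faceS 1 i) α

theorem dV_two_zero {r : ℕ} (α : Om 2 0 r) : dV α =
    pullback (faceS 2 0) α - pullback (faceS 2 1) α := by
  have key : ∀ {V : Type} [AddCommGroup V] [Module ℂ V] (a : Fin 2 → V),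
      (-1 : ℂ) ^ 2 • ∑ i, (-1 : ℂ) ^ i.val • a i = a 0 - a 1 := by
    intro V _ _ a
    rw [Fin.sum_univ_two]
    simp [sub_eq_add_neg]
  exact key (V := Om 2 1 r) fun i => pullback (faceS 2 i) α

theorem dV_one_one {r : ℕ} (α : Om 1 1 r) : dV α =
    -pullback (faceS 1 0) α + pullback (faceS 1 1) α - pullback (faceS 1 2) α := by
  have key : ∀ {V : Type} [AddCommGroup V] [Module ℂ V] (a : Fin 3 → V),
      (-1 : ℂ) ^ 1 • ∑ i, (-1 : ℂ) ^ i.val • a i = -a 0 + a 1 - a 2 := by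
    intro V _ _ a
    rw [Fin.sum_univ_three]
    simp
    abel
  exact key (V := Om 1 2 r) fun i => pullback (faceS 1 i) α

theorem form_add_neg {X : Type} [DiffeologicalSpace X] {k : ℕ} (α : Form X k) : α + -α = 0 :=
  add_neg_cancel α

theorem form_neg_zero {X : Type} [DiffeologicalSpace X] {k : ℕ} : -(0 : Form X k) = 0 :=
  neg_zero (G := Form X k)

/-- Both `β` and `τ` lie in bidegrees with `p + q = 2`, so their de Rham differentials carry no
sign; `c₁(θ)` has `p + q = 1`, but it is closed. -/
theorem dF_even {p q r : ℕ} (h : Even (p + q)) (α : Om p q r) : dF α = extD α := by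
  rw [dF, h.neg_one_pow]
  exact one_smul ℂ (extD α)

section
variable {θ : Form Q.Total 1} {sL : SmoothMap (N 2 0) deltaQ.Total}
  {s : SmoothMap (N 1 1) semiQ.Total}

theorem tripleCocycle_eq_zero {p q r : ℕ} (h₁ : ¬(p = 1 ∧ q = 0 ∧ r = 2))
    (h₂ : ¬(p = 2 ∧ q = 0 ∧ r = 1)) (h₃ : ¬(p = 1 ∧ q = 1 ∧ r = 1)) :
    tripleCocycle θ sL s p q r = 0 := by
  unfold tripleCocycle
  split
  · unfold ddCocycle
    split
    · exact absurd ⟨rfl, rfl, rfl⟩ h₁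
    · exact absurd ⟨rfl, rfl, rfl⟩ h₂
    · rfl
  · exact absurd ⟨rfl, rfl, rfl⟩ h₃
  · rfl

theorem isDegree_tripleCocycle : IsDegree 3 (tripleCocycle θ sL s) := fun p q r h =>
  tripleCocycle_eq_zero (by omega) (by omega) (by omega)

theorem dF_c1N (hθ : Q.IsConnection θ) : dF (c1N θ) = 0 := by
  rw [dF, extD_c1N hθ]
  exact smul_zero _

theorem dH_c1N_add (hθ : Q.IsConnection θ) (hL : IsSL sL) :
    dH (c1N θ) + dF (-betaForm θ sL) = 0 := by
  rw [dH_one, dF_even (by decide), extD_neg, extD_betaForm hθ hL, form_add_neg]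

theorem dH_neg_betaForm (hθ : Q.IsConnection θ) (hL : IsSL sL) : dH (-betaForm θ sL) = 0 := by
  have e : dH (-betaForm θ sL) = -(pullback (faceLG 0 0) (betaForm θ sL)
      - pullback (faceLG 0 1) (betaForm θ sL) + pullback (faceLG 0 2) (betaForm θ sL)
      - pullback (faceLG 0 3) (betaForm θ sL)) := by
    rw [dH_two]
    simp only [pullback_neg]
    abel
  rw [e, dH_betaForm hθ hL, form_neg_zero]

theorem dV_c1N_add (hθ : Q.IsConnection θ) (h : IsSemi s) :
    dV (c1N θ) + dF (-tau θ s) = 0 := by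
  rw [dV_one_zero, dF_even (by decide), extD_neg, extD_tau hθ h, form_add_neg]

theorem dH_neg_tau_add (hθ : Q.IsConnection θ) (hL : IsSL sL) (h : IsSemi s) :
    dH (-tau θ s) + dV (-betaForm θ sL) = 0 := by
  have e : dH (-tau θ s) = -(pullback (faceLG 1 0) (tau θ s) - pullback (faceLG 1 1) (tau θ s)
      + pullback (faceLG 1 2) (tau θ s)) := by
    rw [dH_one]
    simp only [pullback_neg]
    abel
  rw [e, dV_two_zero, pullback_faceLG_tau hθ hL h]
  simp only [pullback_neg]
  abel

theorem dV_neg_tau (hθ : Q.IsConnection θ) (h : IsSemi s) : dV (-tau θ s) = 0 := by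
  have e : dV (-tau θ s) = -(-pullback (faceS 1 0) (tau θ s) + pullback (faceS 1 1) (tau θ s)
      - pullback (faceS 1 2) (tau θ s)) := by
    rw [dV_one_one]
    simp only [pullback_neg]
    abel
  rw [e, pullback_faceS_tau hθ h, form_neg_zero]

/-- Three nonzero components can reach only six tri-degrees of total degree 4. Each of the six is
one of the preceding identities; elsewhere every contribution vanishes. -/
theorem totD_tripleCocycle (hθ : Q.IsConnection θ) (hL : IsSL sL) (h : IsSemi s) :
    totD (tripleCocycle θ sL s) = 0 := by
  funext p q r
  change totH _ p q r + totV _ p q r + totF _ p q r = 0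
  by_cases h₁ : p = 1 ∧ q = 0 ∧ r = 3
  · obtain ⟨rfl, rfl, rfl⟩ := h₁
    rw [totH_eq_zero fun p' _ => tripleCocycle_eq_zero (by omega) (by omega) (by omega),
      totV_eq_zero fun q' _ => tripleCocycle_eq_zero (by omega) (by omega) (by omega), zero_add,
      zero_add]
    exact dF_c1N hθ
  by_cases h₂ : p = 2 ∧ q = 0 ∧ r = 2
  · obtain ⟨rfl, rfl, rfl⟩ := h₂
    rw [totV_eq_zero fun q' _ => tripleCocycle_eq_zero (by omega) (by omega) (by omega), add_zero]
    exact dH_c1N_add hθ hL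
  by_cases h₃ : p = 3 ∧ q = 0 ∧ r = 1
  · obtain ⟨rfl, rfl, rfl⟩ := h₃
    rw [totV_eq_zero fun q' _ => tripleCocycle_eq_zero (by omega) (by omega) (by omega),
      totF_eq_zero fun r' _ => tripleCocycle_eq_zero (by omega) (by omega) (by omega), add_zero,
      add_zero]
    exact dH_neg_betaForm hθ hL
  by_cases h₄ : p = 1 ∧ q = 1 ∧ r = 2
  · obtain ⟨rfl, rfl, rfl⟩ := h₄
    rw [totH_eq_zero fun p' _ => tripleCocycle_eq_zero (by omega) (by omega) (by omega), zero_add]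
    exact dV_c1N_add hθ h
  by_cases h₅ : p = 2 ∧ q = 1 ∧ r = 1
  · obtain ⟨rfl, rfl, rfl⟩ := h₅
    rw [totF_eq_zero fun r' _ => tripleCocycle_eq_zero (by omega) (by omega) (by omega), add_zero]
    exact dH_neg_tau_add hθ hL h
  by_cases h₆ : p = 1 ∧ q = 2 ∧ r = 1
  · obtain ⟨rfl, rfl, rfl⟩ := h₆
    rw [totH_eq_zero fun p' _ => tripleCocycle_eq_zero (by omega) (by omega) (by omega),
      totF_eq_zero fun r' _ => tripleCocycle_eq_zero (by omega) (by omega) (by omega), zero_add,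
      add_zero]
    exact dV_neg_tau hθ h
  rw [totH_eq_zero fun p' _ => tripleCocycle_eq_zero (by omega) (by omega) (by omega),
    totV_eq_zero fun q' _ => tripleCocycle_eq_zero (by omega) (by omega) (by omega),
    totF_eq_zero fun r' _ => tripleCocycle_eq_zero (by omega) (by omega) (by omega), zero_add,
    zero_add]

end

end LoopTriple

end

open LoopTriple

theorem mainTheorem3 (θ : Form Q.Total 1) (hθ : Q.IsConnection θ) :
    -- the form `c₁(θ)` and the induced connections are well defined
    (pullback Q.proj (c1 θ) = kappa • extD θ ∧
      (QH 0).IsTensorConn (QH 1).dual (thetaH θ 0) ((QH 1).dualConn (thetaH θ 1))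
        (deltaTheta01 θ) ∧
      ((QH 0).tensor (QH 1).dual).IsTensorConn (QH 2) (deltaTheta01 θ) (thetaH θ 2)
        (deltaTheta θ) ∧
      (QV 0).dual.IsTensorConn (QV 1) ((QV 0).dualConn (thetaV θ 0)) (thetaV θ 1)
        (semiTheta θ)) ∧
    -- the sections `s_L` and `s_⋊` exist, are smooth and are uniquely determined
    (∃! sL, IsSL sL) ∧ (∃! s, IsSemi s) ∧
    ∀ sL s, IsSL sL → IsSemi s →
      -- the three conditions on `τ`
      extD (tau θ s) =
        -pullback (faceS 1 0) (c1N θ) + pullback (faceS 1 1) (c1N θ) ∧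
      pullback (faceLG 1 0) (tau θ s) - pullback (faceLG 1 1) (tau θ s)
          + pullback (faceLG 1 2) (tau θ s) =
        -pullback (faceS 2 0) (betaForm θ sL) + pullback (faceS 2 1) (betaForm θ sL) ∧
      -pullback (faceS 1 0) (tau θ s) + pullback (faceS 1 1) (tau θ s)
          - pullback (faceS 1 2) (tau θ s) = 0 ∧
      -- the resulting 3-cocycle of the triple complex, extending the one of the loop group
      IsDegree 3 (tripleCocycle θ sL s) ∧
      totD (tripleCocycle θ sL s) = 0 ∧
      ∀ p r, tripleCocycle θ sL s p 0 r = ddCocycle θ sL p r := by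
  refine ⟨⟨pullback_proj_c1 hθ, isTensorConn_deltaTheta01 hθ, isTensorConn_deltaTheta hθ,
    isTensorConn_semiTheta hθ⟩, existsUnique_isSL, existsUnique_isSemi, fun sL s hL h => ?_⟩
  exact ⟨extD_tau hθ h, pullback_faceLG_tau hθ hL h, pullback_faceS_tau hθ h,
    isDegree_tripleCocycle, totD_tripleCocycle hθ hL h, fun p r => rfl⟩
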